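/- **Setting.** Let $p\ge 2$. On $\mathbb C^{p+1}=\{(z,w):z\in\mathbb C^p,\,w\in\mathbb C\}$ consider the Hermitian form $\sum_i z_i\overline{z_i'}-w\overline{w'}$, its isometry group $\mathrm U(p,1)$ with Lie algebra $\mathfrak u(p,1)$, the maximal compact subgroup $K=\mathrm U(p)\times\mathrm U(1)$, and the light cone $X^0=\{(z,w)\ne 0:\sum_i|z_i|^2=|w|^2\}$. For $\alpha,\beta\in\mathbb C$ with $\alpha-\beta\in\mathbb Z$ let $$S^{\alpha,\beta}(X^0)=\{f\in C^\infty(X^0): f(tx)=|t|^{\alpha+\beta}(t/|t|)^{\alpha-\beta}f(x)\ \text{ for all } t\in\mathbb C^\times,\ x\in X^0\},$$ with $\mathrm U(p,1)$ acting by $(gf)(x)=f(g^{-1}x)$. Module structure and unitarity are understood infinitesimally: *submodule* means $(\mathfrak u(p,1),K)$-submodule of the space of $K$-finite vectors of $S^{\alpha,\beta}(X^0)$; *irreducible* refers to these submodules; *unitary* means that the $K$-finite vectors carry a positive definite Hermitian form which is $K$-invariant and for which $\mathfrak u(p,1)$ acts by skew-adjoint operators. **$K$-types.** For integers $m_1,m_2\ge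 0$ let $\mathcal H^{m_1,m_2}(\mathbb C^p)$ be the space of harmonic polynomials of degree $m_1$ in $z$ and $m_2$ in $\bar z$, put $n=\alpha-\beta-m_1+m_2\in\mathbb Z$, and let $V_{m_1,m_2}\subseteq S^{\alpha,\beta}(X^0)$ be the span of the functions $h(z)\,w^{n}\,(\sum_i|z_i|^2)^b$ (with $\bar w^{-n}$ in place of $w^n$ if $n<0$), where $h\in\mathcal H^{m_1,m_2}(\mathbb C^p)$ and $m_1+m_2+|n|+2b=\alpha+\beta$. Draw $V_{m_1,m_2}$ at the point $(x,y)=(m_1+m_2,\,n)$ of the plane. **Barriers.** For $\alpha,\beta\in\mathbb Z$ let $$A^{++}=\alpha+\beta-x-y,\quad A^{+-}=\alpha+\beta-x+y,\quad A^{-+}=\alpha+\beta+x-y+2p-2,\quad A^{--}=\alpha+\beta+x+y+2p-2.$$ The barrier $A^{\pm\pm}$ is the line $A^{\pm\pm}(x,y)=0$. It *causes reducibility* if it passes through a $K$-type and the $K$-types with $A^{\pm\pm}(x,y)\ge 0$ span a nonzero proper submodule. **Result.** (1) Let $\alpha,\beta\in\mathbb Z$. (a) $A^{++}$ causes reducibility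 if and only if $\beta\ge 0$; (b) $A^{+-}$ if and only if $\alpha\ge 0$; (c) $A^{-+}$ if and only if $\beta\le -p$; (d) $A^{--}$ if and only if $\alpha\le -p$. (2) Let $\alpha,\beta\in\mathbb Z$. In each case below the submodules of $S^{\alpha,\beta}(X^0)$ correspond, as a lattice, to the lower sets of the indicated poset of constituents, a lower set corresponding to the span of the $K$-types of its constituents. A constituent is given by the set of its $K$-types $(m_1,m_2)$; all constituents are infinite-dimensional except where stated. * $-p<\alpha<0$, $-p<\beta<0$: one point; $S^{\alpha,\beta}(X^0)$ is irreducible and unitary. * $\alpha\ge 0$, $-p<\beta<0$: a chain of two points, the lower one being $\{m_1\le\alpha\}$. * $-p<\alpha<0$, $\beta\ge 0$: a chain of two points, the lower one being $\{m_2\le\beta\}$. * $-p<\alpha<0$, $\beta\le -p$: a chain of two points, the lower one being $\{m_1\ge 1-p-\beta\}$. * $\alpha\le -p$, $-p<\beta<0$: a chain of two points, the lower one being $\{m_2\ge 1-p-\alpha\}$. * $\alpha,\beta\ge 0$: a product of two chains of two points, with coordinates deciding $m_1\le\alpha$ (lower) or $m_1>\alpha$, and $m_2\le\beta$ (lower)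 or $m_2>\beta$; the least constituent, and only it, is finite-dimensional. * $\alpha,\beta\le -p$: a product of two chains of two points, with coordinates deciding $m_1\ge 1-p-\beta$ (lower) or $m_1<1-p-\beta$, and $m_2\ge 1-p-\alpha$ (lower) or $m_2<1-p-\alpha$; the greatest constituent, and only it, is finite-dimensional. * $\alpha\ge 0$, $\beta\le -p$: if $\alpha+\beta>-p$, two incomparable points $\{m_1>\alpha\}$ and $\{m_1<1-p-\beta\}$ above a least point $\{1-p-\beta\le m_1\le\alpha\}$; if $\alpha+\beta<-p$, two incomparable points $\{m_1\le\alpha\}$ and $\{m_1\ge 1-p-\beta\}$ below a greatest point $\{\alpha<m_1<1-p-\beta\}$; if $\alpha+\beta=-p$, just two incomparable points $\{m_1\le\alpha\}$ and $\{m_1>\alpha\}$. * $\alpha\le -p$, $\beta\ge 0$: the same three descriptions with $m_2$ in place of $m_1$ and with $\alpha$ and $\beta$ interchanged. (3) For all $\alpha,\beta\in\mathbb C$ with $\alpha-\beta\in\mathbb Z$ and $\operatorname{Re}(\alpha+\beta)=-p$ (the unitary axis), $S^{\alpha,\beta}(X^0)$ is unitary. (4) Suppose that $\alpha-\beta\in\mathbb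 Z$, $|\alpha-\beta|<p$ and $\alpha+\beta\in\mathbb R$. Then $S^{\alpha,\beta}(X^0)$ is unitary if and only if $|\alpha+\beta+p|<p-|\alpha-\beta|$, and in this range it is irreducible; so the complementary series has length $p-|\alpha-\beta|$ on each side of the unitary axis. (5) In particular, for $\alpha=\beta=s\in\mathbb R$, $S^{s,s}(X^0)$ is unitary if and only if $-p<s<0$, and in this range it is irreducible. At $\alpha=\beta=0$ the constant functions form a submodule, on which $\mathrm U(p,1)$ acts trivially and which is contained in every nonzero submodule. -/

import Mathlib

open Matrix MvPolynomial
open scoped ContDiff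

noncomputable section

namespace LightCone

/-! ### The group U(p,1), its Lie algebra and the light cone -/

/-- Coordinates on `ℂ^{p+1} = ℂ^p ⊕ ℂ`: `Sum.inl i` is the index of `z_i`, `Sum.inr ()` that of `w`. -/
abbrev Idx (p : ℕ) : Type := Fin p ⊕ Unit

/-- The Gram matrix `diag(1, …, 1, -1)` of the Hermitian form
`((z,w),(z',w')) = ∑ z_i conj(z'_i) - w conj(w')`. -/
def gram (p : ℕ) : Matrix (Idx p) (Idx p) ℂ :=
  Matrix.diagonal (Sum.elim (fun _ => 1) (fun _ => -1))

/-- The indefinite unitary group `U(p,1)`, the linear isometries of the Hermitian form. -/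
def U (p : ℕ) : Subgroup (GL (Idx p) ℂ) where
  carrier := {g | (g : Matrix (Idx p) (Idx p) ℂ)ᴴ * gram p * (g : Matrix (Idx p) (Idx p) ℂ) = gram p}
  one_mem' := by simp
  mul_mem' := by
    intro g h hg hh
    simp only [Set.mem_ofPred_eq] at hg hh ⊢
    rw [Units.val_mul, conjTranspose_mul]
    calc _ = (h : Matrix (Idx p) (Idx p) ℂ)ᴴ *
          ((g : Matrix (Idx p) (Idx p) ℂ)ᴴ * gram p * (g : Matrix (Idx p) (Idx p) ℂ)) *
          (h : Matrix (Idx p) (Idx p) ℂ) := by simp only [Matrix.mul_assoc]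
      _ = _ := by rw [hg, hh]
  inv_mem' := by
    intro g hg
    simp only [Set.mem_ofPred_eq] at hg ⊢
    have h1 : (g : Matrix (Idx p) (Idx p) ℂ) * ((g⁻¹ : GL (Idx p) ℂ) : Matrix (Idx p) (Idx p) ℂ) = 1 :=
      Units.mul_inv g
    have h2 : ((g⁻¹ : GL (Idx p) ℂ) : Matrix (Idx p) (Idx p) ℂ)ᴴ *
        (g : Matrix (Idx p) (Idx p) ℂ)ᴴ = 1 := by
      rw [← conjTranspose_mul, h1, conjTranspose_one]
    calc _ = ((g⁻¹ : GL (Idx p) ℂ) : Matrix (Idx p) (Idx p) ℂ)ᴴ *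
          ((g : Matrix (Idx p) (Idx p) ℂ)ᴴ * gram p * (g : Matrix (Idx p) (Idx p) ℂ)) *
          ((g⁻¹ : GL (Idx p) ℂ) : Matrix (Idx p) (Idx p) ℂ) := by rw [hg]
      _ = (((g⁻¹ : GL (Idx p) ℂ) : Matrix (Idx p) (Idx p) ℂ)ᴴ *
          (g : Matrix (Idx p) (Idx p) ℂ)ᴴ) * gram p * ((g : Matrix (Idx p) (Idx p) ℂ) *
          ((g⁻¹ : GL (Idx p) ℂ) : Matrix (Idx p) (Idx p) ℂ)) := by
          simp only [Matrix.mul_assoc]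
      _ = gram p := by rw [h1, h2]; simp

/-- The maximal compact subgroup `K = U(p) × U(1)` of `U(p,1)`: the elements that preserve
the decomposition `ℂ^{p+1} = ℂ^p ⊕ ℂ`. -/
def IsInK {p : ℕ} (g : U p) : Prop :=
  ∀ i : Fin p, (g : GL (Idx p) ℂ).1 (Sum.inl i) (Sum.inr ()) = 0 ∧
    (g : GL (Idx p) ℂ).1 (Sum.inr ()) (Sum.inl i) = 0

/-- The real Lie algebra `𝔲(p,1)`: matrices that are skew-adjoint for the Hermitian form. -/
def uLie (p : ℕ) : Set (Matrix (Idx p) (Idx p) ℂ) := {A | Aᴴ * gram p + gram p * A = 0}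

/-- The light cone `X⁰ = {(z,w) ≠ 0 : ∑ |z_i|² = |w|²}`. -/
def X0 (p : ℕ) : Set (Idx p → ℂ) :=
  {x | x ≠ 0 ∧ ∑ i : Fin p, ‖x (Sum.inl i)‖ ^ 2 = ‖x (Sum.inr ())‖ ^ 2}

lemma star_dotProduct_gram {p : ℕ} (x : Idx p → ℂ) :
    star x ⬝ᵥ (gram p *ᵥ x) =
      ((∑ i : Fin p, ‖x (Sum.inl i)‖ ^ 2 - ‖x (Sum.inr ())‖ ^ 2 : ℝ) : ℂ) := by
  have h : ∀ z : ℂ, (starRingEnd ℂ) z * z = ((‖z‖ ^ 2 : ℝ) : ℂ) := by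
    intro z; rw [Complex.conj_mul']; push_cast; rfl
  simp [gram, dotProduct, mulVec_diagonal, Complex.conj_mul', sub_eq_add_neg]

lemma mulVec_mem_X0 {p : ℕ} {g : GL (Idx p) ℂ} (hg : g ∈ U p) {x : Idx p → ℂ} (hx : x ∈ X0 p) :
    (g : Matrix (Idx p) (Idx p) ℂ) *ᵥ x ∈ X0 p := by
  obtain ⟨h0, h1⟩ := hx
  refine ⟨fun h => h0 ?_, ?_⟩
  · have : ((g⁻¹ : GL (Idx p) ℂ) : Matrix (Idx p) (Idx p) ℂ) *ᵥ
        ((g : Matrix (Idx p) (Idx p) ℂ) *ᵥ x) = x := by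
      rw [mulVec_mulVec, Units.inv_mul, one_mulVec]
    rw [← this, h, mulVec_zero]
  · have e1 := star_dotProduct_gram ((g : Matrix (Idx p) (Idx p) ℂ) *ᵥ x)
    have e2 := star_dotProduct_gram x
    have hg' : (g : Matrix (Idx p) (Idx p) ℂ)ᴴ * gram p * (g : Matrix (Idx p) (Idx p) ℂ) = gram p := hg
    have e3 : star ((g : Matrix (Idx p) (Idx p) ℂ) *ᵥ x) ⬝ᵥ
        (gram p *ᵥ ((g : Matrix (Idx p) (Idx p) ℂ) *ᵥ x)) = star x ⬝ᵥ (gram p *ᵥ x) := by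
      rw [star_mulVec, ← dotProduct_mulVec, mulVec_mulVec, mulVec_mulVec, hg']
    rw [e1, e2] at e3
    have e4 := Complex.ofReal_injective e3
    linarith

/-- `U(p,1)` acts on the light cone. -/
instance (p : ℕ) : MulAction (U p) (X0 p) where
  smul g x := ⟨(g : GL (Idx p) ℂ).1 *ᵥ x.1, mulVec_mem_X0 g.2 x.2⟩
  one_smul x := Subtype.ext (one_mulVec x.1)
  mul_smul g h x := Subtype.ext (mulVec_mulVec x.1 (g : GL (Idx p) ℂ).1 (h : GL (Idx p) ℂ).1).symm

/-- The nonzero complex scalars act on the light cone by dilations. -/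
instance (p : ℕ) : SMul ℂˣ (X0 p) where
  smul t x := ⟨(t : ℂ) • x.1, by
    obtain ⟨h0, h1⟩ := x.2
    refine ⟨smul_ne_zero t.ne_zero h0, ?_⟩
    simp only [Pi.smul_apply, smul_eq_mul, norm_mul, mul_pow]
    rw [← Finset.mul_sum, h1]⟩

/-- The matrix exponential sends `𝔲(p,1)` to `U(p,1)`. -/
lemma exp_conj_gram {p : ℕ} {A : Matrix (Idx p) (Idx p) ℂ} (hA : A ∈ uLie p) :
    (NormedSpace.exp A)ᴴ * gram p * NormedSpace.exp A = gram p := by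
  have hJ : gram p * gram p = 1 := by
    rw [gram, diagonal_mul_diagonal, ← diagonal_one]
    congr 1
    ext i
    rcases i with i | i <;> simp
  let J : (Matrix (Idx p) (Idx p) ℂ)ˣ := ⟨gram p, gram p, hJ, hJ⟩
  have hA' : Aᴴ = gram p * (-A) * gram p := by
    have h : Aᴴ * gram p = -(gram p * A) := eq_neg_of_add_eq_zero_left hA
    calc Aᴴ = Aᴴ * gram p * gram p := by rw [Matrix.mul_assoc, hJ, Matrix.mul_one]
      _ = _ := by rw [h, Matrix.mul_neg]
  have h1 : (NormedSpace.exp A)ᴴ = gram p * NormedSpace.exp (-A) * gram p := by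
    rw [← Matrix.exp_conjTranspose, hA']
    exact Matrix.exp_units_conj J (-A)
  rw [h1, Matrix.mul_assoc (gram p * _), hJ, Matrix.mul_one, Matrix.mul_assoc,
    ← Matrix.exp_add_of_commute _ _ (Commute.neg_left (Commute.refl A))]
  simp

lemma smul_mem_uLie {p : ℕ} {A : Matrix (Idx p) (Idx p) ℂ} (hA : A ∈ uLie p) (t : ℝ) :
    t • A ∈ uLie p := by
  have h : Aᴴ * gram p + gram p * A = 0 := hA
  change (t • A)ᴴ * gram p + gram p * (t • A) = 0
  rw [conjTranspose_smul, star_trivial, Matrix.smul_mul, Matrix.mul_smul, ← smul_add, h, smul_zero]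

/-- The element `exp(tA)` of `U(p,1)`, for `A ∈ 𝔲(p,1)` and `t ∈ ℝ`. -/
def expU {p : ℕ} (A : uLie p) (t : ℝ) : U p :=
  ⟨⟨NormedSpace.exp (t • A.1), NormedSpace.exp (-(t • A.1)),
    by rw [← Matrix.exp_add_of_commute _ _ ((Commute.refl (t • A.1)).neg_right)]; simp,
    by rw [← Matrix.exp_add_of_commute _ _ ((Commute.refl (t • A.1)).neg_left)]; simp⟩,
    exp_conj_gram (smul_mem_uLie A.2 t)⟩

/-! ### The modules of homogeneous functions -/

/-- `S^{α,β}(X⁰)` with `a = α + β ∈ ℂ` and `k = α - β ∈ ℤ`: the smooth functions `f` on the light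
cone such that `f(tx) = ψ(t) f(x)` for `t ∈ ℂˣ`, where
`ψ(t) = t^α conj(t)^β = |t|^a (t/|t|)^k`. A function on the submanifold `X⁰` is smooth when it is
the restriction of a function smooth at every point of `X⁰`. -/
def S (p : ℕ) (a : ℂ) (k : ℤ) : Submodule ℂ (X0 p → ℂ) where
  carrier := {f | (∃ F : (Idx p → ℂ) → ℂ, ∀ x : X0 p, ContDiffAt ℝ ∞ F x.1 ∧ F x.1 = f x) ∧
    ∀ (t : ℂˣ) (x : X0 p), f (t • x) =
      ((‖(t : ℂ)‖ : ℝ) : ℂ) ^ a * ((t : ℂ) / ((‖(t : ℂ)‖ : ℝ) : ℂ)) ^ k * f x}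
  zero_mem' := ⟨⟨0, fun _ => ⟨contDiffAt_const, rfl⟩⟩, fun _ _ => by simp⟩
  add_mem' := by
    rintro f g ⟨⟨F, hF⟩, hf⟩ ⟨⟨G, hG⟩, hg⟩
    refine ⟨⟨F + G, fun x => ⟨(hF x).1.add (hG x).1, ?_⟩⟩, fun t x => ?_⟩
    · simp [(hF x).2, (hG x).2]
    · simp only [Pi.add_apply, hf t x, hg t x]; ring
  smul_mem' := by
    rintro c f ⟨⟨F, hF⟩, hf⟩
    refine ⟨⟨c • F, fun x => ⟨contDiffAt_const.smul (hF x).1, ?_⟩⟩, fun t x => ?_⟩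
    · simp [(hF x).2]
    · simp only [Pi.smul_apply, smul_eq_mul, hf t x]; ring

/-- The action of `U(p,1)` on functions on the light cone: `(ρ(g) f)(x) = f(g⁻¹ x)`. -/
def rho {p : ℕ} (g : U p) : (X0 p → ℂ) →ₗ[ℂ] (X0 p → ℂ) where
  toFun f := fun x => f (g⁻¹ • x)
  map_add' _ _ := rfl
  map_smul' _ _ := rfl

/-- The differentiated action of `𝔲(p,1)`: `(dρ(A) f)(x) = d/dt f(exp(-tA) x)` at `t = 0`. -/
def dRho {p : ℕ} (A : uLie p) (f : X0 p → ℂ) : X0 p → ℂ :=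
  fun x => deriv (fun t : ℝ => f (expU A (-t) • x)) 0

/-- The span of the `K`-orbit of a function. -/
def kSpan {p : ℕ} (f : X0 p → ℂ) : Submodule ℂ (X0 p → ℂ) :=
  Submodule.span ℂ {h | ∃ g : U p, IsInK g ∧ h = rho g f}

lemma kSpan_add_le {p : ℕ} (f g : X0 p → ℂ) : kSpan (f + g) ≤ kSpan f ⊔ kSpan g := by
  refine Submodule.span_le.2 ?_
  rintro _ ⟨u, hu, rfl⟩
  rw [map_add]
  exact Submodule.add_mem_sup (Submodule.subset_span ⟨u, hu, rfl⟩)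
    (Submodule.subset_span ⟨u, hu, rfl⟩)

lemma kSpan_smul_le {p : ℕ} (c : ℂ) (f : X0 p → ℂ) : kSpan (c • f) ≤ kSpan f := by
  refine Submodule.span_le.2 ?_
  rintro _ ⟨u, hu, rfl⟩
  rw [map_smul]
  exact Submodule.smul_mem _ _ (Submodule.subset_span ⟨u, hu, rfl⟩)

lemma kSpan_zero {p : ℕ} : kSpan (0 : X0 p → ℂ) = ⊥ := by
  refine Submodule.span_eq_bot.2 ?_
  rintro _ ⟨u, _, rfl⟩
  exact map_zero _

/-- The `(𝔤,K)`-module of `S^{α,β}(X⁰)`: the space of its `K`-finite vectors. -/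
def HC (p : ℕ) (a : ℂ) (k : ℤ) : Submodule ℂ (X0 p → ℂ) where
  carrier := {f | f ∈ S p a k ∧ FiniteDimensional ℂ (kSpan f)}
  zero_mem' := ⟨(S p a k).zero_mem, by rw [kSpan_zero]; infer_instance⟩
  add_mem' := by
    rintro f g ⟨hf, hf'⟩ ⟨hg, hg'⟩
    exact ⟨(S p a k).add_mem hf hg, Submodule.finiteDimensional_of_le (kSpan_add_le f g)⟩
  smul_mem' := by
    rintro c f ⟨hf, hf'⟩
    exact ⟨(S p a k).smul_mem c hf, Submodule.finiteDimensional_of_le (kSpan_smul_le c f)⟩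

/-- `W` is a `(𝔤,K)`-submodule of `S^{α,β}(X⁰)`. -/
def IsGKSubmodule (p : ℕ) (a : ℂ) (k : ℤ) (W : Submodule ℂ (X0 p → ℂ)) : Prop :=
  W ≤ HC p a k ∧ (∀ g : U p, IsInK g → ∀ f ∈ W, rho g f ∈ W) ∧
    ∀ A : uLie p, ∀ f ∈ W, dRho A f ∈ W

/-- The partially ordered set of all `(𝔤,K)`-submodules of `S^{α,β}(X⁰)`. -/
abbrev GKSubmodule (p : ℕ) (a : ℂ) (k : ℤ) : Type :=
  {W : Submodule ℂ (X0 p → ℂ) // IsGKSubmodule p a k W}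

/-- `S^{α,β}(X⁰)` is an irreducible `U(p,1)`-module. -/
def IsIrred (p : ℕ) (a : ℂ) (k : ℤ) : Prop :=
  HC p a k ≠ ⊥ ∧ ∀ W : Submodule ℂ (X0 p → ℂ), IsGKSubmodule p a k W → W = ⊥ ∨ W = HC p a k

/-- `S^{α,β}(X⁰)` is unitary: its `K`-finite vectors carry a positive definite Hermitian form that
is `K`-invariant and for which `𝔲(p,1)` acts by skew-adjoint operators. (The form is written as
one on all functions, but only its values on the `K`-finite vectors are constrained; every form on
the `K`-finite vectors arises in this way.) -/
def IsUnitary (p : ℕ) (a : ℂ) (k : ℤ) : Prop :=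
  ∃ B : (X0 p → ℂ) →ₗ⋆[ℂ] (X0 p → ℂ) →ₗ[ℂ] ℂ,
    (∀ f ∈ HC p a k, ∀ h ∈ HC p a k, B h f = star (B f h)) ∧
    (∀ f ∈ HC p a k, f ≠ 0 → 0 < (B f f).re) ∧
    (∀ g : U p, IsInK g → ∀ f ∈ HC p a k, ∀ h ∈ HC p a k, B (rho g f) (rho g h) = B f h) ∧
    (∀ A : uLie p, ∀ f ∈ HC p a k, ∀ h ∈ HC p a k, B (dRho A f) h + B f (dRho A h) = 0)

/-! ### K-types -/

/-- The harmonic polynomials `H^{m₁,m₂}(ℂ^p)` of bidegree `(m₁,m₂)`. The variable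
`X (Sum.inl i)` stands for `z_i`, the variable `X (Sum.inr i)` for `conj(z_i)`. -/
def Harm (p m₁ m₂ : ℕ) : Set (MvPolynomial (Fin p ⊕ Fin p) ℂ) :=
  {P | IsWeightedHomogeneous (Sum.elim (fun _ => 1) (fun _ => 0) : Fin p ⊕ Fin p → ℕ) P m₁ ∧
    IsWeightedHomogeneous (Sum.elim (fun _ => 0) (fun _ => 1) : Fin p ⊕ Fin p → ℕ) P m₂ ∧
    ∑ i : Fin p, pderiv (Sum.inl i) (pderiv (Sum.inr i) P) = 0}

/-- The function on `ℂ` spanning `H^n(ℂ)`, `n ∈ ℤ`: it is `w^n` for `n ≥ 0` and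
`conj(w)^{-n}` for `n ≤ 0`. -/
def wPow (n : ℤ) (w : ℂ) : ℂ :=
  if 0 ≤ n then w ^ n.toNat else (starRingEnd ℂ w) ^ (-n).toNat

/-- The function `j_{α,β}(P ⊗ H^n)` on the light cone, namely
`(z,w) ↦ P(z, conj z) · wPow n w · (∑ |z_i|²)^b`, where `n = k - m₁ + m₂`, and `b` is such that
the total degree `m₁ + m₂ + |n| + 2b` is `a`. -/
def jMap (p : ℕ) (a : ℂ) (k : ℤ) (m₁ m₂ : ℕ) (P : MvPolynomial (Fin p ⊕ Fin p) ℂ) : X0 p → ℂ :=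
  fun x =>
    MvPolynomial.eval (Sum.elim (fun i => x.1 (Sum.inl i))
        (fun i => starRingEnd ℂ (x.1 (Sum.inl i)))) P
      * wPow (k - m₁ + m₂) (x.1 (Sum.inr ()))
      * ((∑ i : Fin p, ‖x.1 (Sum.inl i)‖ ^ 2 : ℝ) : ℂ) ^
          ((a - m₁ - m₂ - ((|k - m₁ + m₂| : ℤ) : ℂ)) / 2)

/-- The `K`-type of `S^{α,β}(X⁰)` with parameter `(m₁,m₂)`, i.e.
`j_{α,β}(H^{m₁,m₂}(ℂ^p) ⊗ H^n(ℂ))` with `n = α - β - m₁ + m₂`. -/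
def KType (p : ℕ) (a : ℂ) (k : ℤ) (m : ℕ × ℕ) : Submodule ℂ (X0 p → ℂ) :=
  Submodule.span ℂ (jMap p a k m.1 m.2 '' Harm p m.1 m.2)

/-! ### Barriers -/

/-- The transition coefficients of `O(P,Q)` on functions of degree `a`, as linear functions of
`(x,y)`. -/
def App (_P _Q a x y : ℤ) : ℤ := a - x - y
/-- See `App`. -/
def Apm (_P Q a x y : ℤ) : ℤ := a - x + y + Q - 2
/-- See `App`. -/
def Amp (P _Q a x y : ℤ) : ℤ := a + x - y + P - 2
/-- See `App`. -/
def Amm (P Q a x y : ℤ) : ℤ := a + x + y + P + Q - 4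

/-- Let `α, β ∈ ℤ`. The `K`-type `(m₁,m₂)` of `S^{α,β}(X⁰)` is drawn at the point
`(x,y) = (m₁ + m₂, n)`, `n = α - β - m₁ + m₂ ∈ ℤ`, of the plane. The barrier of
`A = A^{±±}` is the line `A_{2p,2,α+β}(x,y) = 0` in this plane. It causes reducibility when it
passes through a `K`-type and the `K`-types on it and on its positive side span a nonzero proper
submodule. -/
def CausesReducibility (p : ℕ) (α β : ℤ) (A : ℤ → ℤ → ℤ → ℤ → ℤ → ℤ) : Prop :=
  let val : ℕ × ℕ → ℤ := fun m => A (2 * p) 2 (α + β) (m.1 + m.2) (α - β - m.1 + m.2)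
  let W : Submodule ℂ (X0 p → ℂ) :=
    ⨆ m : ℕ × ℕ, ⨆ _ : 0 ≤ val m, KType p ((α + β : ℤ) : ℂ) (α - β) m
  (∃ m, val m = 0) ∧ IsGKSubmodule p ((α + β : ℤ) : ℂ) (α - β) W ∧ W ≠ ⊥ ∧
    W ≠ HC p ((α + β : ℤ) : ℂ) (α - β)

/-! ### Hasse diagrams -/

/-- The poset `P` is the Hasse diagram of `S^{α,β}(X⁰)`, where the vertex `v ∈ P` stands for the
constituent whose `K`-types are the `(m₁,m₂)` with `κ (m₁,m₂) = v`, and `F` is the set of vertices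
of the finite-dimensional constituents: sending a lower set `L` of `P` to the span of the `K`-types
with `κ (m₁,m₂) ∈ L` is an isomorphism from the lattice of lower sets of `P` onto the lattice of
all submodules. (So the irreducible constituent at `v` is the quotient of the submodule of
`{u | u ≤ v}` by that of `{u | u < v}`.) -/
def HasHasseDiagram (p : ℕ) (α β : ℤ) (P : Type) [PartialOrder P] (κ : ℕ × ℕ → P)
    (F : Set P) : Prop :=
  ∃ e : LowerSet P ≃o GKSubmodule p ((α + β : ℤ) : ℂ) (α - β),
    (∀ L : LowerSet P, (e L).1 =
      ⨆ m : ℕ × ℕ, ⨆ _ : κ m ∈ L, KType p ((α + β : ℤ) : ℂ) (α - β) m) ∧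
    ∀ v : P, FiniteDimensional ℂ
        ((e (LowerSet.Iic v)).1 ⧸ (e (LowerSet.Iio v)).1.submoduleOf (e (LowerSet.Iic v)).1) ↔
      v ∈ F

/-- Two incomparable points. -/
abbrev Two : Type := Unit ⊕ Unit

end LightCone

end

open LightCone

open Matrix MvPolynomial
open scoped ContDiff

noncomputable section

namespace LightCone

/-! ### Bihomogeneous harmonic polynomials -/

/-! A homogeneous function on the cone is determined by its values at the points (z, 1), where z
runs over the unit sphere of ℂ^p. So `Phi` turns polynomials in z and conj z into vectors of the
module, and multiplication by |z|² becomes trivial. `Phi` is injective on harmonic polynomials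
(`eq_zero_of_Phi_eq_zero`), and the image of `Harmonic p` is exactly the space of K-finite vectors
(`HC_eq`). The last point is analysis: a K-finite function pairs with only finitely many K-types in
L² of the sphere, and by Stone–Weierstrass a function orthogonal to all polynomials is zero.

In this model the compact part of the complexified Lie algebra acts through the operators `rot`. The
spaces `H p m` are irreducible under them (`RotStable.H_le`) and are told apart by the Casimir
operator together with the difference of the two Euler operators (`RotStable.component_mem`). The
noncompact part acts by `boostZ α` and `boostB β`. The first maps `H p m` to bidegree (m₁ + 1, m₂)
with coefficient m₁ - α and to (m₁, m₂ - 1) with a nonzero multiple of p + m₂ - 1 + α; the second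
does the same with the two degrees exchanged and β for α (`Phi_boostZ`, `Phi_boostB`). The zeros of
these four coefficients are the barriers. As each K-type is irreducible and occurs once, a submodule
is the same as a set of K-types closed under the transitions with nonzero coefficient
(`isGKSubmodule_iff`). For integral parameters one K-type is reachable from another exactly when no
barrier has to be crossed in the forbidden direction (`reach_iff`), so each Hasse diagram is the
order induced by this preorder (`hasHasseDiagram_of_barrierLE`).

For unitarity, the Fischer product on polynomials makes multiplication by a variable adjoint to
differentiation, and it is K-invariant. Rescaled by c m > 0 in bidegree m, it is invariant under the
Lie algebra when c satisfies two first-order recursions (`IsInvariantWeight`). On the unitary axis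
their parameter-dependent factors cancel; for real α and β between -p and 0 all factors are
positive; in both cases a positive solution can be written down. Conversely, comparing the norms of
1, z_j and conj z_j forces -α and p + β to have the same sign, and likewise -β and p + α
(`IsUnitary.exists_pos`). When |α - β| < p this leaves only the square -p < α, β < 0, where moreover
no transition coefficient vanishes. -/

/-- Polynomials in `z_1, …, z_p` and their conjugates. -/
abbrev Poly (p : ℕ) : Type := MvPolynomial (Fin p ⊕ Fin p) ℂ

/-- The weight counting the variables `z_i`. -/
abbrev wz (p : ℕ) : Fin p ⊕ Fin p → ℕ := Sum.elim (fun _ => 1) (fun _ => 0)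

/-- The weight counting the variables `conj z_i`. -/
abbrev wzb (p : ℕ) : Fin p ⊕ Fin p → ℕ := Sum.elim (fun _ => 0) (fun _ => 1)

section Operators

variable {p : ℕ}

/-- A commutator of derivations is a derivation, so it is enough that it kills the variables. -/
lemma pderiv_comm' {σ : Type*} (i j : σ) (P : MvPolynomial σ ℂ) :
    pderiv i (pderiv j P) = pderiv j (pderiv i P) := by
  classical
  have h : ⁅(pderiv i : Derivation ℂ (MvPolynomial σ ℂ) (MvPolynomial σ ℂ)),
      (pderiv j : Derivation ℂ (MvPolynomial σ ℂ) (MvPolynomial σ ℂ))⁆ = 0 := by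
    refine MvPolynomial.derivation_ext fun k => ?_
    rw [Derivation.commutator_apply, pderiv_X, pderiv_X]
    by_cases h1 : k = j <;> by_cases h2 : k = i <;> simp [Pi.single_apply, h1, h2] <;>
      split_ifs <;> simp
  have h2 := DFunLike.congr_fun h P
  simp only [Derivation.commutator_apply, Derivation.zero_apply] at h2
  exact sub_eq_zero.1 h2

lemma pderiv_X_mul {σ : Type*} [DecidableEq σ] (i j : σ) (P : MvPolynomial σ ℂ) :
    pderiv i (X j * P) = (if i = j then P else 0) + X j * pderiv i P := by
  rw [pderiv_mul, pderiv_X]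
  by_cases h : i = j
  · subst h; simp
  · simp [h]

/-- The complex Laplacian `∑ ∂_i ∂̄_i`. -/
def lap (p : ℕ) : Poly p →ₗ[ℂ] Poly p :=
  ∑ i : Fin p, (pderiv (Sum.inl i)).toLinearMap ∘ₗ (pderiv (Sum.inr i)).toLinearMap

lemma lap_apply (P : Poly p) :
    lap p P = ∑ i : Fin p, pderiv (Sum.inl i) (pderiv (Sum.inr i) P) := by
  simp [lap, LinearMap.sum_apply]

/-- The polynomial `|z|²`. -/
def r2 (p : ℕ) : Poly p := ∑ i : Fin p, X (Sum.inl i) * X (Sum.inr i)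

/-- The Euler operator in the variables `z_i`. -/
def eulerZ (p : ℕ) : Poly p →ₗ[ℂ] Poly p :=
  ∑ i : Fin p, LinearMap.mulLeft ℂ (X (Sum.inl i)) ∘ₗ (pderiv (Sum.inl i)).toLinearMap

/-- The Euler operator in the variables `conj z_i`. -/
def eulerB (p : ℕ) : Poly p →ₗ[ℂ] Poly p :=
  ∑ i : Fin p, LinearMap.mulLeft ℂ (X (Sum.inr i)) ∘ₗ (pderiv (Sum.inr i)).toLinearMap

lemma eulerZ_apply (P : Poly p) :
    eulerZ p P = ∑ i : Fin p, X (Sum.inl i) * pderiv (Sum.inl i) P := by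
  simp [eulerZ, LinearMap.sum_apply]

lemma eulerB_apply (P : Poly p) :
    eulerB p P = ∑ i : Fin p, X (Sum.inr i) * pderiv (Sum.inr i) P := by
  simp [eulerB, LinearMap.sum_apply]

/-- The action of the elementary matrices of `𝔤𝔩(p)` on polynomials. -/
def rot (i j : Fin p) : Poly p →ₗ[ℂ] Poly p :=
  LinearMap.mulLeft ℂ (X (Sum.inl i)) ∘ₗ (pderiv (Sum.inl j)).toLinearMap -
    LinearMap.mulLeft ℂ (X (Sum.inr j)) ∘ₗ (pderiv (Sum.inr i)).toLinearMap

lemma rot_apply (i j : Fin p) (P : Poly p) :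
    rot i j P = X (Sum.inl i) * pderiv (Sum.inl j) P - X (Sum.inr j) * pderiv (Sum.inr i) P := rfl

lemma lap_pderiv (s : Fin p ⊕ Fin p) (P : Poly p) : lap p (pderiv s P) = pderiv s (lap p P) := by
  simp only [lap_apply, map_sum]
  refine Finset.sum_congr rfl fun i _ => ?_
  rw [pderiv_comm' _ s P, pderiv_comm' _ s]

lemma lap_X_inl_mul (i : Fin p) (P : Poly p) :
    lap p (X (Sum.inl i) * P) = X (Sum.inl i) * lap p P + pderiv (Sum.inr i) P := by
  simp only [lap_apply, pderiv_X_mul, reduceCtorEq, if_false, zero_add, Sum.inl.injEq,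
    Finset.sum_add_distrib, Finset.sum_ite_eq', Finset.mem_univ, if_true, Finset.mul_sum]
  ring

lemma lap_X_inr_mul (i : Fin p) (P : Poly p) :
    lap p (X (Sum.inr i) * P) = X (Sum.inr i) * lap p P + pderiv (Sum.inl i) P := by
  have h : ∀ j : Fin p, pderiv (Sum.inl j) (if (Sum.inr j : Fin p ⊕ Fin p) = Sum.inr i then P else 0)
      = if j = i then pderiv (Sum.inl j) P else 0 := by
    intro j; by_cases hj : j = i <;> simp [hj]
  simp only [lap_apply, pderiv_X_mul, map_add, h, reduceCtorEq, if_false, zero_add,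
    Finset.sum_add_distrib, Finset.sum_ite_eq', Finset.mem_univ, if_true, Finset.mul_sum]
  ring

/-- This is the sl(2) relation: the commutator of the Laplacian with |z|² is a scalar on each
bidegree. That scalar is the denominator in `upZ` and `upB`. -/
lemma lap_r2_mul (G : Poly p) :
    lap p (r2 p * G) = r2 p * lap p G + eulerZ p G + eulerB p G + (p : ℂ) • G := by
  have h : ∀ i : Fin p, lap p (X (Sum.inl i) * X (Sum.inr i) * G) =
      X (Sum.inl i) * X (Sum.inr i) * lap p G + X (Sum.inl i) * pderiv (Sum.inl i) G
        + X (Sum.inr i) * pderiv (Sum.inr i) G + G := by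
    intro i
    rw [mul_assoc, lap_X_inl_mul, lap_X_inr_mul, pderiv_X_mul, if_pos rfl]
    ring
  rw [r2, Finset.sum_mul, map_sum, Finset.sum_congr rfl fun i _ => h i]
  simp only [Finset.sum_add_distrib, eulerZ_apply, eulerB_apply, Finset.sum_const,
    Finset.card_univ, Fintype.card_fin, Finset.sum_mul, Nat.cast_smul_eq_nsmul]

/-- The space of harmonic polynomials of bidegree `m`. -/
def H (p : ℕ) (m : ℕ × ℕ) : Submodule ℂ (Poly p) where
  carrier := Harm p m.1 m.2
  zero_mem' := ⟨isWeightedHomogeneous_zero _ _ _, isWeightedHomogeneous_zero _ _ _, by simp⟩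
  add_mem' := by
    rintro P Q ⟨h1, h2, h3⟩ ⟨k1, k2, k3⟩
    exact ⟨h1.add k1, h2.add k2, by simp [Finset.sum_add_distrib, h3, k3]⟩
  smul_mem' := by
    rintro c P ⟨h1, h2, h3⟩
    refine ⟨(weightedHomogeneousSubmodule ℂ _ _).smul_mem c h1,
      (weightedHomogeneousSubmodule ℂ _ _).smul_mem c h2, ?_⟩
    simp only [Derivation.map_smul, ← Finset.smul_sum, h3, smul_zero]

variable {m : ℕ × ℕ} {P : Poly p}

lemma mem_H : P ∈ H p m ↔ P.IsWeightedHomogeneous (wz p) m.1 ∧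
    P.IsWeightedHomogeneous (wzb p) m.2 ∧ lap p P = 0 := by
  rw [lap_apply]; rfl

lemma eulerZ_of_mem (h : P.IsWeightedHomogeneous (wz p) m.1) : eulerZ p P = (m.1 : ℂ) • P := by
  have := h.sum_weight_X_mul_pderiv
  simp only [Fintype.sum_sum_type, Sum.elim_inl, Sum.elim_inr, one_smul, zero_smul,
    Finset.sum_const_zero, add_zero] at this
  rw [eulerZ_apply, this, Nat.cast_smul_eq_nsmul]

lemma eulerB_of_mem (h : P.IsWeightedHomogeneous (wzb p) m.2) : eulerB p P = (m.2 : ℂ) • P := by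
  have := h.sum_weight_X_mul_pderiv
  simp only [Fintype.sum_sum_type, Sum.elim_inl, Sum.elim_inr, one_smul, zero_smul,
    Finset.sum_const_zero, zero_add] at this
  rw [eulerB_apply, this, Nat.cast_smul_eq_nsmul]

lemma pderiv_inl_mem {m₁ m₂ : ℕ} (h : P ∈ H p (m₁ + 1, m₂)) (i : Fin p) :
    pderiv (Sum.inl i) P ∈ H p (m₁, m₂) := by
  obtain ⟨h1, h2, h3⟩ := mem_H.1 h
  exact mem_H.2 ⟨h1.pderiv (by simp), h2.pderiv (by simp), by rw [lap_pderiv, h3, map_zero]⟩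

lemma pderiv_inr_mem {m₁ m₂ : ℕ} (h : P ∈ H p (m₁, m₂ + 1)) (i : Fin p) :
    pderiv (Sum.inr i) P ∈ H p (m₁, m₂) := by
  obtain ⟨h1, h2, h3⟩ := mem_H.1 h
  exact mem_H.2 ⟨h1.pderiv (by simp), h2.pderiv (by simp), by rw [lap_pderiv, h3, map_zero]⟩

lemma pderiv_eq_zero_of_weight {w : Fin p ⊕ Fin p → ℕ} (h : P.IsWeightedHomogeneous w 0)
    {s : Fin p ⊕ Fin p} (hs : w s = 1) : pderiv s P = 0 := by
  ext d
  rw [coeff_pderiv, coeff_zero]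
  by_contra hne
  have h1 := h (left_ne_zero_of_mul hne)
  rw [map_add, Finsupp.weight_single, hs] at h1
  simp at h1

lemma pderiv_inl_of_zero {m₂ : ℕ} (h : P ∈ H p (0, m₂)) (i : Fin p) :
    pderiv (Sum.inl i) P = 0 :=
  pderiv_eq_zero_of_weight (mem_H.1 h).1 rfl

lemma pderiv_inr_of_zero {m₁ : ℕ} (h : P ∈ H p (m₁, 0)) (i : Fin p) :
    pderiv (Sum.inr i) P = 0 :=
  pderiv_eq_zero_of_weight (mem_H.1 h).2.1 rfl

/-- The operator commutes with the Laplacian and replaces one variable by another of the same kind.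
Degree 0 is treated apart because the derivative is then zero and has no lower degree in ℕ. -/
lemma rot_mem (h : P ∈ H p m) (i j : Fin p) : rot i j P ∈ H p m := by
  obtain ⟨h1, h2, h3⟩ := mem_H.1 h
  have key : lap p (rot i j P) = 0 := by
    rw [rot_apply, map_sub, lap_X_inl_mul, lap_X_inr_mul, lap_pderiv, lap_pderiv, h3,
      map_zero, map_zero, pderiv_comm' (Sum.inr i)]
    ring
  obtain ⟨m₁, m₂⟩ := m
  refine mem_H.2 ⟨?_, ?_, key⟩ <;> rw [rot_apply]
  · refine IsWeightedHomogeneous.sub ?_ ?_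
    · rcases m₁ with _ | m₁
      · rw [pderiv_inl_of_zero h, mul_zero]; exact isWeightedHomogeneous_zero _ _ _
      · have := (isWeightedHomogeneous_X ℂ (wz p) (Sum.inl i)).mul
          (mem_H.1 (pderiv_inl_mem h j)).1
        simpa [add_comm] using this
    · have := (isWeightedHomogeneous_X ℂ (wz p) (Sum.inr j)).mul
          (h1.pderiv (i := Sum.inr i) (n' := m₁) (by simp))
      simpa using this
  · refine IsWeightedHomogeneous.sub ?_ ?_
    · have := (isWeightedHomogeneous_X ℂ (wzb p) (Sum.inl i)).mul
          (h2.pderiv (i := Sum.inl j) (n' := m₂) (by simp))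
      simpa using this
    · rcases m₂ with _ | m₂
      · rw [pderiv_inr_of_zero h, mul_zero]; exact isWeightedHomogeneous_zero _ _ _
      · have := (isWeightedHomogeneous_X ℂ (wzb p) (Sum.inr j)).mul
          (mem_H.1 (pderiv_inr_mem h i)).2.1
        simpa [add_comm] using this

/-- The harmonic projection of `z_i P`, for `P` harmonic of bidegree `m`. -/
def upZ (m : ℕ × ℕ) (i : Fin p) (P : Poly p) : Poly p :=
  X (Sum.inl i) * P - ((p : ℂ) + m.1 + m.2 - 1)⁻¹ • (r2 p * pderiv (Sum.inr i) P)

/-- The harmonic projection of `conj(z_i) P`, for `P` harmonic of bidegree `m`. -/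
def upB (m : ℕ × ℕ) (i : Fin p) (P : Poly p) : Poly p :=
  X (Sum.inr i) * P - ((p : ℂ) + m.1 + m.2 - 1)⁻¹ • (r2 p * pderiv (Sum.inl i) P)

lemma cast_ne_zero_of_lt (hp : 1 < p) (m : ℕ × ℕ) : ((p : ℂ) + m.1 + m.2 - 1) ≠ 0 := by
  have : ((p : ℂ) + m.1 + m.2 - 1) = ((p + m.1 + m.2 - 1 : ℕ) : ℂ) := by
    rw [Nat.cast_sub (by omega)]; push_cast; ring
  rw [this]
  exact_mod_cast (by omega : p + m.1 + m.2 - 1 ≠ 0)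

lemma isWeightedHomogeneous_r2_wz : (r2 p).IsWeightedHomogeneous (wz p) 1 :=
  IsWeightedHomogeneous.sum _ _ _ fun i _ => by
    simpa using (isWeightedHomogeneous_X ℂ (wz p) (Sum.inl i)).mul
      (isWeightedHomogeneous_X ℂ (wz p) (Sum.inr i))

lemma isWeightedHomogeneous_r2_wzb : (r2 p).IsWeightedHomogeneous (wzb p) 1 :=
  IsWeightedHomogeneous.sum _ _ _ fun i _ => by
    simpa using (isWeightedHomogeneous_X ℂ (wzb p) (Sum.inl i)).mul
      (isWeightedHomogeneous_X ℂ (wzb p) (Sum.inr i))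

/-- The Laplacian of z_i P is ∂̄_i P, and that of |z|² ∂̄_i P is (m₁ + (m₂ - 1) + p) ∂̄_i P; the
constant in `upZ` makes the two cancel. -/
lemma upZ_mem (hp : 1 < p) (h : P ∈ H p m) (i : Fin p) : upZ m i P ∈ H p (m.1 + 1, m.2) := by
  obtain ⟨m₁, m₂⟩ := m
  obtain ⟨h1, h2, h3⟩ := mem_H.1 h
  have hX1 := (isWeightedHomogeneous_X ℂ (wz p) (Sum.inl i)).mul h1
  have hX2 := (isWeightedHomogeneous_X ℂ (wzb p) (Sum.inl i)).mul h2
  rcases m₂ with _ | m₂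
  · rw [upZ, pderiv_inr_of_zero h, mul_zero, smul_zero, sub_zero]
    refine mem_H.2 ⟨by simpa [add_comm] using hX1, by simpa using hX2, ?_⟩
    rw [lap_X_inl_mul, h3, pderiv_inr_of_zero h, mul_zero, add_zero]
  · have hd := pderiv_inr_mem h i
    obtain ⟨d1, d2, d3⟩ := mem_H.1 hd
    refine mem_H.2 ⟨?_, ?_, ?_⟩
    · refine IsWeightedHomogeneous.sub (by simpa [add_comm] using hX1) ?_
      refine (weightedHomogeneousSubmodule ℂ _ _).smul_mem _ ?_
      simpa [add_comm] using isWeightedHomogeneous_r2_wz.mul d1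
    · refine IsWeightedHomogeneous.sub (by simpa [add_comm] using hX2) ?_
      refine (weightedHomogeneousSubmodule ℂ _ _).smul_mem _ ?_
      simpa [add_comm] using isWeightedHomogeneous_r2_wzb.mul d2
    · have hN := cast_ne_zero_of_lt hp (m₁, m₂ + 1)
      rw [upZ, map_sub, map_smul, lap_X_inl_mul, lap_r2_mul, h3, d3, eulerZ_of_mem d1,
        eulerB_of_mem d2, mul_zero, mul_zero, zero_add, zero_add, ← add_smul, ← add_smul, smul_smul]
      dsimp only at hN ⊢
      rw [show (m₁ : ℂ) + m₂ + p = p + m₁ + (m₂ + 1 : ℕ) - 1 by push_cast; ring,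
        inv_mul_cancel₀ hN, one_smul, sub_self]

lemma upB_mem (hp : 1 < p) (h : P ∈ H p m) (i : Fin p) : upB m i P ∈ H p (m.1, m.2 + 1) := by
  obtain ⟨m₁, m₂⟩ := m
  obtain ⟨h1, h2, h3⟩ := mem_H.1 h
  have hX1 := (isWeightedHomogeneous_X ℂ (wz p) (Sum.inr i)).mul h1
  have hX2 := (isWeightedHomogeneous_X ℂ (wzb p) (Sum.inr i)).mul h2
  rcases m₁ with _ | m₁
  · rw [upB, pderiv_inl_of_zero h, mul_zero, smul_zero, sub_zero]
    refine mem_H.2 ⟨by simpa using hX1, by simpa [add_comm] using hX2, ?_⟩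
    rw [lap_X_inr_mul, h3, pderiv_inl_of_zero h, mul_zero, add_zero]
  · have hd := pderiv_inl_mem h i
    obtain ⟨d1, d2, d3⟩ := mem_H.1 hd
    refine mem_H.2 ⟨?_, ?_, ?_⟩
    · refine IsWeightedHomogeneous.sub (by simpa [add_comm] using hX1) ?_
      refine (weightedHomogeneousSubmodule ℂ _ _).smul_mem _ ?_
      simpa [add_comm] using isWeightedHomogeneous_r2_wz.mul d1
    · refine IsWeightedHomogeneous.sub (by simpa [add_comm] using hX2) ?_
      refine (weightedHomogeneousSubmodule ℂ _ _).smul_mem _ ?_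
      simpa [add_comm] using isWeightedHomogeneous_r2_wzb.mul d2
    · have hN := cast_ne_zero_of_lt hp (m₁ + 1, m₂)
      rw [upB, map_sub, map_smul, lap_X_inr_mul, lap_r2_mul, h3, d3, eulerZ_of_mem d1,
        eulerB_of_mem d2, mul_zero, mul_zero, zero_add, zero_add, ← add_smul, ← add_smul, smul_smul]
      dsimp only at hN ⊢
      rw [show (m₁ : ℂ) + m₂ + p = p + (m₁ + 1 : ℕ) + m₂ - 1 by push_cast; ring,
        inv_mul_cancel₀ hN, one_smul, sub_self]

/-- Differentiating Euler's identity yields the second-order sums that appear in the Casimir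
operator. -/
lemma eulerZ_pderiv (h : eulerZ p P = (m.1 : ℂ) • P) (i : Fin p) :
    ∑ j, X (Sum.inl j) * pderiv (Sum.inl j) (pderiv (Sum.inl i) P) =
      ((m.1 : ℂ) - 1) • pderiv (Sum.inl i) P := by
  have h2 := congrArg (pderiv (Sum.inl i)) h
  simp only [eulerZ_apply, map_sum, pderiv_X_mul, Derivation.map_smul, Sum.inl.injEq,
    Finset.sum_add_distrib, Finset.sum_ite_eq, Finset.mem_univ, if_true] at h2
  rw [sub_smul, one_smul, ← h2, add_sub_cancel_left]
  exact Finset.sum_congr rfl fun j _ => by rw [pderiv_comm']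

lemma eulerB_pderiv (h : eulerB p P = (m.2 : ℂ) • P) (i : Fin p) :
    ∑ j, X (Sum.inr j) * pderiv (Sum.inr j) (pderiv (Sum.inr i) P) =
      ((m.2 : ℂ) - 1) • pderiv (Sum.inr i) P := by
  have h2 := congrArg (pderiv (Sum.inr i)) h
  simp only [eulerB_apply, map_sum, pderiv_X_mul, Derivation.map_smul, Sum.inr.injEq,
    Finset.sum_add_distrib, Finset.sum_ite_eq, Finset.mem_univ, if_true] at h2
  rw [sub_smul, one_smul, ← h2, add_sub_cancel_left]
  exact Finset.sum_congr rfl fun j _ => by rw [pderiv_comm']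

/-- The Casimir element of `𝔤𝔩(p)`. -/
def casimir (p : ℕ) : Poly p →ₗ[ℂ] Poly p := ∑ i : Fin p, ∑ j : Fin p, rot i j ∘ₗ rot j i

/-- After normal ordering, every second-order term is either a product of two Euler operators of the
same kind, up to first-order terms, or contains the Laplacian of P, which is zero. -/
lemma casimir_of_mem (h : P ∈ H p m) :
    casimir p P = ((m.1 : ℂ) * (m.1 + p - 1) + m.2 * (m.2 + p - 1)) • P := by
  obtain ⟨h1, h2, h3⟩ := mem_H.1 h
  have e1 := eulerZ_of_mem h1
  have e2 := eulerB_of_mem h2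
  have d1 := eulerZ_pderiv e1
  have d2 := eulerB_pderiv e2
  have key : ∀ i j : Fin p, rot i j (rot j i P) =
      X (Sum.inl i) * pderiv (Sum.inl i) P
      + X (Sum.inl i) * (X (Sum.inl j) * pderiv (Sum.inl j) (pderiv (Sum.inl i) P))
      - X (Sum.inl i) * X (Sum.inr i) * pderiv (Sum.inl j) (pderiv (Sum.inr j) P)
      - X (Sum.inl j) * X (Sum.inr j) * pderiv (Sum.inl i) (pderiv (Sum.inr i) P)
      + X (Sum.inr j) * pderiv (Sum.inr j) P
      + X (Sum.inr j) * (X (Sum.inr i) * pderiv (Sum.inr i) (pderiv (Sum.inr j) P)) := by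
    intro i j
    simp only [rot_apply, map_sub, pderiv_X_mul, reduceCtorEq, if_false, zero_add, if_true]
    rw [pderiv_comm' (Sum.inr i) (Sum.inl i)]
    ring
  have e1' := eulerZ_apply P
  have e2' := eulerB_apply P
  have hA : ∑ i : Fin p, ∑ j : Fin p,
      X (Sum.inl i) * (X (Sum.inl j) * pderiv (Sum.inl j) (pderiv (Sum.inl i) P)) =
      (((m.1 : ℂ) - 1) * m.1) • P := by
    simp only [← Finset.mul_sum, d1, mul_smul_comm, ← Finset.smul_sum]
    rw [← e1', e1, smul_smul]
  have hB : ∑ i : Fin p, ∑ j : Fin p,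
      X (Sum.inr j) * (X (Sum.inr i) * pderiv (Sum.inr i) (pderiv (Sum.inr j) P)) =
      (((m.2 : ℂ) - 1) * m.2) • P := by
    rw [Finset.sum_comm]
    simp only [← Finset.mul_sum, d2, mul_smul_comm, ← Finset.smul_sum]
    rw [← e2', e2, smul_smul]
  have hC : ∑ i : Fin p, ∑ j : Fin p,
      X (Sum.inl i) * X (Sum.inr i) * pderiv (Sum.inl j) (pderiv (Sum.inr j) P) = 0 := by
    simp only [← Finset.mul_sum, ← lap_apply, h3, mul_zero, Finset.sum_const_zero]
  have hD : ∑ i : Fin p, ∑ j : Fin p,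
      X (Sum.inl j) * X (Sum.inr j) * pderiv (Sum.inl i) (pderiv (Sum.inr i) P) = 0 := by
    rw [Finset.sum_comm]
    exact hC
  simp only [casimir, LinearMap.sum_apply, LinearMap.comp_apply, key, Finset.sum_add_distrib,
    Finset.sum_sub_distrib, hA, hB, hC, hD, Finset.sum_const, ← Finset.smul_sum,
    Finset.card_univ, Fintype.card_fin, ← e1', ← e2', e1, e2, ← Nat.cast_smul_eq_nsmul ℂ, smul_smul]
  simp only [sub_zero, ← add_smul]
  congr 1
  ring

lemma sum_rot_self : ∑ i, rot i i P = eulerZ p P - eulerB p P := by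
  simp only [rot_apply, eulerZ_apply, eulerB_apply, Finset.sum_sub_distrib]

end Operators

/-! ### The structure of `𝔤𝔩(p)`-stable spaces of polynomials -/

/-- A subspace stable under the action of `𝔤𝔩(p)`. -/
def RotStable {p : ℕ} (U : Submodule ℂ (Poly p)) : Prop := ∀ i j, ∀ P ∈ U, rot i j P ∈ U

/-- Applying T - μ a removes the summand at a and multiplies each other summand by a nonzero number,
which allows induction on the number of summands. -/
lemma mem_of_sum_eigenvectors {V ι : Type*} [AddCommGroup V] [Module ℂ V] {T : V →ₗ[ℂ] V}
    {U : Submodule ℂ V} (hU : ∀ v ∈ U, T v ∈ U) {μ : ι → ℂ} (hμ : Function.Injective μ)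
    (s : Finset ι) (f : ι → V) (hf : ∀ i ∈ s, T (f i) = μ i • f i) (hs : ∑ i ∈ s, f i ∈ U) :
    ∀ i ∈ s, f i ∈ U := by
  classical
  induction s using Finset.induction_on generalizing f with
  | empty => simp
  | insert a s ha ih =>
    rw [Finset.sum_insert ha] at hs
    have h1 : ∀ i ∈ s, (μ i - μ a) • f i ∈ U := by
      refine ih _ (fun i hi => ?_) ?_
      · rw [map_smul, hf i (Finset.mem_insert_of_mem hi), smul_comm]
      · have h2 := U.sub_mem (hU _ hs) (U.smul_mem (μ a) hs)
        rw [map_add, hf a (Finset.mem_insert_self _ _), map_sum, smul_add, add_sub_add_left_eq_sub,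
          Finset.smul_sum, ← Finset.sum_sub_distrib] at h2
        convert h2 using 2 with i hi
        rw [hf i (Finset.mem_insert_of_mem hi), sub_smul]
    have h3 : ∀ i ∈ s, f i ∈ U := by
      intro i hi
      have hne : μ i - μ a ≠ 0 := sub_ne_zero.2 (hμ.ne (fun h => ha (h ▸ hi)))
      have := U.smul_mem (μ i - μ a)⁻¹ (h1 i hi)
      rwa [smul_smul, inv_mul_cancel₀ hne, one_smul] at this
    intro i hi
    rcases Finset.mem_insert.1 hi with rfl | hi
    · have := U.sub_mem hs (U.sum_mem h3)
      rwa [add_sub_cancel_right] at this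
    · exact h3 i hi

/-- The eigenvalue on `H p m` of an operator separating the spaces `H p m`. -/
def sepEigenvalue (p : ℕ) (m : ℕ × ℕ) : ℂ :=
  (m.1 : ℂ) * (m.1 + p - 1) + m.2 * (m.2 + p - 1) + Complex.I * (m.1 - m.2)

/-- The imaginary part records m₁ - m₂. For a fixed difference the real part is strictly increasing
in m₁, because p > 1. -/
lemma sepEigenvalue_injective {p : ℕ} (hp : 1 < p) : Function.Injective (sepEigenvalue p) := by
  rintro ⟨a, b⟩ ⟨c, d⟩ h
  have hre := congrArg Complex.re h
  have him := congrArg Complex.im h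
  simp [sepEigenvalue] at hre him
  have hp' : (1 : ℝ) < p := by exact_mod_cast hp
  have ha : (0 : ℝ) ≤ a := a.cast_nonneg
  have hb : (0 : ℝ) ≤ b := b.cast_nonneg
  have hc : (0 : ℝ) ≤ c := c.cast_nonneg
  have hd : (0 : ℝ) ≤ d := d.cast_nonneg
  -- Since b - d = a - c, the equation of real parts factors; the second factor is positive.
  have e : ((a : ℝ) - c) * (a + c + p - 1 + (b + d + p - 1)) = 0 := by
    have : (b : ℝ) - d = a - c := by linarith
    linear_combination hre - (b + d + p - 1) * this
  have hac : (a : ℝ) = c := by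
    rcases mul_eq_zero.1 e with h | h
    · linarith
    · linarith
  have hbd : (b : ℝ) = d := by linarith
  ext
  · exact_mod_cast hac
  · exact_mod_cast hbd

/-- The Casimir plus i times the difference of the Euler operators is built from `rot`, and its
eigenvalues on different `H p m` are different. -/
lemma RotStable.component_mem {p : ℕ} (hp : 1 < p) {U : Submodule ℂ (Poly p)} (hU : RotStable U)
    (s : Finset (ℕ × ℕ)) (f : ℕ × ℕ → Poly p) (hf : ∀ m ∈ s, f m ∈ H p m)
    (hs : ∑ m ∈ s, f m ∈ U) : ∀ m ∈ s, f m ∈ U := by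
  refine mem_of_sum_eigenvectors (T := casimir p + Complex.I • ∑ i, rot i i) ?_
    (sepEigenvalue_injective hp) s f ?_ hs
  · intro v hv
    rw [LinearMap.add_apply, LinearMap.smul_apply, LinearMap.sum_apply]
    refine U.add_mem ?_ (U.smul_mem _ (U.sum_mem fun i _ => hU i i v hv))
    simp only [casimir, LinearMap.sum_apply, LinearMap.comp_apply]
    exact U.sum_mem fun i _ => U.sum_mem fun j _ => hU _ _ _ (hU _ _ _ hv)
  · intro m hm
    have h := hf m hm
    rw [LinearMap.add_apply, LinearMap.smul_apply, LinearMap.sum_apply, sum_rot_self,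
      casimir_of_mem h, eulerZ_of_mem (mem_H.1 h).1, eulerB_of_mem (mem_H.1 h).2.1, ← sub_smul,
      smul_smul, ← add_smul]
    rfl

/-! ### Diagonal Hermitian forms on polynomials -/

section Forms

variable {σ : Type*}

/-- The value of the Hermitian form for which the monomials are orthogonal, with squared norms
given by `W`. -/
def diagFormFun (W : (σ →₀ ℕ) → ℝ) (P Q : MvPolynomial σ ℂ) : ℂ :=
  ∑ s ∈ P.support, (W s : ℂ) * star (coeff s P) * coeff s Q

lemma diagFormFun_eq (W : (σ →₀ ℕ) → ℝ) (P Q : MvPolynomial σ ℂ) {T : Finset (σ →₀ ℕ)}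
    (hT : P.support ⊆ T) :
    diagFormFun W P Q = ∑ s ∈ T, (W s : ℂ) * star (coeff s P) * coeff s Q := by
  refine Finset.sum_subset hT fun s _ hs => ?_
  rw [notMem_support_iff.1 hs]; simp

/-- The Hermitian form for which the monomials are orthogonal, with squared norms given by `W`. -/
def diagForm (W : (σ →₀ ℕ) → ℝ) : MvPolynomial σ ℂ →ₗ⋆[ℂ] MvPolynomial σ ℂ →ₗ[ℂ] ℂ :=
  LinearMap.mk₂'ₛₗ (starRingEnd ℂ) (RingHom.id ℂ) (diagFormFun W)
    (fun P P' Q => by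
      classical
      rw [diagFormFun_eq W (P + P') Q support_add, diagFormFun_eq W P Q Finset.subset_union_left,
        diagFormFun_eq W P' Q Finset.subset_union_right, ← Finset.sum_add_distrib]
      refine Finset.sum_congr rfl fun s _ => ?_
      rw [coeff_add, star_add]; ring)
    (fun c P Q => by
      rw [diagFormFun_eq W (c • P) Q support_smul, diagFormFun, Finset.smul_sum]
      refine Finset.sum_congr rfl fun s _ => ?_
      rw [coeff_smul, smul_eq_mul, star_mul', smul_eq_mul]
      simp only [RCLike.star_def]; ring)
    (fun P Q Q' => by
      simp only [diagFormFun, coeff_add, mul_add, Finset.sum_add_distrib])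
    (fun c P Q => by
      simp only [diagFormFun, coeff_smul, smul_eq_mul, RingHom.id_apply, Finset.mul_sum]
      exact Finset.sum_congr rfl fun s _ => by ring)

lemma diagForm_apply (W : (σ →₀ ℕ) → ℝ) (P Q : MvPolynomial σ ℂ) :
    diagForm W P Q = ∑ s ∈ P.support, (W s : ℂ) * star (coeff s P) * coeff s Q := rfl

lemma diagForm_monomial (W : (σ →₀ ℕ) → ℝ) (s : σ →₀ ℕ) (x : ℂ) (Q : MvPolynomial σ ℂ) :
    diagForm W (monomial s x) Q = W s * star x * coeff s Q := by
  classical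
  rw [show diagForm W (monomial s x) Q = diagFormFun W (monomial s x) Q from rfl,
    diagFormFun_eq W _ Q support_monomial_subset]
  simp

lemma diagForm_symm (W : (σ →₀ ℕ) → ℝ) (P Q : MvPolynomial σ ℂ) :
    diagForm W Q P = star (diagForm W P Q) := by
  classical
  rw [show diagForm W P Q = diagFormFun W P Q from rfl,
    show diagForm W Q P = diagFormFun W Q P from rfl,
    diagFormFun_eq W P Q Finset.subset_union_left,
    diagFormFun_eq W Q P Finset.subset_union_right, star_sum]
  refine Finset.sum_congr rfl fun s _ => ?_
  simp only [star_mul', RCLike.star_def, Complex.conj_ofReal, Complex.conj_conj]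
  ring

lemma diagForm_self_pos {W : (σ →₀ ℕ) → ℝ} (hW : ∀ s, 0 < W s) {P : MvPolynomial σ ℂ}
    (hP : P ≠ 0) : 0 < (diagForm W P P).re := by
  have h : ∀ s, ((W s : ℂ) * star (coeff s P) * coeff s P).re = W s * ‖coeff s P‖ ^ 2 := by
    intro s
    rw [mul_assoc, RCLike.star_def, Complex.conj_mul']
    norm_cast
  rw [diagForm_apply, Complex.re_sum]
  simp only [h]
  obtain ⟨s, hs⟩ := support_nonempty.2 hP
  refine Finset.sum_pos (fun t ht => ?_) ⟨s, hs⟩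
  exact mul_pos (hW t) (pow_pos (norm_pos_iff.2 (mem_support_iff.1 ht)) 2)

/-- Orthogonal projection onto a finite-dimensional subspace. Positivity is available on T only, so
it is T that becomes an inner product space. -/
lemma exists_sub_orthogonal {V : Type*} [AddCommGroup V] [Module ℂ V]
    (F : V →ₗ⋆[ℂ] V →ₗ[ℂ] ℂ) (hF : ∀ u v, F v u = star (F u v)) (T : Submodule ℂ V)
    (hpos : ∀ v ∈ T, v ≠ 0 → 0 < (F v v).re) {U : Submodule ℂ V} (hU : U ≤ T)
    [FiniteDimensional ℂ U] {v : V} (hv : v ∈ T) :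
    ∃ u ∈ U, ∀ u' ∈ U, F u' (v - u) = 0 := by
  let core : InnerProductSpace.Core ℂ T :=
    { inner := fun u v => F u v
      conj_inner_symm := fun u v => (hF v u).symm
      re_inner_nonneg := fun v => by
        by_cases h : v = 0
        · simp [h]
        · exact (hpos v v.2 (by simpa using h)).le
      add_left := fun u v w => by simp
      smul_left := fun u v c => by simp
      definite := fun v hv => by
        by_contra h
        have := hpos v v.2 (by simpa using h)
        rw [hv] at this
        simp at this }
  let := core.toNormedAddCommGroup
  let := InnerProductSpace.ofCore core.toCore
  have : FiniteDimensional ℂ (U.submoduleOf T) :=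
    (Submodule.submoduleOfEquivOfLe hU).symm.finiteDimensional
  obtain ⟨y, hy, z, hz, h⟩ := (U.submoduleOf T).exists_add_mem_mem_orthogonal ⟨v, hv⟩
  refine ⟨y, hy, fun u' hu' => ?_⟩
  have h2 : v - y = z := by
    have := congrArg Subtype.val h
    simp only [Submodule.coe_add] at this
    rw [this]; abel
  rw [h2]
  exact hz ⟨u', hU hu'⟩ hu'

end Forms

/-! ### The Fischer product -/

section Fischer

variable {p : ℕ}

/-- The bidegree of a variable. -/
def wt (s : Fin p ⊕ Fin p) : ℕ × ℕ := (wz p s, wzb p s)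

/-- The bidegree of a monomial. -/
def bideg (s : Fin p ⊕ Fin p →₀ ℕ) : ℕ × ℕ := (Finsupp.weight (wz p) s, Finsupp.weight (wzb p) s)

lemma bideg_add_single (s : Fin p ⊕ Fin p →₀ ℕ) (i : Fin p ⊕ Fin p) :
    bideg (s + Finsupp.single i 1) = bideg s + wt i := by
  simp [bideg, wt, Finsupp.weight_single]

/-- The Fischer form, rescaled by `c m` in bidegree `m`. -/
def fischer (p : ℕ) (c : ℕ × ℕ → ℝ) : Poly p →ₗ⋆[ℂ] Poly p →ₗ[ℂ] ℂ :=
  diagForm fun s => c (bideg s) * ∏ i, ((s i).factorial : ℝ)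

lemma prod_factorial_add_single {σ : Type*} [Fintype σ] (s : σ →₀ ℕ) (i : σ) :
    ∏ j, (((s + Finsupp.single i 1 : σ →₀ ℕ) j).factorial : ℝ) =
      (s i + 1) * ∏ j, ((s j).factorial : ℝ) := by
  classical
  rw [← Finset.mul_prod_erase _ _ (Finset.mem_univ i), ← Finset.mul_prod_erase _ (fun j =>
    ((s j).factorial : ℝ)) (Finset.mem_univ i), ← mul_assoc]
  congr 1
  · simp [Nat.factorial_succ]
  · refine Finset.prod_congr rfl fun j hj => ?_
    rw [Finsupp.add_apply, Finsupp.single_eq_of_ne (Finset.ne_of_mem_erase hj), add_zero]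

lemma fischer_symm (c : ℕ × ℕ → ℝ) (P Q : Poly p) :
    fischer p c Q P = star (fischer p c P Q) := diagForm_symm _ _ _

lemma fischer_self_pos {c : ℕ × ℕ → ℝ} (hc : ∀ m, 0 < c m) {P : Poly p} (hP : P ≠ 0) :
    0 < (fischer p c P P).re :=
  diagForm_self_pos (fun s => mul_pos (hc _)
    (Finset.prod_pos fun i _ => by exact_mod_cast Nat.factorial_pos _)) hP

/-- The factorials in the norms make multiplication by a variable adjoint to differentiation. The
weight shifts because c is read at the bidegree of the product. -/
lemma fischer_X_mul (c : ℕ × ℕ → ℝ) (i : Fin p ⊕ Fin p) (P Q : Poly p) :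
    fischer p c (X i * P) Q = fischer p (fun m => c (m + wt i)) P (pderiv i Q) := by
  induction P using MvPolynomial.induction_on' with
  | monomial s x =>
    rw [mul_comm, X, monomial_mul, mul_one, fischer, fischer, diagForm_monomial, diagForm_monomial,
      bideg_add_single, prod_factorial_add_single, coeff_pderiv]
    push_cast
    ring
  | add P P' h1 h2 => rw [mul_add, map_add, map_add, LinearMap.add_apply, LinearMap.add_apply, h1, h2]

lemma fischer_mul_X (c : ℕ × ℕ → ℝ) (i : Fin p ⊕ Fin p) (P Q : Poly p) :
    fischer p c P (X i * Q) = fischer p (fun m => c (m + wt i)) (pderiv i P) Q := by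
  rw [fischer_symm c (X i * Q) P, fischer_X_mul, ← fischer_symm]

lemma fischer_rot (c : ℕ × ℕ → ℝ) (i j : Fin p) (P Q : Poly p) :
    fischer p c (rot i j P) Q = fischer p c P (rot j i Q) := by
  rw [rot_apply, rot_apply, map_sub, map_sub, LinearMap.sub_apply, fischer_X_mul, fischer_X_mul,
    fischer_mul_X, fischer_mul_X]
  -- All variables of one kind have the same bidegree, so the shifted weights on both sides agree.
  rfl

/-- Consequently harmonic polynomials are orthogonal to all multiples of |z|². -/
lemma fischer_r2_mul (c : ℕ × ℕ → ℝ) (P Q : Poly p) :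
    fischer p c (r2 p * P) Q = fischer p (fun m => c (m + (1, 1))) P (lap p Q) := by
  rw [r2, Finset.sum_mul, lap_apply, map_sum, map_sum, LinearMap.sum_apply]
  refine Finset.sum_congr rfl fun i _ => ?_
  rw [mul_assoc, fischer_X_mul, fischer_X_mul, pderiv_comm']
  congr 2

end Fischer

/-! ### Irreducibility of the spaces of harmonic polynomials -/

section Irreducible

variable {p : ℕ} {m : ℕ × ℕ}

instance (m : ℕ × ℕ) : FiniteDimensional ℂ (H p m) := by
  have h : H p m ≤ restrictTotalDegree (Fin p ⊕ Fin p) ℂ (m.1 + m.2) := by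
    intro P hP
    obtain ⟨h1, h2, -⟩ := mem_H.1 hP
    rw [mem_restrictTotalDegree]
    refine Finset.sup_le fun s hs => ?_
    have e1 := h1 (mem_support_iff.1 hs)
    have e2 := h2 (mem_support_iff.1 hs)
    rw [← e1, ← e2, Finsupp.weight_apply, Finsupp.weight_apply,
      Finsupp.sum_fintype _ _ (by simp), Finsupp.sum_fintype _ _ (by simp),
      Finsupp.sum_fintype _ _ (by simp), Fintype.sum_sum_type, Fintype.sum_sum_type,
      Fintype.sum_sum_type]
    simp
  exact Submodule.finiteDimensional_of_le h

/-- The highest weight vector `z_{o₁}^{m₁} conj(z_{o₂})^{m₂}`. -/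
def hwv (o₁ o₂ : Fin p) (m : ℕ × ℕ) : Poly p :=
  monomial (Finsupp.single (Sum.inl o₁) m.1 + Finsupp.single (Sum.inr o₂) m.2) 1

lemma hwv_ne_zero (o₁ o₂ : Fin p) (m : ℕ × ℕ) : hwv o₁ o₂ m ≠ 0 := by simp [hwv]

lemma hwv_eq (o₁ o₂ : Fin p) (m : ℕ × ℕ) :
    hwv o₁ o₂ m = X (Sum.inl o₁) ^ m.1 * X (Sum.inr o₂) ^ m.2 := by
  simp [hwv, X_pow_eq_monomial, monomial_mul]

lemma hwv_mem {o₁ o₂ : Fin p} (ho : o₁ ≠ o₂) (m : ℕ × ℕ) : hwv o₁ o₂ m ∈ H p m := by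
  refine mem_H.2 ⟨isWeightedHomogeneous_monomial _ _ _ ?_,
    isWeightedHomogeneous_monomial _ _ _ ?_, ?_⟩
  · simp [Finsupp.weight_single]
  · simp [Finsupp.weight_single]
  · rw [lap_apply]
    refine Finset.sum_eq_zero fun i _ => ?_
    rw [hwv_eq, pderiv_mul, pderiv_pow, pderiv_pow]
    by_cases h : i = o₂
    · subst h
      rw [pderiv_X_of_ne (by simp), pderiv_X_self, mul_zero, zero_mul, zero_add, mul_one,
        pderiv_mul, pderiv_mul, pderiv_pow, pderiv_pow, pderiv_X_of_ne (by simpa using ho),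
        pderiv_X_of_ne (by simp)]
      have : pderiv (Sum.inl i) ((m.2 : Poly p)) = 0 := by
        rw [← map_natCast C]; exact pderiv_C
      rw [this]; simp
    · rw [pderiv_X_of_ne (by simp), pderiv_X_of_ne (by simpa using fun e => h e.symm)]
      simp

lemma coeff_X_mul_pderiv {σ : Type*} (i : σ) (P : MvPolynomial σ ℂ) (s : σ →₀ ℕ) :
    coeff s (X i * pderiv i P) = s i * coeff s P := by
  classical
  rw [coeff_X_mul', ]
  split_ifs with h
  · have h1 : s i ≠ 0 := Finsupp.mem_support_iff.1 h
    have h2 : s - Finsupp.single i 1 + Finsupp.single i 1 = s := by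
      refine tsub_add_cancel_of_le ?_
      rw [Finsupp.single_le_iff]; omega
    rw [coeff_pderiv, h2, Finsupp.tsub_apply, Finsupp.single_eq_same,
      Nat.cast_sub (by omega)]
    push_cast; ring
  · rw [Finsupp.notMem_support_iff.1 h]; simp

/-- The polynomials all of whose monomials have weight at least `n`. -/
def WeightGE {σ : Type*} (q : σ → ℕ) (n : ℕ) (P : MvPolynomial σ ℂ) : Prop :=
  ∀ s, coeff s P ≠ 0 → n ≤ Finsupp.weight q s

lemma WeightGE.X_mul_pderiv {σ : Type*} {q : σ → ℕ} {n : ℕ} {P : MvPolynomial σ ℂ}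
    (h : WeightGE q n P) {i j : σ} (hij : q j + 1 ≤ q i) :
    WeightGE q (n + 1) (X i * pderiv j P) := by
  classical
  intro s hs
  rw [coeff_X_mul'] at hs
  split_ifs at hs with hi
  · have h1 : s i ≠ 0 := Finsupp.mem_support_iff.1 hi
    have h2 : s - Finsupp.single i 1 + Finsupp.single i 1 = s := by
      refine tsub_add_cancel_of_le ?_
      rw [Finsupp.single_le_iff]; omega
    rw [coeff_pderiv] at hs
    have h3 := h _ (left_ne_zero_of_mul hs)
    rw [← h2, map_add, Finsupp.weight_single]
    rw [map_add, Finsupp.weight_single] at h3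
    simp only [one_smul] at h3 ⊢
    omega
  · exact absurd rfl hs

lemma WeightGE.sub {σ : Type*} {q : σ → ℕ} {n : ℕ} {P Q : MvPolynomial σ ℂ}
    (hP : WeightGE q n P) (hQ : WeightGE q n Q) : WeightGE q n (P - Q) := by
  intro s hs
  by_cases h : coeff s P = 0
  · refine hQ s fun h' => hs ?_
    rw [coeff_sub, h, h', sub_zero]
  · exact hP s h

/-- A vector is of highest weight when all raising operators kill it. -/
def IsHighest (o₁ o₂ : Fin p) (Q : Poly p) : Prop :=
  (∀ j, j ≠ o₁ → rot o₁ j Q = 0) ∧ ∀ j, j ≠ o₂ → rot j o₂ Q = 0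

/-- A weight that all raising operators increase. -/
def raiseWeight (o₁ o₂ : Fin p) : Fin p ⊕ Fin p → ℕ :=
  Sum.elim (fun i => if i = o₁ then 2 else if i = o₂ then 0 else 1)
    (fun i => if i = o₂ then 2 else if i = o₁ then 0 else 1)

/-- No variable has weight above 2, and a monomial of P has m₁ + m₂ variables. -/
lemma raiseWeight_le {o₁ o₂ : Fin p} {P : Poly p} (hP : P ∈ H p m) {s : Fin p ⊕ Fin p →₀ ℕ}
    (hs : coeff s P ≠ 0) : Finsupp.weight (raiseWeight o₁ o₂) s ≤ 2 * (m.1 + m.2) := by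
  obtain ⟨h1, h2, -⟩ := mem_H.1 hP
  rw [← h1 hs, ← h2 hs, Finsupp.weight_apply, Finsupp.weight_apply, Finsupp.weight_apply,
      Finsupp.sum_fintype _ _ (by simp), Finsupp.sum_fintype _ _ (by simp),
      Finsupp.sum_fintype _ _ (by simp), ← Finset.sum_add_distrib, Finset.mul_sum]
  refine Finset.sum_le_sum fun i _ => ?_
  simp only [smul_eq_mul, ← mul_add]
  rw [mul_left_comm]
  refine Nat.mul_le_mul_left _ ?_
  rcases i with i | i <;> simp only [raiseWeight, Sum.elim_inl, Sum.elim_inr] <;> split_ifs <;> omega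

/-- Apply raising operators as long as one of them acts nontrivially. Each application increases the
least weight n of a monomial, and the weight is bounded by 2(m₁ + m₂), so the process stops; k
counts the steps still possible. -/
lemma RotStable.exists_isHighest {o₁ o₂ : Fin p} (ho : o₁ ≠ o₂) {U : Submodule ℂ (Poly p)}
    (hU : RotStable U) (k : ℕ) : ∀ n, n + k = 2 * (m.1 + m.2) + 1 → ∀ P ∈ U, P ∈ H p m → P ≠ 0 →
      WeightGE (raiseWeight o₁ o₂) n P → ∃ Q ∈ U, Q ∈ H p m ∧ Q ≠ 0 ∧ IsHighest o₁ o₂ Q := by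
  induction k with
  | zero =>
    intro n hn P _ hP h0 hw
    obtain ⟨s, hs⟩ := ne_zero_iff.1 h0
    have h1 := hw s hs
    have h2 := raiseWeight_le (o₁ := o₁) (o₂ := o₂) hP hs
    omega
  | succ k ih =>
    intro n hn P hPU hP h0 hw
    by_cases hP' : IsHighest o₁ o₂ P
    · exact ⟨P, hPU, hP, h0, hP'⟩
    · rw [IsHighest, not_and_or] at hP'
      push Not at hP'
      rcases hP' with ⟨j, hj, hne⟩ | ⟨j, hj, hne⟩
      · refine ih (n + 1) (by omega) _ (hU _ _ _ hPU) (rot_mem hP _ _) hne ?_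
        refine WeightGE.sub (hw.X_mul_pderiv ?_) (hw.X_mul_pderiv ?_) <;>
        · simp only [raiseWeight, Sum.elim_inl, Sum.elim_inr]
          split_ifs <;> simp_all
      · refine ih (n + 1) (by omega) _ (hU _ _ _ hPU) (rot_mem hP _ _) hne ?_
        refine WeightGE.sub (hw.X_mul_pderiv ?_) (hw.X_mul_pderiv ?_) <;>
        · simp only [raiseWeight, Sum.elim_inl, Sum.elim_inr]
          split_ifs <;> simp_all

/-- The raising equations and unique factorisation give one polynomial R with ∂_j Q = conj(z_j) R
for j ≠ o₁ and ∂̄_j Q = z_j R for j ≠ o₂. Harmonicity then reads (p + a partial Euler operator) R =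
0, and this operator multiplies each monomial by a positive number, so R = 0. Hence Q involves only
z_{o₁} and conj(z_{o₂}), and its bidegree determines the monomial. -/
lemma IsHighest.eq_smul_hwv {o₁ o₂ : Fin p} (ho : o₁ ≠ o₂) {Q : Poly p} (hQ : Q ∈ H p m)
    (h : IsHighest o₁ o₂ Q) : ∃ c : ℂ, Q = c • hwv o₁ o₂ m := by
  obtain ⟨h1, h2, h3⟩ := mem_H.1 hQ
  have a1 : ∀ j, j ≠ o₁ → X (Sum.inl o₁) * pderiv (Sum.inl j) Q =
      X (Sum.inr j) * pderiv (Sum.inr o₁) Q := fun j hj => sub_eq_zero.1 (h.1 j hj)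
  have a2 : ∀ j, j ≠ o₂ → X (Sum.inl j) * pderiv (Sum.inl o₂) Q =
      X (Sum.inr o₂) * pderiv (Sum.inr j) Q := fun j hj => sub_eq_zero.1 (h.2 j hj)
  obtain ⟨R, hR⟩ : X (Sum.inl o₁) ∣ pderiv (Sum.inr o₁) Q := by
    have hd : (X (Sum.inl o₁) : Poly p) ∣ X (Sum.inr o₂) * pderiv (Sum.inr o₁) Q :=
      ⟨_, (a1 o₂ ho.symm).symm⟩
    refine (X_prime.dvd_or_dvd hd).resolve_left fun hd' => ?_
    rw [X_dvd_X] at hd'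
    simp at hd'
  have b1 : ∀ j, j ≠ o₁ → pderiv (Sum.inl j) Q = X (Sum.inr j) * R := by
    intro j hj
    have := a1 j hj
    rw [hR, mul_left_comm] at this
    exact mul_left_cancel₀ (X_ne_zero _) this
  have b2 : ∀ j, j ≠ o₂ → pderiv (Sum.inr j) Q = X (Sum.inl j) * R := by
    intro j hj
    have := a2 j hj
    rw [b1 o₂ ho.symm, mul_left_comm] at this
    exact (mul_left_cancel₀ (X_ne_zero _) this).symm
  have hR0 : R = 0 := by
    -- For j = o₂ there is no formula for ∂̄_j Q, so the derivatives are taken in the other order;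
    -- this is why the variable depends on j.
    have e : ∀ j, pderiv (Sum.inl j) (pderiv (Sum.inr j) Q) = R +
        X (if j = o₂ then Sum.inr j else Sum.inl j) *
          pderiv (if j = o₂ then Sum.inr j else Sum.inl j) R := by
      intro j
      by_cases hj : j = o₂
      · subst hj
        rw [pderiv_comm', b1 j ho.symm, pderiv_X_mul, if_pos rfl, if_pos rfl]
      · rw [b2 j hj, pderiv_X_mul, if_pos rfl, if_neg hj]
    rw [lap_apply, Finset.sum_congr rfl fun j _ => e j, Finset.sum_add_distrib,
      Finset.sum_const, Finset.card_univ, Fintype.card_fin] at h3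
    ext s
    have h4 := congrArg (coeff s) h3
    rw [coeff_add, coeff_smul, coeff_sum] at h4
    simp only [coeff_X_mul_pderiv, coeff_zero, ← Finset.sum_mul, nsmul_eq_mul, ← add_mul] at h4
    rw [coeff_zero]
    refine (mul_eq_zero.1 h4).resolve_left ?_
    rw [← Nat.cast_sum, ← Nat.cast_add]
    have hp : 0 < p := o₁.pos
    exact_mod_cast (by omega)
  have hz : ∀ i, i ≠ Sum.inl o₁ → i ≠ Sum.inr o₂ → ∀ s, coeff s Q ≠ 0 → s i = 0 := by
    intro i hi hi' s hs
    have : pderiv i Q = 0 := by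
      rcases i with i | i
      · rw [b1 i (by simpa using hi), hR0, mul_zero]
      · rw [b2 i (by simpa using hi'), hR0, mul_zero]
    have h5 := coeff_X_mul_pderiv i Q s
    rw [this, mul_zero, coeff_zero] at h5
    exact_mod_cast (mul_eq_zero.1 h5.symm).resolve_right hs
  set s₀ : Fin p ⊕ Fin p →₀ ℕ :=
    Finsupp.single (Sum.inl o₁) m.1 + Finsupp.single (Sum.inr o₂) m.2 with hs₀
  have hs : ∀ s, coeff s Q ≠ 0 → s = s₀ := by
    intro s hs
    have e1 := h1 hs
    have e2 := h2 hs
    rw [Finsupp.weight_apply, Finsupp.sum_fintype _ _ (by simp), Fintype.sum_sum_type] at e1 e2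
    simp only [Sum.elim_inl, Sum.elim_inr, smul_eq_mul, mul_one, mul_zero,
      Finset.sum_const_zero, add_zero, zero_add] at e1 e2
    rw [Finset.sum_eq_single o₁ (fun i _ hi => hz _ (by simpa using hi) (by simp) s hs)
      (by simp)] at e1
    rw [Finset.sum_eq_single o₂ (fun i _ hi => hz _ (by simp) (by simpa using hi) s hs)
      (by simp)] at e2
    ext i
    by_cases hi : i = Sum.inl o₁
    · subst hi; simp [hs₀, e1]
    · by_cases hi' : i = Sum.inr o₂
      · subst hi'; simp [hs₀, e2]
      · rw [hz i hi hi' s hs, hs₀, Finsupp.add_apply, Finsupp.single_eq_of_ne hi,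
          Finsupp.single_eq_of_ne hi', add_zero]
  refine ⟨coeff s₀ Q, ?_⟩
  ext s
  rw [coeff_smul, hwv, ← hs₀, coeff_monomial]
  split_ifs with he
  · rw [he]; simp
  · by_contra hne
    rw [smul_zero] at hne
    exact he (hs s hne).symm

lemma RotStable.hwv_mem {o₁ o₂ : Fin p} (ho : o₁ ≠ o₂) {U : Submodule ℂ (Poly p)}
    (hU : RotStable U) {P : Poly p} (hPU : P ∈ U) (hP : P ∈ H p m) (h0 : P ≠ 0) :
    hwv o₁ o₂ m ∈ U := by
  obtain ⟨Q, hQU, hQ, hQ0, hh⟩ := hU.exists_isHighest ho (2 * (m.1 + m.2) + 1) 0 (by omega) P hPU hP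
    h0 (fun s _ => Nat.zero_le _)
  obtain ⟨c, rfl⟩ := hh.eq_smul_hwv ho hQ
  have hc : c ≠ 0 := fun h => hQ0 (by rw [h, zero_smul])
  have := U.smul_mem c⁻¹ hQU
  rwa [smul_smul, inv_mul_cancel₀ hc, one_smul] at this

/-- A `𝔤𝔩(p)`-stable space that meets `H p m` contains it. -/
theorem RotStable.H_le (hp : 1 < p) {U : Submodule ℂ (Poly p)}
    (hU : RotStable U) {P : Poly p} (hPU : P ∈ U) (hP : P ∈ H p m) (h0 : P ≠ 0) :
    H p m ≤ U := by
  have ho : (⟨0, by omega⟩ : Fin p) ≠ ⟨1, hp⟩ := by simp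
  have h1 := hU.hwv_mem ho hPU hP h0
  intro Q hQ
  by_contra hQU
  have : FiniteDimensional ℂ (U ⊓ H p m : Submodule ℂ (Poly p)) :=
    Submodule.finiteDimensional_of_le inf_le_right
  obtain ⟨u, hu, ho'⟩ := exists_sub_orthogonal (fischer p 1) (fischer_symm 1) (H p m)
    (fun v _ hv => fischer_self_pos (fun _ => one_pos) hv) (inf_le_right (a := U)) hQ
  -- The orthogonal complement of U ⊓ `H p m` inside `H p m` is stable too, since the adjoint of
  -- `rot i j` is `rot j i`. If it were nonzero it would contain the same highest weight vector as
  -- U, which would then be orthogonal to itself.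
  let U' : Submodule ℂ (Poly p) :=
    { carrier := {P | P ∈ H p m ∧ ∀ u ∈ U ⊓ H p m, fischer p 1 u P = 0}
      zero_mem' := ⟨zero_mem _, fun u _ => map_zero _⟩
      add_mem' := fun {a b} ha hb => ⟨add_mem ha.1 hb.1, fun u hu => by
        rw [map_add, ha.2 u hu, hb.2 u hu, add_zero]⟩
      smul_mem' := fun c a ha => ⟨Submodule.smul_mem _ c ha.1, fun u hu => by
        rw [map_smul, ha.2 u hu, smul_zero]⟩ }
  have hU' : RotStable U' := fun i j P hP => ⟨rot_mem hP.1 i j, fun u hu => by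
    rw [← fischer_rot]
    exact hP.2 _ ⟨hU _ _ _ hu.1, rot_mem hu.2 _ _⟩⟩
  have hne : Q - u ≠ 0 := fun h => hQU (by rw [sub_eq_zero.1 h]; exact hu.1)
  have hm : Q - u ∈ H p m := sub_mem hQ hu.2
  have h2 := hU'.hwv_mem (m := m) (P := Q - u) ho ⟨hm, ho'⟩ hm hne
  have h3 := h2.2 _ ⟨h1, h2.1⟩
  have h4 := fischer_self_pos (c := 1) (fun _ => one_pos) (hwv_ne_zero (⟨0, by omega⟩ : Fin p) ⟨1, hp⟩ m)
  rw [h3] at h4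
  simp at h4

end Irreducible

/-! ### The polynomial model of the `K`-finite vectors -/

section Model

variable {p : ℕ} {a : ℂ} {k : ℤ}

lemma w_ne_zero (x : X0 p) : x.1 (Sum.inr ()) ≠ 0 := by
  intro h
  have h2 := x.2.2
  rw [h, norm_zero, zero_pow two_ne_zero,
    Finset.sum_eq_zero_iff_of_nonneg fun i _ => sq_nonneg _] at h2
  refine x.2.1 (funext fun i => ?_)
  rcases i with i | i
  · simpa using h2 i (Finset.mem_univ i)
  · exact h

/-- The character `t ↦ |t|^a (t/|t|)^k`. -/
def psi (a : ℂ) (k : ℤ) (t : ℂ) : ℂ := ((‖t‖ : ℝ) : ℂ) ^ a * (t / ((‖t‖ : ℝ) : ℂ)) ^ k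

lemma psi_mul (s t : ℂ) : psi a k (s * t) = psi a k s * psi a k t := by
  rw [psi, psi, psi, norm_mul, Complex.ofReal_mul,
    Complex.mul_cpow_ofReal_nonneg (norm_nonneg _) (norm_nonneg _), mul_div_mul_comm, mul_zpow]
  ring

lemma psi_one : psi a k 1 = 1 := by simp [psi]

lemma norm_psi {t : ℂ} (ht : ‖t‖ = 1) : ‖psi a k t‖ = 1 := by
  simp [psi, ht]

/-- The polynomial `P` as a function on the light cone: homogeneous, and equal to
`P(z, conj z)` at the points with `w = 1`. -/
def Phi (p : ℕ) (a : ℂ) (k : ℤ) : Poly p →ₗ[ℂ] (X0 p → ℂ) where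
  toFun P := fun x => psi a k (x.1 (Sum.inr ())) *
    eval (Sum.elim (fun i => x.1 (Sum.inl i) / x.1 (Sum.inr ()))
      (fun i => starRingEnd ℂ (x.1 (Sum.inl i) / x.1 (Sum.inr ())))) P
  map_add' P Q := by ext x; simp [mul_add]
  map_smul' c P := by ext x; simp [smul_eval]; ring

lemma Phi_apply (P : Poly p) (x : X0 p) : Phi p a k P x = psi a k (x.1 (Sum.inr ())) *
    eval (Sum.elim (fun i => x.1 (Sum.inl i) / x.1 (Sum.inr ()))
      (fun i => starRingEnd ℂ (x.1 (Sum.inl i) / x.1 (Sum.inr ())))) P := rfl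

lemma wPow_eq (n : ℤ) {w : ℂ} (hw : w ≠ 0) :
    wPow n w = ((‖w‖ : ℝ) : ℂ) ^ n.natAbs * (w / ((‖w‖ : ℝ) : ℂ)) ^ n := by
  have hr : ((‖w‖ : ℝ) : ℂ) ≠ 0 := by simpa using hw
  have hc : starRingEnd ℂ w = ((‖w‖ : ℝ) : ℂ) * (w / ((‖w‖ : ℝ) : ℂ))⁻¹ := by
    rw [inv_div, mul_div_assoc', eq_div_iff hw, Complex.conj_mul', sq]
  rw [wPow]
  split_ifs with h
  · lift n to ℕ using h
    rw [zpow_natCast, Int.toNat_natCast, Int.natAbs_natCast, ← mul_pow, mul_div_cancel₀ _ hr]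
  · obtain ⟨m, rfl⟩ : ∃ m : ℕ, n = -m := ⟨n.natAbs, by omega⟩
    rw [neg_neg, Int.toNat_natCast, Int.natAbs_neg, Int.natAbs_natCast, _root_.zpow_neg, zpow_natCast,
      hc, mul_pow, inv_pow]

lemma eval_smul_of_bihomogeneous {m : ℕ × ℕ} {P : Poly p}
    (h1 : P.IsWeightedHomogeneous (wz p) m.1) (h2 : P.IsWeightedHomogeneous (wzb p) m.2)
    (c d : ℂ) (f g : Fin p → ℂ) :
    eval (Sum.elim (fun i => c * f i) (fun i => d * g i)) P =
      c ^ m.1 * d ^ m.2 * eval (Sum.elim f g) P := by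
  rw [eval_eq', eval_eq', Finset.mul_sum]
  refine Finset.sum_congr rfl fun s hs => ?_
  have e1 := h1 (mem_support_iff.1 hs)
  have e2 := h2 (mem_support_iff.1 hs)
  rw [Finsupp.weight_apply, Finsupp.sum_fintype _ _ (by simp), Fintype.sum_sum_type] at e1 e2
  simp only [Sum.elim_inl, Sum.elim_inr, smul_eq_mul, mul_one, mul_zero,
      Finset.sum_const_zero, add_zero, zero_add] at e1 e2
  rw [Fintype.prod_sum_type, Fintype.prod_sum_type, ← e1, ← e2]
  simp only [Sum.elim_inl, Sum.elim_inr, mul_pow, Finset.prod_mul_distrib, Finset.prod_pow_eq_pow_sum]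
  ring

/-- On the cone |z|² = |w|², and bihomogeneity extracts w^{m₁} conj(w)^{m₂} from P. Every remaining
factor is a power of |w| or of w/|w|; the exponents add up to a and to k, independently of m. -/
lemma jMap_eq_Phi {m : ℕ × ℕ} {P : Poly p} (hP : P ∈ H p m) :
    jMap p a k m.1 m.2 P = Phi p a k P := by
  obtain ⟨h1, h2, -⟩ := mem_H.1 hP
  ext x
  have hw := (w_ne_zero x)
  have hx := x.2.2
  simp only [jMap, Phi_apply, hx]
  set w := x.1 (Sum.inr ()) with hwdef
  have hr : ((‖w‖ : ℝ) : ℂ) ≠ 0 := by simpa using hw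
  set n : ℤ := k - m.1 + m.2 with hn
  have e1 : eval (Sum.elim (fun i => x.1 (Sum.inl i)) (fun i => starRingEnd ℂ (x.1 (Sum.inl i)))) P
      = w ^ m.1 * (starRingEnd ℂ w) ^ m.2 * eval (Sum.elim (fun i => x.1 (Sum.inl i) / w)
        (fun i => starRingEnd ℂ (x.1 (Sum.inl i) / w))) P := by
    rw [← eval_smul_of_bihomogeneous h1 h2]
    refine congrArg (fun f => eval f P) (funext fun i => ?_)
    rcases i with i | i
    · simp only [Sum.elim_inl]
      rw [mul_div_cancel₀ _ hw]
    · simp only [Sum.elim_inr]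
      rw [← map_mul, mul_div_cancel₀ _ hw]
  have hu : w / ((‖w‖ : ℝ) : ℂ) ≠ 0 := div_ne_zero hw hr
  have hc := wPow_eq (-m.2) hw
  have hc' : wPow (-m.2) w = (starRingEnd ℂ w) ^ m.2 := by
    rw [wPow]; split_ifs with h
    · have : m.2 = 0 := by omega
      simp [this]
    · simp
  have hd := wPow_eq m.1 hw
  have hd' : wPow m.1 w = w ^ m.1 := by
    rw [wPow, if_pos (by positivity)]; simp
  have hN : ((|n| : ℤ) : ℂ) = (n.natAbs : ℂ) := by
    rw [Int.abs_eq_natAbs]; simp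
  have hpow : ((‖w‖ ^ 2 : ℝ) : ℂ) ^ ((a - m.1 - m.2 - ((|n| : ℤ) : ℂ)) / 2) =
      ((‖w‖ : ℝ) : ℂ) ^ a * (((‖w‖ : ℝ) : ℂ) ^ (m.1 + m.2 + n.natAbs))⁻¹ := by
    rw [sq, Complex.ofReal_mul, Complex.mul_cpow_ofReal_nonneg (norm_nonneg _) (norm_nonneg _),
      ← Complex.cpow_add _ _ hr, ← Complex.cpow_natCast, ← Complex.cpow_neg,
      ← Complex.cpow_add _ _ hr, hN]
    congr 1
    push_cast
    ring
  have hz : (w / ((‖w‖ : ℝ) : ℂ)) ^ k = (w / ((‖w‖ : ℝ) : ℂ)) ^ (m.1 : ℤ) *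
      (w / ((‖w‖ : ℝ) : ℂ)) ^ (-m.2 : ℤ) * (w / ((‖w‖ : ℝ) : ℂ)) ^ n := by
    rw [← zpow_add₀ hu, ← zpow_add₀ hu]
    congr 1
    rw [hn]; ring
  rw [e1, hpow, wPow_eq n hw, psi, hz, ← hc', ← hd', hc, hd]
  rw [Int.natAbs_neg, Int.natAbs_natCast, Int.natAbs_natCast]
  have hne := pow_ne_zero (m.1 + m.2 + n.natAbs) hr
  field_simp
  ring

lemma KType_eq_map (m : ℕ × ℕ) : KType p a k m = (H p m).map (Phi p a k) := by
  rw [KType, ← Submodule.span_eq ((H p m).map (Phi p a k)), Submodule.map_coe]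
  congr 1
  exact Set.image_congr fun P hP => jMap_eq_Phi hP

lemma Phi_r2_mul (G : Poly p) : Phi p a k (r2 p * G) = Phi p a k G := by
  ext x
  have hw := (w_ne_zero x)
  have h : eval (Sum.elim (fun i => x.1 (Sum.inl i) / x.1 (Sum.inr ()))
      (fun i => starRingEnd ℂ (x.1 (Sum.inl i) / x.1 (Sum.inr ())))) (r2 p) = 1 := by
    simp only [r2, map_sum, map_mul, eval_X, Sum.elim_inl, Sum.elim_inr, Complex.mul_conj']
    have hx := x.2.2
    have hw' : ‖x.1 (Sum.inr ())‖ ^ 2 ≠ 0 := by simpa using hw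
    have : ∑ i : Fin p, ‖x.1 (Sum.inl i) / x.1 (Sum.inr ())‖ ^ 2 = 1 := by
      simp only [norm_div, div_pow, ← Finset.sum_div, hx, div_self hw']
    exact_mod_cast this
  rw [Phi_apply, Phi_apply, map_mul, h, one_mul]

/-- Because |z|² acts as 1, the product z_i P is on the cone the sum of two harmonic parts, one with
the z-degree raised and one with the conj z-degree lowered. -/
lemma Phi_X_inl_mul {m : ℕ × ℕ} (i : Fin p) (P : Poly p) :
    Phi p a k (X (Sum.inl i) * P) = Phi p a k (upZ m i P) +
      ((p : ℂ) + m.1 + m.2 - 1)⁻¹ • Phi p a k (pderiv (Sum.inr i) P) := by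
  rw [upZ, map_sub, map_smul, Phi_r2_mul, sub_add_cancel]

lemma Phi_X_inr_mul {m : ℕ × ℕ} (i : Fin p) (P : Poly p) :
    Phi p a k (X (Sum.inr i) * P) = Phi p a k (upB m i P) +
      ((p : ℂ) + m.1 + m.2 - 1)⁻¹ • Phi p a k (pderiv (Sum.inl i) P) := by
  rw [upB, map_sub, map_smul, Phi_r2_mul, sub_add_cancel]

/-! ### The action of the Lie algebra -/

/-- The operator `z_j (E - α) - ∂̄_j`. -/
def boostZ (α : ℂ) (j : Fin p) : Poly p →ₗ[ℂ] Poly p :=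
  LinearMap.mulLeft ℂ (X (Sum.inl j)) ∘ₗ (eulerZ p - α • LinearMap.id) -
    (pderiv (Sum.inr j)).toLinearMap

/-- The operator `conj(z_j) (Ē - β) - ∂_j`. -/
def boostB (β : ℂ) (j : Fin p) : Poly p →ₗ[ℂ] Poly p :=
  LinearMap.mulLeft ℂ (X (Sum.inr j)) ∘ₗ (eulerB p - β • LinearMap.id) -
    (pderiv (Sum.inl j)).toLinearMap

lemma boostZ_apply (α : ℂ) (j : Fin p) (P : Poly p) :
    boostZ α j P = X (Sum.inl j) * (eulerZ p P - α • P) - pderiv (Sum.inr j) P := rfl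

lemma boostB_apply (β : ℂ) (j : Fin p) (P : Poly p) :
    boostB β j P = X (Sum.inr j) * (eulerB p P - β • P) - pderiv (Sum.inl j) P := rfl

/-- The operator on polynomials by which a matrix acts. -/
def lieOp (a : ℂ) (k : ℤ) (A : Matrix (Idx p) (Idx p) ℂ) : Poly p →ₗ[ℂ] Poly p :=
  ∑ j, A (Sum.inr ()) (Sum.inl j) • boostZ ((a + k) / 2) j +
    ∑ j, A (Sum.inl j) (Sum.inr ()) • boostB ((a - k) / 2) j +
    A (Sum.inr ()) (Sum.inr ()) • (eulerZ p - eulerB p - (k : ℂ) • LinearMap.id) -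
    ∑ i, ∑ j, A (Sum.inl i) (Sum.inl j) • rot j i

lemma lieOp_apply (A : Matrix (Idx p) (Idx p) ℂ) (P : Poly p) : lieOp a k A P =
    ∑ j, A (Sum.inr ()) (Sum.inl j) • boostZ ((a + k) / 2) j P +
    ∑ j, A (Sum.inl j) (Sum.inr ()) • boostB ((a - k) / 2) j P +
    A (Sum.inr ()) (Sum.inr ()) • (eulerZ p P - eulerB p P - (k : ℂ) • P) -
    ∑ i, ∑ j, A (Sum.inl i) (Sum.inl j) • rot j i P := by
  simp [lieOp, LinearMap.sum_apply]

/-- This form, |z|^(a-k) z^k through the real logarithm of |z|², can be differentiated at every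
nonzero point without choosing a branch. -/
lemma psi_eq {z : ℂ} (hz : z ≠ 0) : psi a k z =
    Complex.exp ((a - k) / 2 * (Real.log (Complex.normSq z) : ℝ)) * z ^ k := by
  have hr : ((‖z‖ : ℝ) : ℂ) ≠ 0 := by simpa using hz
  rw [psi, div_zpow, Complex.normSq_eq_norm_sq, Real.log_pow, Complex.cpow_def_of_ne_zero hr,
    ← Complex.ofReal_log (norm_nonneg z)]
  have : ((‖z‖ : ℝ) : ℂ) ^ k = Complex.exp (k * (Real.log ‖z‖ : ℝ)) := by
    rw [Complex.ofReal_log (norm_nonneg z), Complex.exp_int_mul, Complex.exp_log hr]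
  rw [this, mul_div_assoc', mul_comm, mul_div_assoc, ← Complex.exp_sub, mul_comm]
  congr 2
  push_cast
  ring

/-- Formally psi(w) = w^α conj(w)^β with α = (a + k)/2 and β = (a - k)/2; the second factor is its
logarithmic derivative. -/
lemma hasDerivAt_psi {w : ℝ → ℂ} {w' : ℂ} {t : ℝ} (hw : HasDerivAt w w' t) (h0 : w t ≠ 0) :
    HasDerivAt (fun s => psi a k (w s)) (psi a k (w t) *
      ((a + k) / 2 * (w' / w t) + (a - k) / 2 * starRingEnd ℂ (w' / w t))) t := by
  have hev : (fun s => psi a k (w s)) =ᶠ[nhds t] fun s =>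
      Complex.exp ((a - k) / 2 * (Real.log (Complex.normSq (w s)) : ℝ)) * w s ^ k := by
    filter_upwards [hw.continuousAt.eventually_ne h0] with s hs using psi_eq hs
  refine HasDerivAt.congr_of_eventuallyEq ?_ hev
  have hN : Complex.normSq (w t) ≠ 0 := by simpa using h0
  have hns : HasDerivAt (fun s => Complex.normSq (w s))
      (2 * ((w t).re * w'.re + (w t).im * w'.im)) t := by
    have hre : HasDerivAt (fun s => (w s).re) w'.re t :=
      Complex.reCLM.hasFDerivAt.comp_hasDerivAt t hw
    have him : HasDerivAt (fun s => (w s).im) w'.im t :=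
      Complex.imCLM.hasFDerivAt.comp_hasDerivAt t hw
    exact ((hre.mul hre).add (him.mul him)).congr_deriv (by ring)
  have h1 := ((hns.log hN).ofReal_comp.const_mul ((a - k) / 2)).cexp
  have h2 : HasDerivAt (fun s => w s ^ k) (k * w t ^ (k - 1) * w') t :=
    (hasDerivAt_zpow k (w t) (Or.inl h0)).comp t hw
  refine (h1.mul h2).congr_deriv ?_
  rw [psi_eq h0, zpow_sub_one₀ h0]
  have hcn : starRingEnd ℂ (w t) ≠ 0 := by simpa using h0
  have hNC : ((2 * ((w t).re * w'.re + (w t).im * w'.im) / Complex.normSq (w t) : ℝ) : ℂ) =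
      w' / w t + starRingEnd ℂ (w' / w t) := by
    rw [Complex.ofReal_div, Complex.normSq_eq_conj_mul_self, map_div₀, div_add_div _ _ h0 hcn,
      mul_comm (starRingEnd ℂ (w t))]
    congr 1
    apply Complex.ext <;> simp <;> ring
  rw [hNC]
  ring

lemma hasDerivAt_eval {σ : Type*} [Fintype σ] {g : σ → ℝ → ℂ} {g' : σ → ℂ} {t : ℝ}
    (hg : ∀ s, HasDerivAt (g s) (g' s) t) (P : MvPolynomial σ ℂ) :
    HasDerivAt (fun u => eval (fun s => g s u) P)
      (∑ s, g' s * eval (fun s => g s t) (pderiv s P)) t := by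
  classical
  induction P using MvPolynomial.induction_on with
  | C c => simpa using hasDerivAt_const t c
  | add P Q hP hQ =>
    simp only [map_add, mul_add, Finset.sum_add_distrib]
    exact hP.add hQ
  | mul_X P i hP =>
    have := hP.mul (hg i)
    simp only [map_mul, eval_X]
    refine this.congr_deriv ?_
    simp only [mul_comm P, pderiv_X_mul, map_add, map_mul, eval_X, mul_add, Finset.sum_add_distrib,
      Finset.sum_mul]
    rw [add_comm]
    congr 1
    · rw [Finset.sum_eq_single i]
      · rw [if_pos rfl, mul_comm]
      · intro j _ hj; rw [if_neg hj]; simp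
      · simp
    · exact Finset.sum_congr rfl fun s _ => by ring

lemma hasDerivAt_expU (A : uLie p) (x : X0 p) (i : Idx p) :
    HasDerivAt (fun t : ℝ => (expU A (-t) • x).1 i) (-(A.1 *ᵥ x.1) i) 0 := by
  let : NormedRing (Matrix (Idx p) (Idx p) ℂ) := Matrix.linftyOpNormedRing
  let : NormedAlgebra ℝ (Matrix (Idx p) (Idx p) ℂ) := Matrix.linftyOpNormedAlgebra
  let : NormedAlgebra ℂ (Matrix (Idx p) (Idx p) ℂ) := Matrix.linftyOpNormedAlgebra
  have h1 : HasDerivAt (fun t : ℝ => NormedSpace.exp (t • A.1)) A.1 0 := by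
    have := hasDerivAt_exp_smul_const (𝕂 := ℝ) A.1 (0 : ℝ)
    rw [zero_smul, NormedSpace.exp_zero, one_mul] at this
    exact this
  have h2 : HasDerivAt (fun t : ℝ => NormedSpace.exp ((-t) • A.1)) (-A.1) 0 := by
    have h3 : HasDerivAt (fun t : ℝ => -t) (-1) 0 := hasDerivAt_neg 0
    have h1' : HasDerivAt (fun t : ℝ => NormedSpace.exp (t • A.1)) A.1 (-0) := by simpa using h1
    exact (HasDerivAt.scomp (0 : ℝ) h1' h3).congr_deriv (by simp)
  let L : Matrix (Idx p) (Idx p) ℂ →ₗ[ℝ] ℂ :=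
    { toFun := fun M => (M *ᵥ x.1) i
      map_add' := fun M N => by rw [Matrix.add_mulVec]; rfl
      map_smul' := fun c M => by rw [Matrix.smul_mulVec]; rfl }
  have h4 := (LinearMap.toContinuousLinearMap L).hasFDerivAt.comp_hasDerivAt (0 : ℝ) h2
  refine h4.congr_deriv ?_
  change ((-A.1) *ᵥ x.1) i = _
  rw [Matrix.neg_mulVec]; rfl

lemma uLie_entries (A : uLie p) :
    (∀ i j, starRingEnd ℂ (A.1 (Sum.inl i) (Sum.inl j)) = -A.1 (Sum.inl j) (Sum.inl i)) ∧
    (∀ i, starRingEnd ℂ (A.1 (Sum.inl i) (Sum.inr ())) = A.1 (Sum.inr ()) (Sum.inl i)) ∧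
    (∀ i, starRingEnd ℂ (A.1 (Sum.inr ()) (Sum.inl i)) = A.1 (Sum.inl i) (Sum.inr ())) ∧
    starRingEnd ℂ (A.1 (Sum.inr ()) (Sum.inr ())) = -A.1 (Sum.inr ()) (Sum.inr ()) := by
  have hA : A.1ᴴ * gram p + gram p * A.1 = 0 := A.2
  have h : ∀ i j, starRingEnd ℂ (A.1 j i) * gram p j j + gram p i i * A.1 i j = 0 := by
    intro i j
    have := congrFun (congrFun hA i) j
    simpa [gram, Matrix.mul_diagonal, Matrix.diagonal_mul] using this
  refine ⟨fun i j => ?_, fun i => ?_, fun i => ?_, ?_⟩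
  · simpa [gram] using eq_neg_of_add_eq_zero_left (h (Sum.inl j) (Sum.inl i))
  · have := eq_neg_of_add_eq_zero_left (h (Sum.inr ()) (Sum.inl i))
    simpa [gram] using this
  · have := h (Sum.inl i) (Sum.inr ())
    simp [gram] at this
    linear_combination -this
  · have := h (Sum.inr ()) (Sum.inr ())
    simp [gram] at this
    linear_combination -this

/-- In the coordinate ζ = z/w the group acts by fractional linear maps, so its vector fields are
quadratic in ζ. The quadratic terms combine with the logarithmic derivative of psi(w) into E - α and
Ē - β, and the constant terms give the bare derivatives in `boostZ` and `boostB`. The relations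
defining 𝔲(p,1) turn the conjugated entries of A into entries of A. -/
lemma hasDerivAt_Phi (A : uLie p) (P : Poly p) (x : X0 p) :
    HasDerivAt (fun t : ℝ => Phi p a k P (expU A (-t) • x)) (Phi p a k (lieOp a k A.1 P) x) 0 := by
  have hw := (w_ne_zero x)
  have hexp : expU A (-0 : ℝ) • x = x := by
    apply Subtype.ext
    change NormedSpace.exp ((-0 : ℝ) • A.1) *ᵥ x.1 = x.1
    simp
  have d1 := hasDerivAt_psi (a := a) (k := k) (hasDerivAt_expU A x (Sum.inr ()))
    (w_ne_zero _)
  have dz : ∀ i, HasDerivAt (fun t : ℝ => (expU A (-t) • x).1 (Sum.inl i) /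
      (expU A (-t) • x).1 (Sum.inr ())) _ 0 := fun i =>
    (hasDerivAt_expU A x (Sum.inl i)).div (hasDerivAt_expU A x (Sum.inr ())) (w_ne_zero _)
  have dzb := fun i => (dz i).star
  have d2 := hasDerivAt_eval (t := 0) (g := Sum.elim
    (fun i (t : ℝ) => (expU A (-t) • x).1 (Sum.inl i) / (expU A (-t) • x).1 (Sum.inr ()))
    (fun i t => starRingEnd ℂ ((expU A (-t) • x).1 (Sum.inl i) / (expU A (-t) • x).1 (Sum.inr ()))))
    (g' := Sum.elim _ _) (fun s => by
      rcases s with i | i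
      · exact dz i
      · exact dzb i) P
  have hfun : ∀ t : ℝ, (fun s : Fin p ⊕ Fin p => Sum.elim
      (fun i (t : ℝ) => (expU A (-t) • x).1 (Sum.inl i) / (expU A (-t) • x).1 (Sum.inr ()))
      (fun i t => starRingEnd ℂ ((expU A (-t) • x).1 (Sum.inl i) /
        (expU A (-t) • x).1 (Sum.inr ()))) s t) = Sum.elim
      (fun i => (expU A (-t) • x).1 (Sum.inl i) / (expU A (-t) • x).1 (Sum.inr ()))
      (fun i => starRingEnd ℂ ((expU A (-t) • x).1 (Sum.inl i) /
        (expU A (-t) • x).1 (Sum.inr ()))) := by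
    intro t; ext s; rcases s with i | i <;> rfl
  simp only [hfun] at d2
  refine (d1.mul d2).congr_deriv ?_
  obtain ⟨u1, u2, u3, u4⟩ := uLie_entries A
  rw [hexp, Phi_apply, Fintype.sum_sum_type]
  simp only [Sum.elim_inl, Sum.elim_inr]
  set w := x.1 (Sum.inr ()) with hwd
  set ζ : Fin p → ℂ := fun i => x.1 (Sum.inl i) / w with hζ
  have hz : ∀ i, x.1 (Sum.inl i) = ζ i * w := fun i => (div_mul_cancel₀ _ hw).symm
  set e : Poly p →+* ℂ := eval (Sum.elim (fun i => ζ i) fun i => starRingEnd ℂ (ζ i)) with he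
  set S1 := ∑ j, A.1 (Sum.inr ()) (Sum.inl j) * ζ j with hS1
  set S2 := ∑ j, A.1 (Sum.inl j) (Sum.inr ()) * starRingEnd ℂ (ζ j) with hS2
  have hAw : (A.1 *ᵥ x.1) (Sum.inr ()) = (S1 + A.1 (Sum.inr ()) (Sum.inr ())) * w := by
    simp only [mulVec, dotProduct, Fintype.sum_sum_type, Finset.univ_unique, Finset.sum_singleton,
      hz, hS1, add_mul, Finset.sum_mul, mul_assoc]
    rfl
  have hAz : ∀ i, (A.1 *ᵥ x.1) (Sum.inl i) =
      (∑ j, A.1 (Sum.inl i) (Sum.inl j) * ζ j + A.1 (Sum.inl i) (Sum.inr ())) * w := by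
    intro i
    simp only [mulVec, dotProduct, Fintype.sum_sum_type, Finset.univ_unique, Finset.sum_singleton,
      hz, add_mul, Finset.sum_mul, mul_assoc]
    rfl
  have hdz : ∀ i, (-(A.1 *ᵥ x.1) (Sum.inl i) * w - x.1 (Sum.inl i) * -(A.1 *ᵥ x.1) (Sum.inr ())) /
      w ^ 2 = -(∑ j, A.1 (Sum.inl i) (Sum.inl j) * ζ j + A.1 (Sum.inl i) (Sum.inr ())) +
        ζ i * (S1 + A.1 (Sum.inr ()) (Sum.inr ())) := by
    intro i
    rw [hAw, hAz, hz]
    field_simp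
    ring
  have hcS1 : starRingEnd ℂ S1 = S2 := by
    simp only [hS1, hS2, map_sum, map_mul, u3]
  have hdw : -(A.1 *ᵥ x.1) (Sum.inr ()) / w = -(S1 + A.1 (Sum.inr ()) (Sum.inr ())) := by
    rw [hAw, neg_div, mul_div_cancel_right₀ _ hw]
  have hcz : ∀ i, starRingEnd ℂ (-(∑ j, A.1 (Sum.inl i) (Sum.inl j) * ζ j +
      A.1 (Sum.inl i) (Sum.inr ())) + ζ i * (S1 + A.1 (Sum.inr ()) (Sum.inr ()))) =
      ∑ j, A.1 (Sum.inl j) (Sum.inl i) * starRingEnd ℂ (ζ j) - A.1 (Sum.inr ()) (Sum.inl i) +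
      starRingEnd ℂ (ζ i) * (S2 - A.1 (Sum.inr ()) (Sum.inr ())) := by
    intro i
    simp only [map_add, map_neg, map_mul, map_sum, u1, u2, u4, hcS1, neg_mul,
      Finset.sum_neg_distrib]
    ring
  have hEZ : e (eulerZ p P) = ∑ i, ζ i * e (pderiv (Sum.inl i) P) := by
    simp [eulerZ_apply, he, map_sum]
  have hEB : e (eulerB p P) = ∑ i, starRingEnd ℂ (ζ i) * e (pderiv (Sum.inr i) P) := by
    simp [eulerB_apply, he, map_sum]
  have hC : ∀ (c : ℂ) (Q : Poly p), e (c • Q) = c * e Q := fun c Q => by simp [he, smul_eval]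
  have hX : ∀ i, e (X (Sum.inl i)) = ζ i := fun i => by simp [he]
  have hXb : ∀ i, e (X (Sum.inr i)) = starRingEnd ℂ (ζ i) := fun i => by simp [he]
  have s1 : ∑ j, A.1 (Sum.inr ()) (Sum.inl j) * (ζ j * (e (eulerZ p P) - (a + k) / 2 * e P) -
      e (pderiv (Sum.inr j) P)) = S1 * (e (eulerZ p P) - (a + k) / 2 * e P) -
      ∑ j, A.1 (Sum.inr ()) (Sum.inl j) * e (pderiv (Sum.inr j) P) := by
    rw [hS1, Finset.sum_mul, ← Finset.sum_sub_distrib]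
    exact Finset.sum_congr rfl fun j _ => by ring
  have s2 : ∑ j, A.1 (Sum.inl j) (Sum.inr ()) * (starRingEnd ℂ (ζ j) *
      (e (eulerB p P) - (a - k) / 2 * e P) -
      e (pderiv (Sum.inl j) P)) = S2 * (e (eulerB p P) - (a - k) / 2 * e P) -
      ∑ j, A.1 (Sum.inl j) (Sum.inr ()) * e (pderiv (Sum.inl j) P) := by
    rw [hS2, Finset.sum_mul, ← Finset.sum_sub_distrib]
    exact Finset.sum_congr rfl fun j _ => by ring
  have s3 : ∑ i, (-(∑ j, A.1 (Sum.inl i) (Sum.inl j) * ζ j + A.1 (Sum.inl i) (Sum.inr ())) +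
      ζ i * (S1 + A.1 (Sum.inr ()) (Sum.inr ()))) * e (pderiv (Sum.inl i) P) =
      -(∑ i, ∑ j, A.1 (Sum.inl i) (Sum.inl j) * (ζ j * e (pderiv (Sum.inl i) P))) -
      ∑ i, A.1 (Sum.inl i) (Sum.inr ()) * e (pderiv (Sum.inl i) P) +
      (S1 + A.1 (Sum.inr ()) (Sum.inr ())) * e (eulerZ p P) := by
    rw [hEZ, Finset.mul_sum, ← Finset.sum_neg_distrib, ← Finset.sum_sub_distrib,
      ← Finset.sum_add_distrib]
    refine Finset.sum_congr rfl fun i _ => ?_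
    simp only [← mul_assoc, ← Finset.sum_mul]
    ring
  have s4 : ∑ i, (∑ j, A.1 (Sum.inl j) (Sum.inl i) * starRingEnd ℂ (ζ j) -
      A.1 (Sum.inr ()) (Sum.inl i) +
      starRingEnd ℂ (ζ i) * (S2 - A.1 (Sum.inr ()) (Sum.inr ()))) * e (pderiv (Sum.inr i) P) =
      ∑ i, ∑ j, A.1 (Sum.inl i) (Sum.inl j) * (starRingEnd ℂ (ζ i) * e (pderiv (Sum.inr j) P)) -
      ∑ i, A.1 (Sum.inr ()) (Sum.inl i) * e (pderiv (Sum.inr i) P) +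
      (S2 - A.1 (Sum.inr ()) (Sum.inr ())) * e (eulerB p P) := by
    rw [hEB, Finset.mul_sum, Finset.sum_comm, ← Finset.sum_sub_distrib,
      ← Finset.sum_add_distrib]
    refine Finset.sum_congr rfl fun i _ => ?_
    simp only [← mul_assoc, ← Finset.sum_mul]
    ring
  have hlie : e (lieOp a k A.1 P) = ∑ j, A.1 (Sum.inr ()) (Sum.inl j) *
      (ζ j * (e (eulerZ p P) - (a + k) / 2 * e P) - e (pderiv (Sum.inr j) P)) +
      ∑ j, A.1 (Sum.inl j) (Sum.inr ()) * (starRingEnd ℂ (ζ j) *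
      (e (eulerB p P) - (a - k) / 2 * e P) - e (pderiv (Sum.inl j) P)) +
      A.1 (Sum.inr ()) (Sum.inr ()) * (e (eulerZ p P) - e (eulerB p P) - k * e P) -
      (∑ i, ∑ j, A.1 (Sum.inl i) (Sum.inl j) * (ζ j * e (pderiv (Sum.inl i) P)) -
      ∑ i, ∑ j, A.1 (Sum.inl i) (Sum.inl j) *
        (starRingEnd ℂ (ζ i) * e (pderiv (Sum.inr j) P))) := by
    simp only [lieOp_apply, map_add, map_sub, map_sum, hC, boostZ_apply, boostB_apply, rot_apply,
      map_mul, hX, hXb, ← Finset.sum_sub_distrib, mul_sub]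
  simp only [hdz, hdw, hcz, RCLike.star_def]
  rw [s3, s4, hlie, s1, s2, map_neg, map_add, hcS1, u4]
  ring

lemma dRho_Phi (A : uLie p) (P : Poly p) : dRho A (Phi p a k P) = Phi p a k (lieOp a k A.1 P) :=
  funext fun x => (hasDerivAt_Phi A P x).deriv

end Model

/-! ### Complexification of the Lie algebra action -/

section Complexify

variable {p : ℕ} {a : ℂ} {k : ℤ}

lemma lieOp_add (A B : Matrix (Idx p) (Idx p) ℂ) :
    lieOp a k (A + B) = lieOp a k A + lieOp a k B := by
  refine LinearMap.ext fun P => ?_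
  simp only [lieOp_apply, LinearMap.add_apply, Matrix.add_apply, add_smul, Finset.sum_add_distrib]
  abel

lemma lieOp_smul (c : ℂ) (A : Matrix (Idx p) (Idx p) ℂ) :
    lieOp a k (c • A) = c • lieOp a k A := by
  refine LinearMap.ext fun P => ?_
  simp only [lieOp_apply, LinearMap.smul_apply, Matrix.smul_apply, smul_eq_mul, mul_smul,
    ← Finset.smul_sum, smul_add, smul_sub]

lemma lieOp_single_inl_inl (i j : Fin p) (P : Poly p) :
    lieOp a k (Matrix.single (Sum.inl j) (Sum.inl i) 1) P = -rot i j P := by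
  rw [lieOp_apply]
  simp only [Matrix.single_apply, Sum.inl.injEq, reduceCtorEq, false_and, and_false, if_false,
    zero_smul, Finset.sum_const_zero, add_zero, zero_sub, ite_and, ite_smul, one_smul,
    Finset.sum_ite_irrel, Finset.sum_ite_eq, Finset.mem_univ, if_true]

lemma lieOp_single_inr_inl (j : Fin p) (P : Poly p) :
    lieOp a k (Matrix.single (Sum.inr ()) (Sum.inl j) 1) P = boostZ ((a + k) / 2) j P := by
  rw [lieOp_apply]
  simp only [Matrix.single_apply, Sum.inl.injEq, reduceCtorEq, false_and, and_false, if_false,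
    zero_smul, Finset.sum_const_zero, add_zero, sub_zero, ite_smul, one_smul, true_and,
    Finset.sum_ite_eq, Finset.mem_univ, if_true]

lemma lieOp_single_inl_inr (j : Fin p) (P : Poly p) :
    lieOp a k (Matrix.single (Sum.inl j) (Sum.inr ()) 1) P = boostB ((a - k) / 2) j P := by
  rw [lieOp_apply]
  simp only [Matrix.single_apply, Sum.inl.injEq, reduceCtorEq, and_false, if_false,
    zero_smul, Finset.sum_const_zero, add_zero, sub_zero, zero_add, ite_smul, one_smul, and_true,
    Finset.sum_ite_eq, Finset.mem_univ, if_true]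

lemma mem_uLie_iff (A : Matrix (Idx p) (Idx p) ℂ) : A ∈ uLie p ↔
    ∀ i j, star (A j i) * gram p j j + gram p i i * A i j = 0 := by
  rw [uLie, Set.mem_ofPred_eq, ← Matrix.ext_iff]
  simp [gram, Matrix.mul_diagonal, Matrix.diagonal_mul]

lemma single_sub_single_mem_uLie (i j : Fin p) :
    Matrix.single (Sum.inl j) (Sum.inl i) 1 - Matrix.single (Sum.inl i) (Sum.inl j) 1 ∈ uLie p := by
  rw [mem_uLie_iff]
  rintro (r | r) (s | s) <;> simp [gram, Matrix.single_apply]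
  grind

lemma I_smul_single_add_single_mem_uLie (i j : Fin p) :
    Complex.I • (Matrix.single (Sum.inl j) (Sum.inl i) 1 +
      Matrix.single (Sum.inl i) (Sum.inl j) 1) ∈ uLie p := by
  rw [mem_uLie_iff]
  rintro (r | r) (s | s) <;> simp [gram, Matrix.single_apply]
  grind

lemma single_add_single_mem_uLie (j : Fin p) :
    Matrix.single (Sum.inl j) (Sum.inr ()) 1 + Matrix.single (Sum.inr ()) (Sum.inl j) 1 ∈ uLie p := by
  rw [mem_uLie_iff]
  rintro (r | r) (s | s) <;> simp [gram, Matrix.single_apply] 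
  split_ifs <;> simp

lemma I_smul_single_sub_single_mem_uLie (j : Fin p) :
    Complex.I • (Matrix.single (Sum.inl j) (Sum.inr ()) 1 -
      Matrix.single (Sum.inr ()) (Sum.inl j) 1) ∈ uLie p := by
  rw [mem_uLie_iff]
  rintro (r | r) (s | s) <;> simp [gram, Matrix.single_apply] <;> split_ifs <;> simp

/-- `lieOp` is complex linear in the matrix, while only elements of the real form act on functions.
An elementary matrix is a complex combination of a skew-Hermitian difference and i times a symmetric
sum. -/
lemma rot_eq_lieOp (a : ℂ) (k : ℤ) (i j : Fin p) (P : Poly p) : rot i j P =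
    (-(1 / 2 : ℂ)) • lieOp a k (Matrix.single (Sum.inl j) (Sum.inl i) 1 -
      Matrix.single (Sum.inl i) (Sum.inl j) 1) P +
    (Complex.I / 2) • lieOp a k (Complex.I • (Matrix.single (Sum.inl j) (Sum.inl i) 1 +
      Matrix.single (Sum.inl i) (Sum.inl j) 1)) P := by
  rw [sub_eq_add_neg, ← neg_one_smul ℂ (Matrix.single (Sum.inl i) (Sum.inl j) (1 : ℂ)), lieOp_smul,
    lieOp_add, lieOp_add, lieOp_smul]
  simp only [LinearMap.add_apply, LinearMap.smul_apply, lieOp_single_inl_inl]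
  match_scalars
  · linear_combination (1 / 2 : ℂ) * Complex.I_mul_I
  · linear_combination (1 / 2 : ℂ) * Complex.I_mul_I

lemma boostB_eq_lieOp (j : Fin p) (P : Poly p) : boostB ((a - k) / 2) j P =
    (1 / 2 : ℂ) • lieOp a k (Matrix.single (Sum.inl j) (Sum.inr ()) 1 +
      Matrix.single (Sum.inr ()) (Sum.inl j) 1) P -
    (Complex.I / 2) • lieOp a k (Complex.I • (Matrix.single (Sum.inl j) (Sum.inr ()) 1 -
      Matrix.single (Sum.inr ()) (Sum.inl j) 1)) P := by
  rw [sub_eq_add_neg (Matrix.single _ _ _), ← neg_one_smul ℂ (Matrix.single (Sum.inr ()) (Sum.inl j) (1 : ℂ)), lieOp_smul,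
    lieOp_add, lieOp_add, lieOp_smul]
  simp only [LinearMap.add_apply, LinearMap.smul_apply, lieOp_single_inl_inr, lieOp_single_inr_inl]
  match_scalars
  · linear_combination (1 / 2 : ℂ) * Complex.I_mul_I
  · linear_combination -(1 / 2 : ℂ) * Complex.I_mul_I

lemma boostZ_eq_lieOp (j : Fin p) (P : Poly p) : boostZ ((a + k) / 2) j P =
    (1 / 2 : ℂ) • lieOp a k (Matrix.single (Sum.inl j) (Sum.inr ()) 1 +
      Matrix.single (Sum.inr ()) (Sum.inl j) 1) P +
    (Complex.I / 2) • lieOp a k (Complex.I • (Matrix.single (Sum.inl j) (Sum.inr ()) 1 -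
      Matrix.single (Sum.inr ()) (Sum.inl j) 1)) P := by
  rw [sub_eq_add_neg (Matrix.single _ _ _), ← neg_one_smul ℂ (Matrix.single (Sum.inr ()) (Sum.inl j) (1 : ℂ)), lieOp_smul,
    lieOp_add, lieOp_add, lieOp_smul]
  simp only [LinearMap.add_apply, LinearMap.smul_apply, lieOp_single_inl_inr, lieOp_single_inr_inl]
  match_scalars
  · linear_combination (1 / 2 : ℂ) * Complex.I_mul_I
  · linear_combination -(1 / 2 : ℂ) * Complex.I_mul_I

/-- The block diagonal elements of `𝔲(p,1)`. -/
def IsBlockDiag (A : Matrix (Idx p) (Idx p) ℂ) : Prop :=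
  ∀ i : Fin p, A (Sum.inl i) (Sum.inr ()) = 0 ∧ A (Sum.inr ()) (Sum.inl i) = 0

/-- Only the block diagonal elements are needed, so this applies to spaces that are merely K-stable
as well as to submodules. -/
lemma rotStable_comap {W : Submodule ℂ (X0 p → ℂ)}
    (hW : ∀ A : uLie p, IsBlockDiag A.1 → ∀ P : Poly p, Phi p a k P ∈ W →
      dRho A (Phi p a k P) ∈ W) : RotStable (W.comap (Phi p a k)) := by
  intro i j P hP
  rw [rot_eq_lieOp a k]
  refine add_mem (Submodule.smul_mem _ _ ?_) (Submodule.smul_mem _ _ ?_)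
  · rw [Submodule.mem_comap, ← dRho_Phi ⟨_, single_sub_single_mem_uLie i j⟩]
    exact hW _ (fun l => by simp) P hP
  · rw [Submodule.mem_comap, ← dRho_Phi ⟨_, I_smul_single_add_single_mem_uLie i j⟩]
    exact hW _ (fun l => by simp) P hP

lemma Phi_boostZ_mem {W : Submodule ℂ (X0 p → ℂ)} (hW : ∀ A : uLie p, ∀ f ∈ W, dRho A f ∈ W)
    {P : Poly p} (hP : Phi p a k P ∈ W) (j : Fin p) :
    Phi p a k (boostZ ((a + k) / 2) j P) ∈ W := by
  rw [boostZ_eq_lieOp, map_add, map_smul, map_smul,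
    ← dRho_Phi ⟨_, single_add_single_mem_uLie j⟩, ← dRho_Phi ⟨_, I_smul_single_sub_single_mem_uLie j⟩]
  exact add_mem (Submodule.smul_mem _ _ (hW _ _ hP)) (Submodule.smul_mem _ _ (hW _ _ hP))

lemma Phi_boostB_mem {W : Submodule ℂ (X0 p → ℂ)} (hW : ∀ A : uLie p, ∀ f ∈ W, dRho A f ∈ W)
    {P : Poly p} (hP : Phi p a k P ∈ W) (j : Fin p) :
    Phi p a k (boostB ((a - k) / 2) j P) ∈ W := by
  rw [boostB_eq_lieOp, map_sub, map_smul, map_smul,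
    ← dRho_Phi ⟨_, single_add_single_mem_uLie j⟩, ← dRho_Phi ⟨_, I_smul_single_sub_single_mem_uLie j⟩]
  exact sub_mem (Submodule.smul_mem _ _ (hW _ _ hP)) (Submodule.smul_mem _ _ (hW _ _ hP))

lemma rotStable_ker : RotStable (LinearMap.ker (Phi p a k)) := by
  refine rotStable_comap (W := ⊥) fun A _ P hP => ?_
  rw [Submodule.mem_bot] at hP ⊢
  rw [hP]
  ext x
  simp [dRho]

end Complexify

/-! ### The action of `K` -/

section CompactGroup

variable {p : ℕ} {a : ℂ} {k : ℤ}

lemma gram_mul_gram : gram p * gram p = 1 := by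
  rw [gram, diagonal_mul_diagonal, ← diagonal_one]
  congr 1
  ext i
  rcases i with i | i <;> simp

lemma val_inv_eq (g : U p) : ((g⁻¹ : U p) : GL (Idx p) ℂ).1 =
    gram p * ((g : GL (Idx p) ℂ).1)ᴴ * gram p := by
  set G : Matrix (Idx p) (Idx p) ℂ := (g : GL (Idx p) ℂ).1
  set B : Matrix (Idx p) (Idx p) ℂ := ((g⁻¹ : U p) : GL (Idx p) ℂ).1
  have hGB : G * B = 1 := Units.mul_inv (g : GL (Idx p) ℂ)
  have hgG : Gᴴ * gram p * G = gram p := g.2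
  calc B = gram p * gram p * B := by rw [gram_mul_gram, Matrix.one_mul]
    _ = gram p * (Gᴴ * gram p * G) * B := by rw [hgG]
    _ = gram p * Gᴴ * gram p * (G * B) := by simp only [Matrix.mul_assoc]
    _ = _ := by rw [hGB, Matrix.mul_one]

lemma IsInK.inv {g : U p} (hg : IsInK g) : IsInK g⁻¹ := by
  intro i
  rw [val_inv_eq, gram, Matrix.mul_diagonal, Matrix.mul_diagonal, Matrix.diagonal_mul,
    Matrix.diagonal_mul, conjTranspose_apply, conjTranspose_apply, (hg i).1, (hg i).2]
  simp

/-- The phase c of the U(1)-factor is divided out of the unitary block. Then c cancels in z/w and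
enters only through `psi`. -/
lemma IsInK.entries {g : U p} (hg : IsInK g) : ∃ (c : ℂ) (v : Matrix (Fin p) (Fin p) ℂ), ‖c‖ = 1 ∧
    v ∈ Matrix.unitaryGroup (Fin p) ℂ ∧ ∀ x : X0 p, (g⁻¹ • x).1 (Sum.inr ()) = c * x.1 (Sum.inr ()) ∧
      ∀ i, (g⁻¹ • x).1 (Sum.inl i) = c * ∑ j, v i j * x.1 (Sum.inl j) := by
  set B : Matrix (Idx p) (Idx p) ℂ := ((g⁻¹ : U p) : GL (Idx p) ℂ).1 with hB
  have hBB : Bᴴ * gram p * B = gram p := (g⁻¹).2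
  have hB1 : ∀ i, B (Sum.inl i) (Sum.inr ()) = 0 := fun i => (hg.inv i).1
  have hB2 : ∀ i, B (Sum.inr ()) (Sum.inl i) = 0 := fun i => (hg.inv i).2
  have hent : ∀ r s, ∑ t, star (B t r) * gram p t t * B t s = gram p r s := by
    intro r s
    rw [← congrFun (congrFun hBB r) s, Matrix.mul_apply]
    refine Finset.sum_congr rfl fun t _ => ?_
    rw [gram, Matrix.mul_diagonal, conjTranspose_apply, Matrix.diagonal_apply_eq]
  set c := B (Sum.inr ()) (Sum.inr ()) with hc
  have hcn : ‖c‖ = 1 := by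
    have := hent (Sum.inr ()) (Sum.inr ())
    rw [Fintype.sum_sum_type] at this
    simp only [hB1, gram, diagonal_apply_eq, Sum.elim_inr, Sum.elim_inl, mul_zero,
      Finset.sum_const_zero, zero_add, Finset.univ_unique, Finset.sum_singleton] at this
    have h2 : star c * c = 1 := by
      have h3 : star c * -1 * c = -1 := this
      linear_combination -h3
    rw [RCLike.star_def, Complex.conj_mul'] at h2
    have h3 : ‖c‖ ^ 2 = 1 := by exact_mod_cast h2
    exact (pow_eq_one_iff_of_nonneg (norm_nonneg c) two_ne_zero).1 h3
  have hc0 : c ≠ 0 := fun h => by rw [h, norm_zero] at hcn; exact zero_ne_one hcn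
  have hcc : star c * c = 1 := by
    rw [RCLike.star_def, Complex.conj_mul', hcn]; simp
  refine ⟨c, Matrix.of fun i j => c⁻¹ * B (Sum.inl i) (Sum.inl j), hcn, ?_, fun x => ⟨?_, fun i => ?_⟩⟩
  · rw [Matrix.mem_unitaryGroup_iff']
    ext i j
    have := hent (Sum.inl i) (Sum.inl j)
    rw [Fintype.sum_sum_type] at this
    simp only [hB2, gram, diagonal_apply, Sum.elim_inr, Sum.elim_inl, mul_zero,
      Finset.sum_const_zero, add_zero, mul_one, if_true, Sum.inl.injEq] at this
    rw [Matrix.mul_apply, Matrix.one_apply, ← this]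
    refine Finset.sum_congr rfl fun t _ => ?_
    rw [star_apply, of_apply, of_apply, star_mul', star_inv₀]
    have h1 : star c ≠ 0 := star_ne_zero.2 hc0
    field_simp
    linear_combination (-(star (B (Sum.inl t) (Sum.inl i)) * B (Sum.inl t) (Sum.inl j))) * hcc
  · change (B *ᵥ x.1) (Sum.inr ()) = _
    simp [mulVec, dotProduct, hB2, hc]
  · change (B *ᵥ x.1) (Sum.inl i) = _
    simp only [mulVec, dotProduct, Fintype.sum_sum_type, hB1, zero_mul, Finset.sum_const_zero,
      add_zero, Matrix.of_apply, Finset.mul_sum]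
    refine Finset.sum_congr rfl fun t _ => ?_
    field_simp

/-- The substitution of variables given by a matrix. -/
def subst (v : Matrix (Fin p) (Fin p) ℂ) : Poly p →ₐ[ℂ] Poly p :=
  aeval (Sum.elim (fun i => ∑ j, v i j • X (Sum.inl j))
    (fun i => ∑ j, starRingEnd ℂ (v i j) • X (Sum.inr j)))

lemma subst_X_inl (v : Matrix (Fin p) (Fin p) ℂ) (i : Fin p) :
    subst v (X (Sum.inl i)) = ∑ j, v i j • X (Sum.inl j) := by simp [subst]

lemma subst_X_inr (v : Matrix (Fin p) (Fin p) ℂ) (i : Fin p) :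
    subst v (X (Sum.inr i)) = ∑ j, starRingEnd ℂ (v i j) • X (Sum.inr j) := by simp [subst]

lemma eval_subst (v : Matrix (Fin p) (Fin p) ℂ) (z : Fin p → ℂ) (P : Poly p) :
    eval (Sum.elim z fun i => starRingEnd ℂ (z i)) (subst v P) =
      eval (Sum.elim (v *ᵥ z) fun i => starRingEnd ℂ ((v *ᵥ z) i)) P := by
  induction P using MvPolynomial.induction_on with
  | C c => simp [subst]
  | add P Q hP hQ => simp [hP, hQ]
  | mul_X P i hP =>
    rw [map_mul, map_mul, map_mul, hP]
    congr 1
    rcases i with i | i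
    · simp [subst_X_inl, mulVec, dotProduct, smul_eval]
    · simp [subst_X_inr, mulVec, dotProduct, smul_eval]

lemma rho_Phi {g : U p} {c : ℂ} (hc : ‖c‖ = 1) {v : Matrix (Fin p) (Fin p) ℂ}
    (h : ∀ x : X0 p, (g⁻¹ • x).1 (Sum.inr ()) = c * x.1 (Sum.inr ()) ∧
      ∀ i, (g⁻¹ • x).1 (Sum.inl i) = c * ∑ j, v i j * x.1 (Sum.inl j)) (P : Poly p) :
    rho g (Phi p a k P) = psi a k c • Phi p a k (subst v P) := by
  ext x
  have hw := w_ne_zero x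
  have hc0 : c ≠ 0 := fun h => by rw [h, norm_zero] at hc; exact zero_ne_one hc
  change Phi p a k P (g⁻¹ • x) = psi a k c * Phi p a k (subst v P) x
  rw [Phi_apply, Phi_apply, eval_subst, (h x).1, psi_mul, mul_assoc]
  have hz : (fun i => (g⁻¹ • x).1 (Sum.inl i) / (c * x.1 (Sum.inr ()))) =
      v *ᵥ fun i => x.1 (Sum.inl i) / x.1 (Sum.inr ()) := by
    ext i
    rw [(h x).2, mul_div_mul_left _ _ hc0]
    simp [mulVec, dotProduct, Finset.sum_div, mul_div_assoc]
  rw [← hz]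

lemma pderiv_inl_subst (v : Matrix (Fin p) (Fin p) ℂ) (j : Fin p) (P : Poly p) :
    pderiv (Sum.inl j) (subst v P) = ∑ l, v l j • subst v (pderiv (Sum.inl l) P) := by
  induction P using MvPolynomial.induction_on with
  | C c => simp [subst]
  | add P Q hP hQ => simp [hP, hQ, Finset.sum_add_distrib]
  | mul_X P i hP =>
    simp only [map_mul, pderiv_mul, hP, map_add, smul_add, Finset.sum_add_distrib, Finset.sum_mul,
      smul_mul_assoc]
    congr 1
    rcases i with i | i
    · rw [subst_X_inl, map_sum, Finset.sum_eq_single j, Finset.sum_eq_single i]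
      · simp
      · intro l _ hl; rw [pderiv_X_of_ne (by simpa using hl.symm)]; simp
      · simp
      · intro l _ hl; rw [Derivation.map_smul, pderiv_X_of_ne (by simpa using hl)]; simp
      · simp
    · rw [subst_X_inr, map_sum, Finset.sum_eq_zero, Finset.sum_eq_zero]
      · simp
      · intro l _; rw [pderiv_X_of_ne (by simp)]; simp
      · intro l _; rw [Derivation.map_smul, pderiv_X_of_ne (by simp)]; simp

lemma pderiv_inr_subst (v : Matrix (Fin p) (Fin p) ℂ) (j : Fin p) (P : Poly p) :
    pderiv (Sum.inr j) (subst v P) =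
      ∑ l, starRingEnd ℂ (v l j) • subst v (pderiv (Sum.inr l) P) := by
  induction P using MvPolynomial.induction_on with
  | C c => simp [subst]
  | add P Q hP hQ => simp [hP, hQ, Finset.sum_add_distrib]
  | mul_X P i hP =>
    simp only [map_mul, pderiv_mul, hP, map_add, smul_add, Finset.sum_add_distrib, Finset.sum_mul,
      smul_mul_assoc]
    congr 1
    rcases i with i | i
    · rw [subst_X_inl, map_sum, Finset.sum_eq_zero, Finset.sum_eq_zero]
      · simp
      · intro l _; rw [pderiv_X_of_ne (by simp)]; simp
      · intro l _; rw [Derivation.map_smul, pderiv_X_of_ne (by simp)]; simp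
    · rw [subst_X_inr, map_sum, Finset.sum_eq_single j, Finset.sum_eq_single i]
      · simp
      · intro l _ hl; rw [pderiv_X_of_ne (by simpa using hl.symm)]; simp
      · simp
      · intro l _ hl; rw [Derivation.map_smul, pderiv_X_of_ne (by simpa using hl)]; simp
      · simp

lemma unitary_rows {v : Matrix (Fin p) (Fin p) ℂ} (hv : v ∈ Matrix.unitaryGroup (Fin p) ℂ)
    (i l : Fin p) : ∑ j, v i j * starRingEnd ℂ (v l j) = if i = l then 1 else 0 := by
  have := congrFun (congrFun (Matrix.mem_unitaryGroup_iff.1 hv) i) l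
  simpa [Matrix.mul_apply, Matrix.one_apply] using this

lemma lap_subst {v : Matrix (Fin p) (Fin p) ℂ} (hv : v ∈ Matrix.unitaryGroup (Fin p) ℂ)
    (P : Poly p) : lap p (subst v P) = subst v (lap p P) := by
  simp only [lap_apply, pderiv_inr_subst, map_sum, Derivation.map_smul, pderiv_inl_subst,
    Finset.smul_sum, smul_smul]
  rw [Finset.sum_comm]
  refine Finset.sum_congr rfl fun l _ => ?_
  rw [Finset.sum_comm, Finset.sum_eq_single l]
  · rw [← Finset.sum_smul]
    have := unitary_rows hv l l
    rw [if_pos rfl] at this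
    simp only [mul_comm (starRingEnd ℂ _)]
    rw [this, one_smul]
  · intro i _ hi
    rw [← Finset.sum_smul]
    have := unitary_rows hv i l
    rw [if_neg hi] at this
    simp only [mul_comm (starRingEnd ℂ _)]
    rw [this, zero_smul]
  · simp

lemma isWeightedHomogeneous_subst (v : Matrix (Fin p) (Fin p) ℂ) {w : Fin p ⊕ Fin p → ℕ}
    (hw : ∀ i j, w (Sum.inl i) = w (Sum.inl j)) (hw' : ∀ i j, w (Sum.inr i) = w (Sum.inr j))
    {n : ℕ} {P : Poly p} (hP : P.IsWeightedHomogeneous w n) :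
    (subst v P).IsWeightedHomogeneous w n := by
  have h : ∀ i, (subst v (X i)).IsWeightedHomogeneous w (w i) := by
    rintro (i | i)
    · rw [subst_X_inl]
      refine IsWeightedHomogeneous.sum _ _ _ fun j _ => ?_
      refine (weightedHomogeneousSubmodule ℂ _ _).smul_mem _ ?_
      rw [hw i j]
      exact isWeightedHomogeneous_X ℂ w _
    · rw [subst_X_inr]
      refine IsWeightedHomogeneous.sum _ _ _ fun j _ => ?_
      refine (weightedHomogeneousSubmodule ℂ _ _).smul_mem _ ?_
      rw [hw' i j]
      exact isWeightedHomogeneous_X ℂ w _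
  rw [P.as_sum, map_sum]
  refine IsWeightedHomogeneous.sum _ _ _ fun s hs => ?_
  rw [monomial_eq, map_mul, Finsupp.prod, map_prod]
  have e : Finsupp.weight w s = n := hP (mem_support_iff.1 hs)
  have h1 := IsWeightedHomogeneous.prod (w := w) s.support (fun i => subst v (X i) ^ s i)
    (fun i => s i • w i) fun i _ => (h i).pow _
  rw [show ∑ i ∈ s.support, s i • w i = n by rw [← e, Finsupp.weight_apply]; rfl] at h1
  have h2 := (isWeightedHomogeneous_C w (coeff s P)).mul h1
  simpa [subst] using h2

lemma subst_mem {v : Matrix (Fin p) (Fin p) ℂ} (hv : v ∈ Matrix.unitaryGroup (Fin p) ℂ)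
    {m : ℕ × ℕ} {P : Poly p} (hP : P ∈ H p m) : subst v P ∈ H p m := by
  obtain ⟨h1, h2, h3⟩ := mem_H.1 hP
  exact mem_H.2 ⟨isWeightedHomogeneous_subst v (fun _ _ => rfl) (fun _ _ => rfl) h1,
    isWeightedHomogeneous_subst v (fun _ _ => rfl) (fun _ _ => rfl) h2,
    by rw [lap_subst hv, h3, map_zero]⟩

/-- A variable moved across the form becomes a derivative, and the chain rule together with the
orthonormality of the rows of v restores it. The move shifts the weight, so the induction on P must
hold for all c. -/
lemma fischer_subst {v : Matrix (Fin p) (Fin p) ℂ} (hv : v ∈ Matrix.unitaryGroup (Fin p) ℂ)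
    (P : Poly p) : ∀ (c : ℕ × ℕ → ℝ) (Q : Poly p),
    fischer p c (subst v P) (subst v Q) = fischer p c P Q := by
  induction P using MvPolynomial.induction_on with
  | C x =>
    intro c Q
    have h0 : coeff 0 (subst v Q) = coeff 0 Q := by
      have h1 := eval_subst v 0 Q
      simp only [mulVec_zero] at h1
      have h2 : (Sum.elim (0 : Fin p → ℂ) fun i => starRingEnd ℂ ((0 : Fin p → ℂ) i)) = 0 := by
        ext i; rcases i with i | i <;> simp
      rw [h2] at h1
      rwa [eval_zero] at h1
    rw [show subst v (C x) = C x by simp [subst], fischer, C_apply, diagForm_monomial,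
      diagForm_monomial, h0]
  | add P P' h1 h2 =>
    intro c Q
    simp only [map_add, LinearMap.add_apply, h1, h2]
  | mul_X P i hP =>
    intro c Q
    rw [map_mul, mul_comm, mul_comm P]
    rcases i with i | i
    · rw [subst_X_inl, Finset.sum_mul, map_sum, LinearMap.sum_apply, fischer_X_mul, ← hP]
      simp only [smul_mul_assoc, LinearMap.map_smulₛₗ, LinearMap.smul_apply, fischer_X_mul,
        pderiv_inl_subst]
      have e : subst v (pderiv (Sum.inl i) Q) = ∑ j, starRingEnd ℂ (v i j) •
          ∑ l, v l j • subst v (pderiv (Sum.inl l) Q) := by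
        simp only [Finset.smul_sum, smul_smul]
        rw [Finset.sum_comm, Finset.sum_eq_single i]
        · rw [← Finset.sum_smul]
          simp only [mul_comm (starRingEnd ℂ _)]
          rw [unitary_rows hv, if_pos rfl, one_smul]
        · intro l _ hl
          rw [← Finset.sum_smul]
          simp only [mul_comm (starRingEnd ℂ _)]
          rw [unitary_rows hv, if_neg hl, zero_smul]
        · simp
      rw [e, map_sum]
      refine Finset.sum_congr rfl fun j _ => ?_
      rw [map_smul]
      rfl
    · rw [subst_X_inr, Finset.sum_mul, map_sum, LinearMap.sum_apply, fischer_X_mul, ← hP]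
      simp only [smul_mul_assoc, LinearMap.map_smulₛₗ, LinearMap.smul_apply, fischer_X_mul,
        pderiv_inr_subst, Complex.conj_conj]
      have e : subst v (pderiv (Sum.inr i) Q) = ∑ j, v i j •
          ∑ l, starRingEnd ℂ (v l j) • subst v (pderiv (Sum.inr l) Q) := by
        simp only [Finset.smul_sum, smul_smul]
        rw [Finset.sum_comm, Finset.sum_eq_single i]
        · rw [← Finset.sum_smul, unitary_rows hv, if_pos rfl, one_smul]
        · intro l _ hl
          rw [← Finset.sum_smul, unitary_rows hv, if_neg hl.symm, zero_smul]
        · simp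
      rw [e, map_sum]
      refine Finset.sum_congr rfl fun j _ => ?_
      rw [map_smul]
      rfl

end CompactGroup

/-! ### The polynomial functions are `K`-finite -/

section KFinite

variable {p : ℕ} {a : ℂ} {k : ℤ}

lemma contDiffAt_psi {z : ℂ} (hz : z ≠ 0) : ContDiffAt ℝ ∞ (psi a k) z := by
  have hev : psi a k =ᶠ[nhds z] fun z =>
      Complex.exp ((a - k) / 2 * (Real.log (z.re * z.re + z.im * z.im) : ℝ)) * z ^ k := by
    filter_upwards [isOpen_ne.mem_nhds hz] with s hs
    rw [psi_eq hs, Complex.normSq_apply]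
  refine ContDiffAt.congr_of_eventuallyEq ?_ hev
  have hre : ContDiffAt ℝ ∞ (fun z : ℂ => z.re) z := Complex.reCLM.contDiff.contDiffAt
  have him : ContDiffAt ℝ ∞ (fun z : ℂ => z.im) z := Complex.imCLM.contDiff.contDiffAt
  have hn : z.re * z.re + z.im * z.im ≠ 0 := by
    rw [← Complex.normSq_apply]; simpa using hz
  have hlog := ((hre.mul hre).add (him.mul him)).log hn
  have hlog' : ContDiffAt ℝ ∞
      (fun z : ℂ => ((Real.log (z.re * z.re + z.im * z.im) : ℝ) : ℂ)) z :=
    Complex.ofRealCLM.contDiff.contDiffAt.comp z hlog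
  refine (contDiffAt_const.mul hlog').cexp.mul ?_
  obtain ⟨n, rfl | rfl⟩ := k.eq_nat_or_neg
  · simp only [zpow_natCast]
    exact contDiffAt_id.pow n
  · simp only [_root_.zpow_neg, zpow_natCast]
    exact (contDiffAt_id.pow n).inv (pow_ne_zero _ hz)

lemma contDiffAt_eval {E σ : Type*} [NormedAddCommGroup E] [NormedSpace ℝ E] {g : E → σ → ℂ} {x : E}
    (hg : ∀ s, ContDiffAt ℝ ∞ (fun y => g y s) x) (P : MvPolynomial σ ℂ) :
    ContDiffAt ℝ ∞ (fun y => eval (g y) P) x := by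
  induction P using MvPolynomial.induction_on with
  | C c => simpa using contDiffAt_const
  | add P Q hP hQ => simpa using hP.add hQ
  | mul_X P i hP => simpa using hP.mul (hg i)

lemma Phi_mem_S (P : Poly p) : Phi p a k P ∈ S p a k := by
  refine ⟨⟨fun y => psi a k (y (Sum.inr ())) *
    eval (Sum.elim (fun i => y (Sum.inl i) / y (Sum.inr ()))
      (fun i => starRingEnd ℂ (y (Sum.inl i) / y (Sum.inr ())))) P, fun x => ⟨?_, rfl⟩⟩, ?_⟩
  · have hc : ∀ i, ContDiffAt ℝ ∞ (fun y : Idx p → ℂ => y i) x.1 := fun i => contDiffAt_apply ℝ ℂ i _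
    refine ((contDiffAt_psi (w_ne_zero x)).comp x.1 (hc _)).mul (contDiffAt_eval ?_ P)
    have hq : ∀ i : Fin p, ContDiffAt ℝ ∞ (fun y : Idx p → ℂ => y (Sum.inl i) / y (Sum.inr ())) x.1 := by
      intro i
      simp only [div_eq_mul_inv]
      exact (hc _).mul ((hc _).inv (w_ne_zero x))
    rintro (i | i)
    · exact hq i
    · exact Complex.conjCLE.contDiff.contDiffAt.comp x.1 (hq i)
  · intro t x
    change _ = psi a k t * _
    have h : ∀ i, (t • x).1 i = t * x.1 i := fun _ => rfl
    rw [Phi_apply, Phi_apply, h, psi_mul, mul_assoc]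
    simp only [h, mul_div_mul_left _ _ t.ne_zero]

lemma kSpan_Phi_le {m : ℕ × ℕ} {P : Poly p} (hP : P ∈ H p m) :
    kSpan (Phi p a k P) ≤ (H p m).map (Phi p a k) := by
  refine Submodule.span_le.2 ?_
  rintro _ ⟨g, hg, rfl⟩
  obtain ⟨c, v, hc, hv, h⟩ := hg.entries
  rw [rho_Phi hc h]
  exact Submodule.smul_mem _ _ ⟨_, subst_mem hv hP, rfl⟩

lemma map_H_le_HC (m : ℕ × ℕ) : (H p m).map (Phi p a k) ≤ HC p a k := by
  rintro _ ⟨P, hP, rfl⟩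
  exact ⟨Phi_mem_S P, Submodule.finiteDimensional_of_le (kSpan_Phi_le hP)⟩

lemma rho_mem_map_H {g : U p} (hg : IsInK g) {m : ℕ × ℕ} {f : X0 p → ℂ}
    (hf : f ∈ (H p m).map (Phi p a k)) : rho g f ∈ (H p m).map (Phi p a k) := by
  obtain ⟨P, hP, rfl⟩ := hf
  exact kSpan_Phi_le hP (Submodule.subset_span ⟨g, hg, rfl⟩)

/-- The sum of the spaces of bihomogeneous harmonic polynomials. -/
def Harmonic (p : ℕ) : Submodule ℂ (Poly p) := ⨆ m, H p m

lemma H_le_harmonic (m : ℕ × ℕ) : H p m ≤ Harmonic p := le_iSup _ m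

lemma exists_components {M : Set (ℕ × ℕ)} {P : Poly p} (hP : P ∈ ⨆ m ∈ M, H p m) :
    ∃ (s : Finset (ℕ × ℕ)) (f : ℕ × ℕ → Poly p), (∀ m ∈ s, m ∈ M ∧ f m ∈ H p m) ∧
      P = ∑ m ∈ s, f m := by
  classical
  rw [iSup_subtype'] at hP
  obtain ⟨f, hf, hs⟩ := (Submodule.mem_iSup_iff_exists_finsupp _ _).1 hP
  refine ⟨f.support.map (Function.Embedding.subtype _), fun m => if h : m ∈ M then f ⟨m, h⟩ else 0,
    ?_, ?_⟩
  · intro m hm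
    obtain ⟨⟨m', hm'⟩, -, rfl⟩ := Finset.mem_map.1 hm
    refine ⟨hm', ?_⟩
    change (if h : m' ∈ M then f ⟨m', h⟩ else 0) ∈ H p m'
    rw [dif_pos hm']
    exact hf ⟨m', hm'⟩
  · rw [Finset.sum_map, ← hs, Finsupp.sum]
    exact Finset.sum_congr rfl fun m _ =>
      (dif_pos (c := (m : ℕ × ℕ) ∈ M) (t := fun h => f ⟨m, h⟩) m.2).symm

lemma exists_components_harmonic {P : Poly p} (hP : P ∈ Harmonic p) :
    ∃ (s : Finset (ℕ × ℕ)) (f : ℕ × ℕ → Poly p), (∀ m ∈ s, f m ∈ H p m) ∧ P = ∑ m ∈ s, f m := by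
  have : P ∈ ⨆ m ∈ (Set.univ : Set (ℕ × ℕ)), H p m := by simpa [Harmonic] using hP
  obtain ⟨s, f, h1, h2⟩ := exists_components this
  exact ⟨s, f, fun m hm => (h1 m hm).2, h2⟩

lemma Phi_hwv_ne_zero {o₁ o₂ : Fin p} (ho : o₁ ≠ o₂) (m : ℕ × ℕ) :
    Phi p a k (hwv o₁ o₂ m) ≠ 0 := by
  intro h
  have hs : ((Real.sqrt 2 : ℝ) : ℂ) ≠ 0 := by simp
  -- A point of the cone at which neither variable of the highest weight vector vanishes: |1|² +
  -- |1|² = (√2)².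
  let x : X0 p := ⟨Sum.elim (fun i => if i = o₁ ∨ i = o₂ then 1 else 0) (fun _ => (Real.sqrt 2 : ℝ)), by
    refine ⟨fun h0 => hs (congrFun h0 (Sum.inr ())), ?_⟩
    have e : ∀ i : Fin p, ‖(if i = o₁ ∨ i = o₂ then 1 else 0 : ℂ)‖ ^ 2 =
        (if i = o₁ then 1 else 0 : ℝ) + if i = o₂ then 1 else 0 := by
      intro i
      by_cases h1 : i = o₁
      · have : i ≠ o₂ := h1 ▸ ho
        simp [h1, ho]
      · by_cases h2 : i = o₂ <;> simp [h1, h2]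
        exact fun h => absurd h ho.symm
    simp only [Sum.elim_inl, Sum.elim_inr, e, Finset.sum_add_distrib, Finset.sum_ite_eq',
      Finset.mem_univ, if_true, Complex.norm_real, Real.norm_eq_abs, sq_abs]
    rw [Real.sq_sqrt (by norm_num)]; norm_num⟩
  have h1 := congrFun h x
  rw [Phi_apply, hwv_eq, map_mul, map_pow, map_pow, eval_X, eval_X] at h1
  have hpsi : psi a k (x.1 (Sum.inr ())) ≠ 0 := by
    rw [psi_eq (w_ne_zero x)]
    exact mul_ne_zero (Complex.exp_ne_zero _) (zpow_ne_zero _ (w_ne_zero x))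
  refine mul_ne_zero hpsi (mul_ne_zero (pow_ne_zero _ ?_) (pow_ne_zero _ ?_)) h1
  · simp [x]
  · simp [x]

/-- The kernel of `Phi` is 𝔤𝔩(p)-stable. If it met some `H p m` it would contain the highest weight
vector, which does not vanish on the cone. -/
lemma eq_zero_of_Phi_eq_zero (hp : 1 < p) {P : Poly p} (hP : P ∈ Harmonic p)
    (h : Phi p a k P = 0) : P = 0 := by
  obtain ⟨s, f, hf, rfl⟩ := exists_components_harmonic hP
  have ho : (⟨0, by omega⟩ : Fin p) ≠ ⟨1, hp⟩ := by simp
  have h1 := rotStable_ker.component_mem hp s f hf (LinearMap.mem_ker.2 h)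
  refine Finset.sum_eq_zero fun m hm => ?_
  by_contra h0
  exact Phi_hwv_ne_zero ho m
    (LinearMap.mem_ker.1 (rotStable_ker.H_le hp (h1 m hm) (hf m hm) h0 (hwv_mem ho m)))

lemma Phi_pderiv_inl_mem {m : ℕ × ℕ} {P : Poly p} (hP : P ∈ H p m) (i : Fin p) :
    pderiv (Sum.inl i) P ∈ Harmonic p := by
  obtain ⟨_ | m₁, m₂⟩ := m
  · rw [pderiv_inl_of_zero hP]; exact zero_mem _
  · exact H_le_harmonic _ (pderiv_inl_mem hP i)

lemma Phi_pderiv_inr_mem {m : ℕ × ℕ} {P : Poly p} (hP : P ∈ H p m) (i : Fin p) :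
    pderiv (Sum.inr i) P ∈ Harmonic p := by
  obtain ⟨m₁, _ | m₂⟩ := m
  · rw [pderiv_inr_of_zero hP]; exact zero_mem _
  · exact H_le_harmonic _ (pderiv_inr_mem hP i)

/-- Every polynomial function on the cone is a sum of harmonic ones. -/
lemma Phi_mem_map_harmonic (hp : 1 < p) (P : Poly p) :
    Phi p a k P ∈ (Harmonic p).map (Phi p a k) := by
  induction P using MvPolynomial.induction_on with
  | C c =>
    refine ⟨C c, H_le_harmonic (0, 0) (mem_H.2 ⟨isWeightedHomogeneous_C _ _,
      isWeightedHomogeneous_C _ _, by simp [lap_apply]⟩), rfl⟩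
  | add P Q hP hQ => rw [map_add]; exact add_mem hP hQ
  | mul_X P i hP =>
    obtain ⟨Q, hQ, hQP⟩ := hP
    -- Equality of the images of P and Q is equality of their values, so it survives multiplication
    -- by a variable.
    have e : Phi p a k (P * X i) = Phi p a k (X i * Q) := by
      ext x
      have := congrFun hQP x
      rw [Phi_apply, Phi_apply] at this
      rw [Phi_apply, Phi_apply, map_mul, map_mul, mul_comm (eval _ (X i)), ← mul_assoc, ← mul_assoc,
        this]
    rw [e]
    obtain ⟨s, f, hf, rfl⟩ := exists_components_harmonic hQ
    rw [Finset.mul_sum, map_sum]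
    refine sum_mem fun m hm => ?_
    rcases i with i | i
    · rw [Phi_X_inl_mul (m := m)]
      exact add_mem ⟨_, H_le_harmonic _ (upZ_mem hp (hf m hm) i), rfl⟩
        (Submodule.smul_mem _ _ ⟨_, Phi_pderiv_inr_mem (hf m hm) i, rfl⟩)
    · rw [Phi_X_inr_mul (m := m)]
      exact add_mem ⟨_, H_le_harmonic _ (upB_mem hp (hf m hm) i), rfl⟩
        (Submodule.smul_mem _ _ ⟨_, Phi_pderiv_inl_mem (hf m hm) i, rfl⟩)

/-! ### One-parameter subgroups of `K` -/

lemma expU_neg (A : uLie p) (t : ℝ) : (expU A t)⁻¹ = expU A (-t) := by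
  apply Subtype.ext
  apply Units.ext
  change NormedSpace.exp (-(t • A.1)) = NormedSpace.exp ((-t) • A.1)
  rw [neg_smul]

/-- A block diagonal matrix commutes with `gram`, hence so does its exponential; commuting with
diag(1, …, 1, -1) means being block diagonal. -/
lemma isInK_expU {A : uLie p} (hA : IsBlockDiag A.1) (t : ℝ) : IsInK (expU A t) := by
  have hc : Commute (t • A.1) (gram p) := by
    ext r s
    rw [gram, Matrix.mul_diagonal, Matrix.diagonal_mul]
    rcases r with r | r <;> rcases s with s | s <;>
      simp [Matrix.smul_apply, (hA _).1, (hA _).2]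
  have hc' : Commute (NormedSpace.exp (t • A.1)) (gram p) := by
    let : NormedRing (Matrix (Idx p) (Idx p) ℂ) := Matrix.linftyOpNormedRing
    let : NormedAlgebra ℝ (Matrix (Idx p) (Idx p) ℂ) := Matrix.linftyOpNormedAlgebra
    exact hc.exp_left
  have h : ∀ r s, NormedSpace.exp (t • A.1) r s * gram p s s =
      gram p r r * NormedSpace.exp (t • A.1) r s := by
    intro r s
    have := congrFun (congrFun hc'.eq r) s
    rw [gram, Matrix.mul_diagonal, Matrix.diagonal_mul] at this
    simpa [gram] using this
  intro i
  have h1 := h (Sum.inl i) (Sum.inr ())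
  have h2 := h (Sum.inr ()) (Sum.inl i)
  simp only [gram, diagonal_apply_eq, Sum.elim_inl, Sum.elim_inr] at h1 h2
  change NormedSpace.exp (t • A.1) _ _ = 0 ∧ NormedSpace.exp (t • A.1) _ _ = 0
  exact ⟨by linear_combination (-1 / 2 : ℂ) * h1, by linear_combination (1 / 2 : ℂ) * h2⟩

/-- The difference quotients along a one-parameter subgroup of K stay in Y, and a finite-dimensional
space of functions is closed under pointwise limits. -/
lemma dRho_mem_of_finiteDimensional {Y : Submodule ℂ (X0 p → ℂ)} [FiniteDimensional ℂ Y]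
    (hY : ∀ g : U p, IsInK g → ∀ f ∈ Y, rho g f ∈ Y) {A : uLie p} (hA : IsBlockDiag A.1)
    {P : Poly p} (hP : Phi p a k P ∈ Y) : dRho A (Phi p a k P) ∈ Y := by
  have hcl : IsClosed (Y : Set (X0 p → ℂ)) := Y.closed_of_finiteDimensional
  have h : Filter.Tendsto (fun (t : ℝ) (x : X0 p) =>
      (t⁻¹ : ℝ) • (Phi p a k P (expU A (-(0 + t)) • x) - Phi p a k P (expU A (-0) • x)))
      (nhdsWithin 0 {0}ᶜ) (nhds (dRho A (Phi p a k P))) := by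
    rw [dRho_Phi, tendsto_pi_nhds]
    intro x
    exact (hasDerivAt_Phi A P x).tendsto_slope_zero
  refine hcl.mem_of_tendsto h (Filter.Eventually.of_forall fun t => ?_)
  have e : (fun x : X0 p => (t⁻¹ : ℝ) • (Phi p a k P (expU A (-(0 + t)) • x) -
      Phi p a k P (expU A (-0) • x))) = ((t⁻¹ : ℝ) : ℂ) •
      (rho (expU A (0 + t)) (Phi p a k P) - rho (expU A 0) (Phi p a k P)) := by
    ext x
    change _ = ((t⁻¹ : ℝ) : ℂ) * (Phi p a k P ((expU A (0 + t))⁻¹ • x) -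
      Phi p a k P ((expU A 0)⁻¹ • x))
    rw [expU_neg, expU_neg, Complex.real_smul]
  change (fun x : X0 p => _) ∈ Y
  rw [e]
  exact Submodule.smul_mem _ _ (sub_mem (hY _ (isInK_expU hA _) _ hP) (hY _ (isInK_expU hA _) _ hP))

end KFinite

/-! ### The invariant inner product on the sphere -/

section Sphere

open MeasureTheory Metric

/-- A linear map multiplies Haar measure by a constant, which is 1 for an isometry since the unit
ball is mapped to itself. The measure on the sphere is defined through cones over its subsets, and
these are permuted. -/
lemma measurePreserving_toSphere {E : Type*} [NormedAddCommGroup E] [NormedSpace ℝ E]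
    [FiniteDimensional ℝ E] [MeasurableSpace E] [BorelSpace E] (μ : Measure E) [μ.IsAddHaarMeasure]
    (e : E ≃ₗᵢ[ℝ] E) (f : sphere (0 : E) 1 → sphere (0 : E) 1) (hf : ∀ x, (f x : E) = e x) :
    MeasurePreserving f μ.toSphere μ.toSphere := by
  have hfc : Continuous f :=
    continuous_induced_rng.2 ((e.continuous.comp continuous_subtype_val).congr fun x => (hf x).symm)
  have himg : ∀ s : Set E, μ (e.symm '' s) = μ s := by
    have h := μ.addHaar_image_continuousLinearEquiv e.symm.toContinuousLinearEquiv
    have h1 := h (ball 0 1)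
    have hb : (e.symm.toContinuousLinearEquiv : E → E) '' ball 0 1 = ball 0 1 := by
      have := e.symm.image_ball 0 1
      rw [map_zero] at this
      exact this
    rw [hb] at h1
    have h2 : ENNReal.ofReal |LinearMap.det (e.symm.toContinuousLinearEquiv : E →ₗ[ℝ] E)| = 1 := by
      have h3 : (1 : ENNReal) * μ (ball 0 1) =
          ENNReal.ofReal |LinearMap.det (e.symm.toContinuousLinearEquiv : E →ₗ[ℝ] E)| *
            μ (ball 0 1) := by rw [one_mul]; exact h1
      exact ((ENNReal.mul_left_inj (measure_ball_pos μ 0 one_pos).ne' measure_ball_lt_top.ne).1 h3).symm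
    intro s
    have := h s
    rw [h2, one_mul] at this
    exact this
  refine ⟨hfc.measurable, Measure.ext fun s hs => ?_⟩
  rw [Measure.map_apply hfc.measurable hs, Measure.toSphere_apply' _ hs,
    Measure.toSphere_apply' _ (hfc.measurable hs)]
  congr 1
  refine Eq.trans (congrArg μ ?_) (himg _)
  ext x
  constructor
  · rintro ⟨r, hr, _, ⟨y, hy, rfl⟩, rfl⟩
    refine ⟨e (r • (y : E)), ⟨r, hr, f y, ⟨f y, hy, rfl⟩, ?_⟩, e.symm_apply_apply _⟩
    change r • (f y : E) = _
    rw [hf, map_smul]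
  · rintro ⟨_, ⟨r, hr, _, ⟨y, hy, rfl⟩, rfl⟩, rfl⟩
    have hm : e.symm (y : E) ∈ sphere (0 : E) 1 := by simp
    refine ⟨r, hr, e.symm y, ⟨⟨e.symm y, hm⟩, ?_, rfl⟩, ?_⟩
    · have : f ⟨e.symm y, hm⟩ = y := Subtype.ext (by rw [hf]; simp)
      rw [Set.mem_preimage, this]
      exact hy
    · change r • e.symm (y : E) = _
      rw [← map_smul]

variable {p : ℕ} {a : ℂ} {k : ℤ}

/-- The unit sphere of `ℂ^p`. -/
abbrev Sph (p : ℕ) : Type := sphere (0 : EuclideanSpace ℂ (Fin p)) 1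

/-- The rotation invariant measure on the sphere. -/
def sphMeasure (p : ℕ) : Measure (Sph p) :=
  (Measure.addHaar : Measure (EuclideanSpace ℂ (Fin p))).toSphere

instance : IsFiniteMeasure (sphMeasure p) := by unfold sphMeasure; infer_instance

instance : (sphMeasure p).IsOpenPosMeasure := by unfold sphMeasure; infer_instance

/-- The point `(z, 1)` of the light cone. -/
def sphPt (z : Sph p) : X0 p := ⟨Sum.elim (fun i => z.1 i) fun _ => 1, by
  refine ⟨fun h => one_ne_zero (congrFun h (Sum.inr ())), ?_⟩
  have h : ‖z.1‖ ^ 2 = 1 := by rw [norm_eq_of_mem_sphere]; norm_num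
  rw [EuclideanSpace.norm_sq_eq] at h
  simpa using h⟩

lemma continuous_sphPt : Continuous (sphPt (p := p)) := by
  refine continuous_induced_rng.2 (continuous_pi fun i => ?_)
  rcases i with i | i
  · exact (EuclideanSpace.proj i).continuous.comp continuous_subtype_val
  · exact continuous_const

lemma continuous_of_mem_S {f : X0 p → ℂ} (hf : f ∈ S p a k) : Continuous f := by
  obtain ⟨⟨F, hF⟩, -⟩ := hf
  have : f = fun x => F x.1 := funext fun x => ((hF x).2).symm
  rw [this, continuous_iff_continuousAt]
  intro x
  exact (hF x).1.continuousAt.comp continuous_subtype_val.continuousAt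

lemma apply_smul_of_mem_S {f : X0 p → ℂ} (hf : f ∈ S p a k) {x y : X0 p} {c : ℂ} (hc : c ≠ 0)
    (h : y.1 = c • x.1) : f y = psi a k c * f x := by
  have : y = Units.mk0 c hc • x := Subtype.ext h
  rw [this, hf.2]
  rfl

lemma eq_zero_of_sphPt {f : X0 p → ℂ} (hf : f ∈ S p a k) (h : ∀ z, f (sphPt z) = 0) : f = 0 := by
  ext x
  have hw := w_ne_zero x
  let z : Sph p := ⟨WithLp.toLp 2 fun i => x.1 (Sum.inl i) / x.1 (Sum.inr ()), by
    rw [mem_sphere_zero_iff_norm, ← sq_eq_sq₀ (norm_nonneg _) zero_le_one, EuclideanSpace.norm_sq_eq]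
    simp only [norm_div, div_pow, ← Finset.sum_div, x.2.2]
    rw [div_self (by simpa using hw), one_pow]⟩
  rw [apply_smul_of_mem_S hf hw (x := sphPt z), h z, mul_zero]
  · rfl
  · ext i
    rcases i with i | i
    · simp [sphPt, z, mul_div_cancel₀ _ hw]
    · simp [sphPt]

/-- Restriction of homogeneous functions to the sphere. -/
def sphRes (p : ℕ) (a : ℂ) (k : ℤ) : S p a k →ₗ[ℂ] C(Sph p, ℂ) where
  toFun f := ⟨fun z => f.1 (sphPt z), (continuous_of_mem_S f.2).comp continuous_sphPt⟩
  map_add' _ _ := rfl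
  map_smul' _ _ := rfl

/-- Evaluation of polynomials on the sphere. -/
def sphEval (p : ℕ) : Poly p →ₐ[ℂ] C(Sph p, ℂ) :=
  aeval (Sum.elim
    (fun i => ⟨fun z => z.1 i, (EuclideanSpace.proj i).continuous.comp continuous_subtype_val⟩)
    (fun i => ⟨fun z => starRingEnd ℂ (z.1 i), Complex.continuous_conj.comp
      ((EuclideanSpace.proj i).continuous.comp continuous_subtype_val)⟩))

lemma sphEval_X_inl (i : Fin p) (z : Sph p) : sphEval p (X (Sum.inl i)) z = z.1 i := by
  simp only [sphEval, aeval_X, Sum.elim_inl]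
  rfl

lemma sphEval_X_inr (i : Fin p) (z : Sph p) :
    sphEval p (X (Sum.inr i)) z = starRingEnd ℂ (z.1 i) := by
  simp only [sphEval, aeval_X, Sum.elim_inr]
  rfl

lemma sphEval_apply (P : Poly p) (z : Sph p) :
    sphEval p P z = eval (Sum.elim (fun i => z.1 i) fun i => starRingEnd ℂ (z.1 i)) P := by
  induction P using MvPolynomial.induction_on with
  | C c => simp [sphEval]
  | add P Q hP hQ => simp [hP, hQ]
  | mul_X P i hP =>
    rw [map_mul, map_mul, ContinuousMap.mul_apply, hP]
    rcases i with i | i <;> simp [sphEval_X_inl, sphEval_X_inr]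

lemma sphRes_Phi (P : Poly p) : sphRes p a k ⟨Phi p a k P, Phi_mem_S P⟩ = sphEval p P := by
  ext z
  rw [sphEval_apply]
  change Phi p a k P (sphPt z) = _
  rw [Phi_apply]
  simp [sphPt, psi_one]

/-- Stone–Weierstrass: conjugation exchanges the two kinds of variables, and the coordinates
separate points. -/
lemma dense_range_sphEval :
    closure (Set.range (sphEval p)) = Set.univ := by
  let A : StarSubalgebra ℂ C(Sph p, ℂ) :=
    { (sphEval p).range with
      star_mem' := by
        rintro _ ⟨P, rfl⟩
        change star (sphEval p P) ∈ (sphEval p).range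
        induction P using MvPolynomial.induction_on with
        | C c =>
          refine ⟨C (star c), ?_⟩
          ext z; simp [sphEval]
        | add P Q hP hQ => rw [map_add, star_add]; exact add_mem hP hQ
        | mul_X P i hP =>
          rw [map_mul, star_mul']
          refine mul_mem hP ?_
          rcases i with i | i
          · refine ⟨X (Sum.inr i), ?_⟩
            ext z; simp [sphEval_X_inl, sphEval_X_inr]
          · refine ⟨X (Sum.inl i), ?_⟩
            ext z; simp [sphEval_X_inl, sphEval_X_inr] }
  have hA : A.topologicalClosure = ⊤ := by
    refine ContinuousMap.starSubalgebra_topologicalClosure_eq_top_of_separatesPoints A ?_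
    intro x y hxy
    have : ∃ i, x.1 i ≠ y.1 i := by
      by_contra! h
      exact hxy (Subtype.ext (PiLp.ext h))
    obtain ⟨i, hi⟩ := this
    refine ⟨sphEval p (X (Sum.inl i)), ⟨sphEval p (X (Sum.inl i)), ⟨X (Sum.inl i), rfl⟩, rfl⟩, ?_⟩
    simpa [sphEval_X_inl] using hi
  have h2 := congrArg (fun B : StarSubalgebra ℂ C(Sph p, ℂ) => (B : Set C(Sph p, ℂ))) hA
  exact h2

/-- The `L²` inner product of continuous functions on the sphere. -/
def sphForm (p : ℕ) : C(Sph p, ℂ) →ₗ⋆[ℂ] C(Sph p, ℂ) →ₗ[ℂ] ℂ :=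
  LinearMap.mk₂'ₛₗ (starRingEnd ℂ) (RingHom.id ℂ)
    (fun f g => inner ℂ (ContinuousMap.toLp 2 (sphMeasure p) ℂ f)
      (ContinuousMap.toLp (E := ℂ) 2 (sphMeasure p) ℂ g))
    (fun f f' g => by rw [map_add, inner_add_left])
    (fun c f g => by rw [map_smul, inner_smul_left]; rfl)
    (fun f g g' => by rw [map_add, inner_add_right])
    (fun c f g => by rw [map_smul, inner_smul_right]; rfl)

lemma sphForm_apply (f g : C(Sph p, ℂ)) :
    sphForm p f g = inner ℂ (ContinuousMap.toLp 2 (sphMeasure p) ℂ f)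
      (ContinuousMap.toLp (E := ℂ) 2 (sphMeasure p) ℂ g) := rfl

lemma sphForm_eq_integral (f g : C(Sph p, ℂ)) :
    sphForm p f g = ∫ z, g z * starRingEnd ℂ (f z) ∂(sphMeasure p) :=
  ContinuousMap.inner_toLp _ f g

lemma sphForm_symm (f g : C(Sph p, ℂ)) : sphForm p g f = star (sphForm p f g) := by
  rw [sphForm_apply, sphForm_apply]
  exact (inner_conj_symm (𝕜 := ℂ) _ _).symm

lemma sphForm_self_pos {f : C(Sph p, ℂ)} (hf : f ≠ 0) : 0 < (sphForm p f f).re := by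
  rw [sphForm_apply]
  refine (inner_self_nonneg (𝕜 := ℂ)).lt_of_ne fun h => hf ?_
  have h2 := (inner_self_eq_zero (𝕜 := ℂ)).1 (Complex.ext h.symm (inner_self_im (𝕜 := ℂ) _))
  exact ContinuousMap.toLp_injective (𝕜 := ℂ) (p := 2) (sphMeasure p) (by rw [h2, map_zero])

/-- Orthogonality to f is a closed condition, so by density f is orthogonal to itself. -/
lemma eq_zero_of_orthogonal {f : C(Sph p, ℂ)} (hf : ∀ P, sphForm p (sphEval p P) f = 0) : f = 0 := by
  have hcl : IsClosed {g : C(Sph p, ℂ) | sphForm p g f = 0} := by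
    refine isClosed_eq ?_ continuous_const
    simp only [sphForm_apply]
    exact (ContinuousLinearMap.continuous _).inner continuous_const
  have h1 : closure (Set.range (sphEval p)) ⊆ {g : C(Sph p, ℂ) | sphForm p g f = 0} := by
    refine closure_minimal ?_ hcl
    rintro _ ⟨P, rfl⟩
    exact hf P
  rw [dense_range_sphEval] at h1
  by_contra h0
  have h2 := sphForm_self_pos h0
  rw [h1 (Set.mem_univ f)] at h2
  simp at h2

lemma exists_isometry_of_unitary {v : Matrix (Fin p) (Fin p) ℂ}
    (hv : v ∈ Matrix.unitaryGroup (Fin p) ℂ) :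
    ∃ e : EuclideanSpace ℂ (Fin p) ≃ₗᵢ[ℝ] EuclideanSpace ℂ (Fin p),
      ∀ z i, e z i = ∑ j, v i j * z j := by
  let L : EuclideanSpace ℂ (Fin p) →ₗ[ℝ] EuclideanSpace ℂ (Fin p) :=
    (Matrix.toLpLin 2 2 v).restrictScalars ℝ
  have hL : ∀ z i, L z i = ∑ j, v i j * z j := fun z i => by
    simp [L, Matrix.toLpLin_apply, mulVec, dotProduct]
  have hn : ∀ z, ‖L z‖ = ‖z‖ := by
    intro z
    rw [← sq_eq_sq₀ (norm_nonneg _) (norm_nonneg _), EuclideanSpace.norm_sq_eq,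
      EuclideanSpace.norm_sq_eq]
    have h : ∀ u : EuclideanSpace ℂ (Fin p), ((∑ i, ‖u i‖ ^ 2 : ℝ) : ℂ) = star u.ofLp ⬝ᵥ u.ofLp := by
      intro u
      simp [dotProduct, Complex.conj_mul']
    have h2 : (L z).ofLp = v *ᵥ z.ofLp := by
      ext i; rw [hL]; rfl
    have h3 := h (L z)
    rw [h2, star_mulVec, ← dotProduct_mulVec, mulVec_mulVec, ← star_eq_conjTranspose,
      Matrix.mem_unitaryGroup_iff'.1 hv, one_mulVec, ← h z] at h3
    exact Complex.ofReal_injective h3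
  let li : EuclideanSpace ℂ (Fin p) →ₗᵢ[ℝ] EuclideanSpace ℂ (Fin p) := ⟨L, hn⟩
  exact ⟨li.toLinearIsometryEquiv rfl, hL⟩

lemma rho_mem_S (g : U p) {f : X0 p → ℂ} (hf : f ∈ S p a k) : rho g f ∈ S p a k := by
  obtain ⟨⟨F, hF⟩, hf⟩ := hf
  refine ⟨⟨fun y => F (((g⁻¹ : U p) : GL (Idx p) ℂ).1 *ᵥ y), fun x => ⟨?_, (hF (g⁻¹ • x)).2⟩⟩, ?_⟩
  · have hlin : ContDiffAt ℝ ∞ (fun y => ((g⁻¹ : U p) : GL (Idx p) ℂ).1 *ᵥ y) x.1 := by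
      refine contDiffAt_pi.2 fun i => ?_
      simp only [mulVec, dotProduct]
      exact ContDiffAt.sum fun j _ => contDiffAt_const.mul (contDiffAt_apply ℝ ℂ j _)
    exact ContDiffAt.comp x.1 (hF (g⁻¹ • x)).1 hlin
  · intro t x
    change f (g⁻¹ • (t • x)) = _ * f (g⁻¹ • x)
    rw [← hf t]
    congr 1
    exact Subtype.ext (Matrix.mulVec_smul ((g⁻¹ : U p) : GL (Idx p) ℂ).1 (t : ℂ) x.1)

/-- The `L²` inner product on the sphere, as a form on functions on the light cone. -/
theorem exists_invariant_form (p : ℕ) (a : ℂ) (k : ℤ) :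
    ∃ B : (X0 p → ℂ) →ₗ⋆[ℂ] (X0 p → ℂ) →ₗ[ℂ] ℂ,
      (∀ f h, B h f = star (B f h)) ∧
      (∀ f ∈ S p a k, f ≠ 0 → 0 < (B f f).re) ∧
      (∀ g : U p, IsInK g → ∀ f ∈ S p a k, ∀ h ∈ S p a k, B (rho g f) (rho g h) = B f h) ∧
      ∀ f ∈ S p a k, (∀ P, B (Phi p a k P) f = 0) → f = 0 := by
  -- Restriction to the sphere is continuous-valued only on `S p a k`; an arbitrary linear extension
  -- makes the form defined on all functions.
  obtain ⟨R, hR⟩ := LinearMap.exists_extend (sphRes p a k)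
  have hR' : ∀ f (hf : f ∈ S p a k), R f = sphRes p a k ⟨f, hf⟩ := fun f hf =>
    LinearMap.congr_fun hR ⟨f, hf⟩
  have h0 : ∀ f ∈ S p a k, R f = 0 → f = 0 := by
    intro f hf h
    rw [hR' f hf] at h
    exact eq_zero_of_sphPt hf fun z => DFunLike.congr_fun h z
  refine ⟨LinearMap.mk₂'ₛₗ (starRingEnd ℂ) (RingHom.id ℂ) (fun f g => sphForm p (R f) (R g))
    (fun f f' g => by simp) (fun c f g => by simp) (fun f g g' => by simp) (fun c f g => by simp),
    fun f h => sphForm_symm _ _, fun f hf hne => sphForm_self_pos fun h => hne (h0 f hf h), ?_, ?_⟩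
  · intro g hg f hf h hh
    change sphForm p (R (rho g f)) (R (rho g h)) = sphForm p (R f) (R h)
    obtain ⟨c, v, hc, hv, hx⟩ := hg.entries
    obtain ⟨e, he⟩ := exists_isometry_of_unitary hv
    have hc0 : c ≠ 0 := fun h => by rw [h, norm_zero] at hc; exact zero_ne_one hc
    let φ : Sph p → Sph p := fun z => ⟨e z, by simp⟩
    have hφ := measurePreserving_toSphere (Measure.addHaar : Measure (EuclideanSpace ℂ (Fin p))) e φ
      fun _ => rfl
    have hval : ∀ f ∈ S p a k, ∀ z, rho g f (sphPt z) = psi a k c * f (sphPt (φ z)) := by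
      intro f hf z
      refine apply_smul_of_mem_S hf hc0 ?_
      ext i
      rcases i with i | i
      · rw [(hx _).2]
        simp [sphPt, φ, he]
      · rw [show (Sum.inr i : Idx p) = Sum.inr () from rfl, (hx _).1]
        simp [sphPt]
    rw [hR' _ (rho_mem_S g hf), hR' _ (rho_mem_S g hh), hR' f hf, hR' h hh, sphForm_eq_integral,
      sphForm_eq_integral]
    change ∫ z, rho g h (sphPt z) * starRingEnd ℂ (rho g f (sphPt z)) ∂(sphMeasure p) =
      ∫ z, h (sphPt z) * starRingEnd ℂ (f (sphPt z)) ∂(sphMeasure p)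
    have hnorm : psi a k c * starRingEnd ℂ (psi a k c) = 1 := by
      rw [Complex.mul_conj', norm_psi hc]; simp
    have hval2 : ∀ z, rho g h (sphPt z) * starRingEnd ℂ (rho g f (sphPt z)) =
        h (sphPt (φ z)) * starRingEnd ℂ (f (sphPt (φ z))) := by
      intro z
      rw [hval f hf, hval h hh, map_mul]
      linear_combination (h (sphPt (φ z)) * starRingEnd ℂ (f (sphPt (φ z)))) * hnorm
    simp only [hval2]
    let φe : Sph p ≃ₜ Sph p :=
      { toFun := φ
        invFun := fun z => ⟨e.symm z, by simp⟩
        left_inv := fun z => Subtype.ext (e.symm_apply_apply _)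
        right_inv := fun z => Subtype.ext (e.apply_symm_apply _)
        continuous_toFun := continuous_induced_rng.2 (e.continuous.comp continuous_subtype_val)
        continuous_invFun :=
          continuous_induced_rng.2 (e.symm.continuous.comp continuous_subtype_val) }
    exact hφ.integral_comp φe.measurableEmbedding
      (fun z => h (sphPt z) * starRingEnd ℂ (f (sphPt z)))
  · intro f hf hP
    refine h0 f hf (eq_zero_of_orthogonal fun P => ?_)
    have := hP P
    change sphForm p (R (Phi p a k P)) (R f) = 0 at this
    rwa [hR' _ (Phi_mem_S P), sphRes_Phi] at this

end Sphere

/-! ### The `K`-finite vectors -/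

section KFinite

variable {p : ℕ} {a : ℂ} {k : ℤ}

lemma IsInK.mul {g h : U p} (hg : IsInK g) (hh : IsInK h) : IsInK (g * h) := by
  intro i
  change ((g : GL (Idx p) ℂ).1 * (h : GL (Idx p) ℂ).1) _ _ = 0 ∧
    ((g : GL (Idx p) ℂ).1 * (h : GL (Idx p) ℂ).1) _ _ = 0
  simp [Matrix.mul_apply, (hg _).1, (hg _).2, (hh _).1, (hh _).2]

lemma isInK_one : IsInK (1 : U p) := fun i => by
  change (1 : Matrix (Idx p) (Idx p) ℂ) _ _ = 0 ∧ (1 : Matrix (Idx p) (Idx p) ℂ) _ _ = 0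
  simp

lemma rho_one (f : X0 p → ℂ) : rho 1 f = f := by
  ext x
  change f ((1 : U p)⁻¹ • x) = f x
  rw [inv_one, one_smul]

lemma rho_rho (g h : U p) (f : X0 p → ℂ) : rho g (rho h f) = rho (g * h) f := by
  ext x
  change f (h⁻¹ • g⁻¹ • x) = f ((g * h)⁻¹ • x)
  rw [_root_.mul_inv_rev, mul_smul]

lemma mem_kSpan_self (f : X0 p → ℂ) : f ∈ kSpan f :=
  Submodule.subset_span ⟨1, isInK_one, (rho_one f).symm⟩

lemma rho_mem_kSpan {f : X0 p → ℂ} {g : U p} (hg : IsInK g) {h : X0 p → ℂ} (hh : h ∈ kSpan f) :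
    rho g h ∈ kSpan f := by
  have : kSpan f ≤ (kSpan f).comap (rho g) := by
    refine Submodule.span_le.2 ?_
    rintro _ ⟨u, hu, rfl⟩
    exact Submodule.subset_span ⟨g * u, hg.mul hu, rho_rho g u f⟩
  exact this hh

lemma kSpan_le_S {f : X0 p → ℂ} (hf : f ∈ S p a k) : kSpan f ≤ S p a k := by
  refine Submodule.span_le.2 ?_
  rintro _ ⟨u, -, rfl⟩
  exact rho_mem_S u hf

/-- The elements of `Z` orthogonal to `X`. -/
def orth (B : (X0 p → ℂ) →ₗ⋆[ℂ] (X0 p → ℂ) →ₗ[ℂ] ℂ) (X Z : Submodule ℂ (X0 p → ℂ)) :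
    Submodule ℂ (X0 p → ℂ) where
  carrier := {y | y ∈ Z ∧ ∀ x ∈ X, B x y = 0}
  zero_mem' := ⟨zero_mem _, fun _ _ => map_zero _⟩
  add_mem' := fun ha hb => ⟨add_mem ha.1 hb.1, fun x hx => by
    rw [map_add, ha.2 x hx, hb.2 x hx, add_zero]⟩
  smul_mem' := fun c a ha => ⟨Submodule.smul_mem _ c ha.1, fun x hx => by
    rw [map_smul, ha.2 x hx, smul_zero]⟩

/-- Invariance of B under K alone suffices: the orthogonal space is K-stable and finite-dimensional,
and then it can be differentiated. -/
lemma rotStable_orth {B : (X0 p → ℂ) →ₗ⋆[ℂ] (X0 p → ℂ) →ₗ[ℂ] ℂ}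
    (hB : ∀ g : U p, IsInK g → ∀ f ∈ S p a k, ∀ h ∈ S p a k, B (rho g f) (rho g h) = B f h)
    {X Z : Submodule ℂ (X0 p → ℂ)} (hX : X ≤ S p a k)
    (hXK : ∀ g : U p, IsInK g → ∀ f ∈ X, rho g f ∈ X) [FiniteDimensional ℂ Z] (hZ : Z ≤ S p a k)
    (hZK : ∀ g : U p, IsInK g → ∀ f ∈ Z, rho g f ∈ Z) :
    RotStable ((orth B X Z).comap (Phi p a k)) := by
  have : FiniteDimensional ℂ (orth B X Z) :=
    Submodule.finiteDimensional_of_le (S₂ := Z) fun y hy => hy.1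
  refine rotStable_comap fun A hA P hP => dRho_mem_of_finiteDimensional ?_ hA hP
  rintro g hg f ⟨hf, hfX⟩
  refine ⟨hZK g hg f hf, fun x hx => ?_⟩
  have h1 := hB g hg (rho g⁻¹ x) (rho_mem_S _ (hX hx)) f (hZ hf)
  rwa [rho_rho, mul_inv_cancel, rho_one, hfX _ (hXK _ hg.inv x hx)] at h1

lemma map_H_le_S (m : ℕ × ℕ) : (H p m).map (Phi p a k) ≤ S p a k := by
  rintro _ ⟨P, -, rfl⟩
  exact Phi_mem_S P

/-- Let R be the projection of Q to bidegree m. The polynomials whose functions are orthogonal to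
the K-type of m, within the sum of the two K-types, form a stable space. It contains Q - R, hence
also the component Q. -/
lemma form_Phi_eq_zero (hp : 1 < p) {B : (X0 p → ℂ) →ₗ⋆[ℂ] (X0 p → ℂ) →ₗ[ℂ] ℂ}
    (hs : ∀ f h, B h f = star (B f h)) (hpos : ∀ f ∈ S p a k, f ≠ 0 → 0 < (B f f).re)
    (hB : ∀ g : U p, IsInK g → ∀ f ∈ S p a k, ∀ h ∈ S p a k, B (rho g f) (rho g h) = B f h)
    {m m' : ℕ × ℕ} (hm : m ≠ m') {P Q : Poly p} (hP : P ∈ H p m) (hQ : Q ∈ H p m') :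
    B (Phi p a k P) (Phi p a k Q) = 0 := by
  obtain ⟨_, ⟨R, hR, rfl⟩, hRo⟩ := exists_sub_orthogonal B hs (S p a k) hpos
    (U := (H p m).map (Phi p a k)) (map_H_le_S m) (Phi_mem_S Q)
  rw [← map_sub] at hRo
  have hst := rotStable_orth hB (X := (H p m).map (Phi p a k))
    (Z := (H p m ⊔ H p m').map (Phi p a k)) (map_H_le_S m) (fun g hg f => rho_mem_map_H hg)
    (by rw [Submodule.map_sup]; exact sup_le (map_H_le_S m) (map_H_le_S m'))
    (fun g hg f hf => by
      rw [Submodule.map_sup] at hf ⊢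
      obtain ⟨x, hx, y, hy, rfl⟩ := Submodule.mem_sup.1 hf
      rw [map_add]
      exact Submodule.add_mem_sup (rho_mem_map_H hg hx) (rho_mem_map_H hg hy))
  have h1 := hst.component_mem hp {m, m'} (fun n => if n = m then -R else Q) (by
      intro n hn
      rcases Finset.mem_insert.1 hn with rfl | hn
      · simpa using hR
      · obtain rfl := Finset.mem_singleton.1 hn
        simpa [hm.symm] using hQ) (by
      rw [Finset.sum_pair hm, if_pos rfl, if_neg hm.symm, neg_add_eq_sub]
      exact ⟨⟨_, sub_mem (Submodule.mem_sup_right hQ) (Submodule.mem_sup_left hR), rfl⟩, hRo⟩) m'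
      (by simp)
  rw [if_neg hm.symm] at h1
  exact h1.2 _ ⟨P, hP, rfl⟩

/-! ### Torus weights and finiteness of the K-types met by a K-finite vector -/

/-- The element of `K` whose inverse is diagonal with entries `e`, `1`. -/
def torus (e : Fin p → ℂ) (he : ∀ i, ‖e i‖ = 1) : U p :=
  ⟨⟨Matrix.diagonal (Sum.elim (fun i => starRingEnd ℂ (e i)) fun _ => 1),
    Matrix.diagonal (Sum.elim e fun _ => 1),
    by
      rw [diagonal_mul_diagonal, ← diagonal_one]
      congr 1
      ext i
      rcases i with i | i <;> simp [Complex.conj_mul', he],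
    by
      rw [diagonal_mul_diagonal, ← diagonal_one]
      congr 1
      ext i
      rcases i with i | i <;> simp [Complex.mul_conj', he]⟩, by
    change (Matrix.diagonal _)ᴴ * gram p * Matrix.diagonal _ = gram p
    rw [gram, diagonal_conjTranspose, diagonal_mul_diagonal, diagonal_mul_diagonal]
    congr 1
    ext i
    rcases i with i | i <;> simp [Complex.mul_conj', he]⟩

lemma isInK_torus (e : Fin p → ℂ) (he : ∀ i, ‖e i‖ = 1) : IsInK (torus e he) := fun i => by
  change Matrix.diagonal _ _ _ = (0 : ℂ) ∧ Matrix.diagonal _ _ _ = (0 : ℂ)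
  simp

lemma rho_torus_Phi (e : Fin p → ℂ) (he : ∀ i, ‖e i‖ = 1) (P : Poly p) :
    rho (torus e he) (Phi p a k P) = Phi p a k (subst (Matrix.diagonal e) P) := by
  rw [rho_Phi (c := 1) (v := Matrix.diagonal e) (by simp), psi_one, one_smul]
  intro x
  have h : ∀ i, ((torus e he)⁻¹ • x).1 i = (Sum.elim e (fun _ => 1) : Idx p → ℂ) i * x.1 i :=
    fun i => mulVec_diagonal _ _ i
  refine ⟨by simp [h], fun i => ?_⟩
  rw [h, Finset.sum_eq_single i] <;> simp +contextual [eq_comm]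

lemma subst_diagonal_hwv (e : Fin p → ℂ) (o₁ o₂ : Fin p) (m : ℕ × ℕ) :
    subst (Matrix.diagonal e) (hwv o₁ o₂ m) =
      (e o₁ ^ m.1 * starRingEnd ℂ (e o₂) ^ m.2) • hwv o₁ o₂ m := by
  have h1 : subst (Matrix.diagonal e) (X (Sum.inl o₁)) = e o₁ • X (Sum.inl o₁) := by
    rw [subst_X_inl, Finset.sum_eq_single o₁] <;> simp +contextual [eq_comm]
  have h2 : subst (Matrix.diagonal e) (X (Sum.inr o₂)) = starRingEnd ℂ (e o₂) • X (Sum.inr o₂) := by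
    rw [subst_X_inr, Finset.sum_eq_single o₂] <;> simp +contextual [eq_comm]
  rw [hwv_eq, map_mul, map_pow, map_pow, h1, h2, smul_pow, smul_pow, smul_mul_smul_comm]

/-- The number e^i is not a root of unity because π is irrational, so its powers separate degrees.
-/
lemma exp_I_pow_injective : Function.Injective fun n : ℕ => Complex.exp Complex.I ^ n := by
  intro m n h
  simp only [← Complex.exp_nat_mul] at h
  obtain ⟨j, hj⟩ := Complex.exp_eq_exp_iff_exists_int.1 h
  have h1 : (m : ℝ) = n + j * (2 * Real.pi) := by
    have := congrArg Complex.im hj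
    simpa using this
  by_contra hne
  have hj0 : j ≠ 0 := by
    rintro rfl
    apply hne
    have : (m : ℝ) = n := by rw [h1]; simp
    exact_mod_cast this
  have hj0' : (j : ℝ) ≠ 0 := by exact_mod_cast hj0
  refine irrational_pi ⟨((m : ℚ) - n) / (2 * j), ?_⟩
  push_cast
  field_simp
  linarith

/-- Such an l is an eigenvector of the transpose, which has finitely many eigenvalues. -/
lemma finite_setOf_eigenvector {V : Type*} [AddCommGroup V] [Module ℂ V] [FiniteDimensional ℂ V]
    (T : V →ₗ[ℂ] V) {ζ : ℕ → ℂ} (hζ : Function.Injective ζ) :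
    {n : ℕ | ∃ l : V →ₗ[ℂ] ℂ, l ≠ 0 ∧ ∀ v, l (T v) = ζ n * l v}.Finite := by
  refine Set.Finite.of_finite_image (f := ζ) ?_ hζ.injOn
  refine (Module.End.finite_hasEigenvalue (Module.Dual.transpose T)).subset ?_
  rintro _ ⟨n, ⟨l, hl, hT⟩, rfl⟩
  refine Module.End.hasEigenvalue_of_hasEigenvector (x := l) ⟨Module.End.mem_eigenspace_iff.2 ?_, hl⟩
  ext v
  exact hT v

/-- Pairing with a highest weight vector is an eigenfunctional for the torus on V. One torus element
of infinite order detects m₁ and another m₂; each has finitely many eigenvalues on V, which bounds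
both degrees. -/
lemma finite_setOf_form_hwv_ne_zero {o₁ o₂ : Fin p} (ho : o₁ ≠ o₂)
    {B : (X0 p → ℂ) →ₗ⋆[ℂ] (X0 p → ℂ) →ₗ[ℂ] ℂ}
    (hB : ∀ g : U p, IsInK g → ∀ f ∈ S p a k, ∀ h ∈ S p a k, B (rho g f) (rho g h) = B f h)
    {V : Submodule ℂ (X0 p → ℂ)} [FiniteDimensional ℂ V] (hV : V ≤ S p a k)
    (hVK : ∀ g : U p, IsInK g → ∀ f ∈ V, rho g f ∈ V) :
    {m : ℕ × ℕ | ∃ v ∈ V, B (Phi p a k (hwv o₁ o₂ m)) v ≠ 0}.Finite := by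
  set ζ := Complex.exp Complex.I with hζ
  have hζ1 : ‖ζ‖ = 1 := by simpa using Complex.norm_exp_ofReal_mul_I 1
  have key : ∀ (e : Fin p → ℂ) (he : ∀ i, ‖e i‖ = 1) (m : ℕ × ℕ), ∀ v ∈ V,
      B (Phi p a k (hwv o₁ o₂ m)) (rho (torus e he) v) =
        (e o₁ ^ m.1 * starRingEnd ℂ (e o₂) ^ m.2) * B (Phi p a k (hwv o₁ o₂ m)) v := by
    intro e he m v hv
    rw [← hB (torus e he) (isInK_torus e he) (Phi p a k (hwv o₁ o₂ m)) (Phi_mem_S _) v (hV hv),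
      rho_torus_Phi, subst_diagonal_hwv, map_smul, LinearMap.map_smulₛₗ, LinearMap.smul_apply,
      smul_eq_mul, ← mul_assoc, Complex.mul_conj']
    simp [he]
  have hfin : ∀ (e : Fin p → ℂ) (he : ∀ i, ‖e i‖ = 1) (π : ℕ × ℕ → ℕ) (ξ : ℂ),
      (Function.Injective fun n : ℕ => ξ ^ n) →
      (∀ m : ℕ × ℕ, e o₁ ^ m.1 * starRingEnd ℂ (e o₂) ^ m.2 = ξ ^ π m) →
      {n | ∃ m : ℕ × ℕ, n = π m ∧ ∃ v ∈ V, B (Phi p a k (hwv o₁ o₂ m)) v ≠ 0}.Finite := by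
    intro e he π ξ hξ hπ
    refine (finite_setOf_eigenvector
      ((rho (torus e he)).restrict fun v hv => hVK _ (isInK_torus e he) v hv) hξ).subset ?_
    rintro _ ⟨m, rfl, v, hv, hne⟩
    refine ⟨B (Phi p a k (hwv o₁ o₂ m)) ∘ₗ V.subtype, fun h => hne (LinearMap.congr_fun h ⟨v, hv⟩), ?_⟩
    rintro ⟨u, hu⟩
    rw [← hπ]
    exact key e he m u hu
  have h1 := hfin (fun i => if i = o₁ then ζ else 1) (fun i => by split_ifs <;> simp [hζ1]) Prod.fst ζ
    exp_I_pow_injective (fun m => by simp [ho.symm])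
  have h2 := hfin (fun i => if i = o₂ then ζ else 1) (fun i => by split_ifs <;> simp [hζ1]) Prod.snd
    (starRingEnd ℂ ζ)
    (fun m n h => exp_I_pow_injective (by
      have h' : starRingEnd ℂ ζ ^ m = starRingEnd ℂ ζ ^ n := h
      rw [← map_pow, ← map_pow] at h'
      exact (starRingEnd ℂ).injective h'))
    (fun m => by simp [ho])
  refine (h1.prod h2).subset ?_
  rintro m hm
  exact ⟨⟨m, rfl, hm⟩, ⟨m, rfl, hm⟩⟩

/-- The `K`-finite vectors are the harmonic polynomial functions. -/
theorem HC_eq (hp : 1 < p) : HC p a k = (Harmonic p).map (Phi p a k) := by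
  refine le_antisymm ?_ ?_
  · rintro f ⟨hf, hfin⟩
    obtain ⟨B, hs, hpos, hB, hnd⟩ := exists_invariant_form p a k
    have ho : (⟨0, by omega⟩ : Fin p) ≠ ⟨1, hp⟩ := by simp
    have hM := finite_setOf_form_hwv_ne_zero ho hB (V := kSpan f) (kSpan_le_S hf)
      (fun g hg h hh => rho_mem_kSpan hg hh)
    set M := {m : ℕ × ℕ | ∃ v ∈ kSpan f,
      B (Phi p a k (hwv (⟨0, by omega⟩ : Fin p) ⟨1, hp⟩ m)) v ≠ 0} with hMd
    have hMf : Finite M := hM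
    have : FiniteDimensional ℂ (⨆ m : M, H p m.1 : Submodule ℂ (Poly p)) :=
      Submodule.finiteDimensional_iSup _
    -- Subtract from f its projection onto the finitely many K-types whose highest weight vector
    -- pairs nontrivially with the K-span of f; the remainder is then orthogonal to every polynomial
    -- function.
    obtain ⟨_, ⟨R, hR, rfl⟩, hRo⟩ := exists_sub_orthogonal B hs (S p a k) hpos
      (U := (⨆ m : M, H p m.1).map (Phi p a k)) (by
        rintro _ ⟨P, -, rfl⟩
        exact Phi_mem_S P) hf
    have hR' : R ∈ ⨆ m ∈ M, H p m := by rwa [iSup_subtype']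
    have hzero : f - Phi p a k R = 0 := by
      refine hnd _ (sub_mem hf (Phi_mem_S R)) fun P => ?_
      obtain ⟨Q, hQ, hQP⟩ := Phi_mem_map_harmonic (a := a) (k := k) hp P
      rw [← hQP]
      obtain ⟨s, q, hq, rfl⟩ := exists_components_harmonic hQ
      rw [map_sum, map_sum, LinearMap.sum_apply]
      refine Finset.sum_eq_zero fun m hm => ?_
      by_cases hmM : m ∈ M
      · exact hRo _ ⟨q m, Submodule.mem_iSup_of_mem (⟨m, hmM⟩ : M) (hq m hm), rfl⟩
      -- The highest weight vector is orthogonal to the whole K-span of f, and by irreducibility so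
      -- is all of `H p m`.
      · have h1 : B (Phi p a k (q m)) f = 0 := by
          have hst := rotStable_orth hB (X := kSpan f) (Z := (H p m).map (Phi p a k))
            (kSpan_le_S hf) (fun g hg h hh => rho_mem_kSpan hg hh) (map_H_le_S m)
            (fun g hg f => rho_mem_map_H hg)
          have h2 := hst.H_le hp (m := m) (P := hwv (⟨0, by omega⟩ : Fin p) ⟨1, hp⟩ m)
            ⟨⟨_, hwv_mem ho m, rfl⟩, fun x hx => by
              rw [hs]
              by_contra h3
              exact hmM ⟨x, hx, fun h4 => h3 (by rw [h4, star_zero])⟩⟩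
            (hwv_mem ho m) (hwv_ne_zero _ _ _)
          rw [hs, (h2 (hq m hm)).2 f (mem_kSpan_self f), star_zero]
        have h2 : B (Phi p a k (q m)) (Phi p a k R) = 0 := by
          obtain ⟨s', r, hr, rfl⟩ := exists_components hR'
          rw [map_sum, map_sum]
          refine Finset.sum_eq_zero fun n hn => form_Phi_eq_zero hp hs hpos hB ?_ (hq m hm) (hr n hn).2
          rintro rfl
          exact hmM (hr _ hn).1
        rw [map_sub, h1, h2, sub_zero]
    refine ⟨R, ?_, (sub_eq_zero.1 hzero).symm⟩
    exact (iSup₂_le fun m _ => H_le_harmonic m : (⨆ m ∈ M, H p m) ≤ Harmonic p) hR'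
  · rw [Harmonic, Submodule.map_iSup]
    exact iSup_le map_H_le_HC

end KFinite

/-! ### The lattice of submodules -/

section Lattice

variable {p : ℕ} {a : ℂ} {k : ℤ}

/-- With N = p + m₁ + m₂ - 1, the lower part (m₁ - α)/N of z_j(m₁ - α)P joins -∂̄_j P, and (m₁ -
α)/N - 1 = -(p + m₂ - 1 + α)/N. The zeros of the two coefficients are the barriers attached to α. -/
lemma Phi_boostZ {m : ℕ × ℕ} (hp : 1 < p) {P : Poly p} (hP : P ∈ H p m) (α : ℂ) (j : Fin p) :
    Phi p a k (boostZ α j P) = ((m.1 : ℂ) - α) • Phi p a k (upZ m j P) -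
      (((p : ℂ) + m.1 + m.2 - 1)⁻¹ * (p + m.2 - 1 + α)) • Phi p a k (pderiv (Sum.inr j) P) := by
  have hc := cast_ne_zero_of_lt hp m
  rw [boostZ_apply, eulerZ_of_mem (mem_H.1 hP).1, ← sub_smul, mul_smul_comm, map_sub, map_smul,
    Phi_X_inl_mul (m := m)]
  match_scalars
  · ring
  · field_simp
    ring

lemma Phi_boostB {m : ℕ × ℕ} (hp : 1 < p) {P : Poly p} (hP : P ∈ H p m) (β : ℂ) (j : Fin p) :
    Phi p a k (boostB β j P) = ((m.2 : ℂ) - β) • Phi p a k (upB m j P) -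
      (((p : ℂ) + m.1 + m.2 - 1)⁻¹ * (p + m.1 - 1 + β)) • Phi p a k (pderiv (Sum.inl j) P) := by
  have hc := cast_ne_zero_of_lt hp m
  rw [boostB_apply, eulerB_of_mem (mem_H.1 hP).2.1, ← sub_smul, mul_smul_comm, map_sub, map_smul,
    Phi_X_inr_mul (m := m)]
  match_scalars
  · ring
  · field_simp
    ring

/-- The sum of the `K`-types with parameters in `M`. -/
def kSum (p : ℕ) (a : ℂ) (k : ℤ) (M : Set (ℕ × ℕ)) : Submodule ℂ (X0 p → ℂ) :=
  (⨆ m ∈ M, H p m).map (Phi p a k)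

lemma kSum_eq (M : Set (ℕ × ℕ)) : kSum p a k M = ⨆ m, ⨆ _ : m ∈ M, KType p a k m := by
  simp only [kSum, Submodule.map_iSup, KType_eq_map]

lemma map_H_le_kSum {M : Set (ℕ × ℕ)} {m : ℕ × ℕ} (hm : m ∈ M) :
    (H p m).map (Phi p a k) ≤ kSum p a k M :=
  Submodule.map_mono (le_iSup₂_of_le m hm le_rfl)

lemma kSum_mono {M M' : Set (ℕ × ℕ)} (h : M ⊆ M') : kSum p a k M ≤ kSum p a k M' :=
  Submodule.map_mono (iSup₂_le fun m hm => le_iSup₂_of_le m (h hm) le_rfl)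

lemma kSum_le_iff {M : Set (ℕ × ℕ)} {W : Submodule ℂ (X0 p → ℂ)} :
    kSum p a k M ≤ W ↔ ∀ m ∈ M, (H p m).map (Phi p a k) ≤ W := by
  simp only [kSum, Submodule.map_iSup, iSup_le_iff]

lemma kSum_univ (hp : 1 < p) : kSum p a k Set.univ = HC p a k := by
  simp [HC_eq hp, kSum, Harmonic]

lemma kSum_empty : kSum p a k ∅ = ⊥ := by simp [kSum]

lemma rotStable_bot : RotStable (⊥ : Submodule ℂ (Poly p)) := by
  intro i j P hP
  rw [Submodule.mem_bot] at hP ⊢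
  rw [hP, map_zero]

lemma kSum_le_HC (M : Set (ℕ × ℕ)) : kSum p a k M ≤ HC p a k :=
  kSum_le_iff.2 fun m _ => map_H_le_HC m

/-- `Phi` is injective on harmonic polynomials, and the spaces `H p m` are independent because their
eigenvalues differ. -/
lemma mem_of_Phi_mem_kSum (hp : 1 < p) {M : Set (ℕ × ℕ)} {m : ℕ × ℕ} {P : Poly p} (hP : P ∈ H p m)
    (h0 : P ≠ 0) (h : Phi p a k P ∈ kSum p a k M) : m ∈ M := by
  classical
  obtain ⟨Q, hQ, hQP⟩ := h
  have hQ' : Q ∈ Harmonic p :=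
    (iSup₂_le fun m _ => H_le_harmonic m : (⨆ m ∈ M, H p m) ≤ Harmonic p) hQ
  have h1 : P - Q = 0 := eq_zero_of_Phi_eq_zero (a := a) (k := k) hp
    (sub_mem (H_le_harmonic m hP) hQ') (by rw [map_sub, hQP, sub_self])
  obtain ⟨s, f, hf, rfl⟩ := exists_components hQ
  by_contra hm
  have hms : m ∉ s := fun h => hm (hf m h).1
  have h2 := rotStable_bot.component_mem hp (insert m s) (fun n => if n = m then P else -f n) (by
      intro n hn
      rcases Finset.mem_insert.1 hn with rfl | hns
      · simpa using hP
      · rw [if_neg (by rintro rfl; exact hms hns)]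
        exact neg_mem (hf n hns).2) (by
      rw [Finset.sum_insert hms, if_pos rfl, Finset.sum_congr rfl (g := fun n => -f n), Finset.sum_neg_distrib,
        ← sub_eq_add_neg, h1]
      · exact zero_mem _
      · intro n hn
        rw [if_neg (by rintro rfl; exact hms hn)]) m (Finset.mem_insert_self _ _)
  rw [if_pos rfl] at h2
  exact h0 h2

lemma kSum_le_kSum_iff (hp : 1 < p) {M M' : Set (ℕ × ℕ)} :
    kSum p a k M ≤ kSum p a k M' ↔ M ⊆ M' := by
  have ho : (⟨0, by omega⟩ : Fin p) ≠ ⟨1, hp⟩ := by simp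
  exact ⟨fun h m hm => mem_of_Phi_mem_kSum hp (hwv_mem ho m) (hwv_ne_zero _ _ _)
    (h (map_H_le_kSum hm ⟨_, hwv_mem ho m, rfl⟩)), kSum_mono⟩

lemma kSum_injective (hp : 1 < p) : Function.Injective (kSum p a k) := fun _ _ h =>
  Set.Subset.antisymm ((kSum_le_kSum_iff hp).1 h.le) ((kSum_le_kSum_iff hp).1 h.ge)

/-! ### Submodules as sets of K-types closed under transitions -/

/-- The transitions between `K`-types that the Lie algebra can make. -/
inductive Step (p : ℕ) (α β : ℂ) : ℕ × ℕ → ℕ × ℕ → Prop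
  | up_fst (m₁ m₂ : ℕ) : (m₁ : ℂ) ≠ α → Step p α β (m₁, m₂) (m₁ + 1, m₂)
  | down_snd (m₁ m₂ : ℕ) : (p : ℂ) + m₂ + α ≠ 0 → Step p α β (m₁, m₂ + 1) (m₁, m₂)
  | up_snd (m₁ m₂ : ℕ) : (m₂ : ℂ) ≠ β → Step p α β (m₁, m₂) (m₁, m₂ + 1)
  | down_fst (m₁ m₂ : ℕ) : (p : ℂ) + m₁ + β ≠ 0 → Step p α β (m₁ + 1, m₂) (m₁, m₂)

/-- The sets of `K`-types that are stable under the possible transitions. -/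
def StepClosed (p : ℕ) (α β : ℂ) (M : Set (ℕ × ℕ)) : Prop :=
  ∀ m m', Step p α β m m' → m ∈ M → m' ∈ M

lemma StepClosed.reach {α β : ℂ} {M : Set (ℕ × ℕ)} (hM : StepClosed p α β M) {m m' : ℕ × ℕ}
    (h : Relation.ReflTransGen (Step p α β) m m') (hm : m ∈ M) : m' ∈ M := by
  induction h with
  | refl => exact hm
  | tail _ hs ih => exact hM _ _ hs ih

lemma Phi_boostZ_mem_kSum (hp : 1 < p) {M : Set (ℕ × ℕ)} {α β : ℂ}
    (hM : StepClosed p α β M) {m : ℕ × ℕ} (hm : m ∈ M) {P : Poly p}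
    (hP : P ∈ H p m) (j : Fin p) : Phi p a k (boostZ α j P) ∈ kSum p a k M := by
  obtain ⟨m₁, m₂⟩ := m
  rw [Phi_boostZ hp hP]
  refine sub_mem ?_ ?_
  · by_cases h : (m₁ : ℂ) = α
    · rw [sub_eq_zero.2 h, zero_smul]
      exact zero_mem _
    · exact Submodule.smul_mem _ _ (map_H_le_kSum (hM _ _ (Step.up_fst _ _ h) hm)
        ⟨_, upZ_mem hp hP j, rfl⟩)
  · rcases m₂ with _ | m₂
    · rw [pderiv_inr_of_zero hP, map_zero, smul_zero]
      exact zero_mem _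
    · by_cases h : (p : ℂ) + m₂ + α = 0
      · have : (p : ℂ) + ((m₁, m₂ + 1) : ℕ × ℕ).2 - 1 + α = 0 := by
          push_cast
          linear_combination h
        rw [this, mul_zero, zero_smul]
        exact zero_mem _
      · exact Submodule.smul_mem _ _ (map_H_le_kSum (hM _ _ (Step.down_snd _ _ h) hm)
          ⟨_, pderiv_inr_mem hP j, rfl⟩)

lemma Phi_boostB_mem_kSum (hp : 1 < p) {M : Set (ℕ × ℕ)} {α β : ℂ}
    (hM : StepClosed p α β M) {m : ℕ × ℕ} (hm : m ∈ M) {P : Poly p}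
    (hP : P ∈ H p m) (j : Fin p) : Phi p a k (boostB β j P) ∈ kSum p a k M := by
  obtain ⟨m₁, m₂⟩ := m
  rw [Phi_boostB hp hP]
  refine sub_mem ?_ ?_
  · by_cases h : (m₂ : ℂ) = β
    · rw [sub_eq_zero.2 h, zero_smul]
      exact zero_mem _
    · exact Submodule.smul_mem _ _ (map_H_le_kSum (hM _ _ (Step.up_snd _ _ h) hm)
        ⟨_, upB_mem hp hP j, rfl⟩)
  · rcases m₁ with _ | m₁
    · rw [pderiv_inl_of_zero hP, map_zero, smul_zero]
      exact zero_mem _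
    · by_cases h : (p : ℂ) + m₁ + β = 0
      · have : (p : ℂ) + ((m₁ + 1, m₂) : ℕ × ℕ).1 - 1 + β = 0 := by
          push_cast
          linear_combination h
        rw [this, mul_zero, zero_smul]
        exact zero_mem _
      · exact Submodule.smul_mem _ _ (map_H_le_kSum (hM _ _ (Step.down_fst _ _ h) hm)
          ⟨_, pderiv_inl_mem hP j, rfl⟩)

lemma isGKSubmodule_kSum (hp : 1 < p) {M : Set (ℕ × ℕ)}
    (hM : StepClosed p ((a + k) / 2) ((a - k) / 2) M) : IsGKSubmodule p a k (kSum p a k M) := by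
  refine ⟨kSum_le_HC M, fun g hg => ?_, fun A => ?_⟩
  · have : kSum p a k M ≤ (kSum p a k M).comap (rho g) := kSum_le_iff.2 fun m hm f hf =>
      map_H_le_kSum hm (rho_mem_map_H hg hf)
    exact this
  · have : (⨆ m ∈ M, H p m) ≤ (kSum p a k M).comap (Phi p a k ∘ₗ lieOp a k A.1) := by
      refine iSup₂_le fun m hm P hP => ?_
      rw [Submodule.mem_comap, LinearMap.comp_apply, lieOp_apply, eulerZ_of_mem (mem_H.1 hP).1,
        eulerB_of_mem (mem_H.1 hP).2.1]
      simp only [map_add, map_sub, map_sum, map_smul]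
      have hPm : ∀ Q ∈ H p m, Phi p a k Q ∈ kSum p a k M := fun Q hQ =>
        map_H_le_kSum hm ⟨Q, hQ, rfl⟩
      refine sub_mem (add_mem (add_mem ?_ ?_) ?_) ?_
      · exact sum_mem fun j _ => Submodule.smul_mem _ _ (Phi_boostZ_mem_kSum hp hM hm hP j)
      · exact sum_mem fun j _ => Submodule.smul_mem _ _ (Phi_boostB_mem_kSum hp hM hm hP j)
      · exact Submodule.smul_mem _ _ (sub_mem (sub_mem (Submodule.smul_mem _ _ (hPm P hP))
          (Submodule.smul_mem _ _ (hPm P hP))) (Submodule.smul_mem _ _ (hPm P hP)))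
      · exact sum_mem fun i _ => sum_mem fun j _ =>
          Submodule.smul_mem _ _ (hPm _ (rot_mem hP j i))
    rintro _ ⟨P, hP, rfl⟩
    rw [dRho_Phi]
    exact this hP

lemma IsGKSubmodule.rotStable {W : Submodule ℂ (X0 p → ℂ)} (hW : IsGKSubmodule p a k W) :
    RotStable (W.comap (Phi p a k)) :=
  rotStable_comap fun A _ _ hP => hW.2.2 A _ hP

/-- The components of a vector of W lie in W, and a nonzero component generates its whole K-type. -/
lemma IsGKSubmodule.eq_kSum (hp : 1 < p) {W : Submodule ℂ (X0 p → ℂ)} (hW : IsGKSubmodule p a k W) :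
    W = kSum p a k {m | (H p m).map (Phi p a k) ≤ W} := by
  refine le_antisymm ?_ (kSum_le_iff.2 fun m hm => hm)
  intro f hf
  have h1 := hW.1 hf
  rw [HC_eq hp] at h1
  obtain ⟨Q, hQ, rfl⟩ := h1
  obtain ⟨s, q, hq, rfl⟩ := exists_components_harmonic hQ
  have h2 := hW.rotStable.component_mem hp s q hq hf
  rw [map_sum]
  refine sum_mem fun m hm => ?_
  by_cases h0 : q m = 0
  · rw [h0, map_zero]; exact zero_mem _
  · have h3 : m ∈ {m | (H p m).map (Phi p a k) ≤ W} :=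
      Submodule.map_le_iff_le_comap.2 (hW.rotStable.H_le hp (h2 m hm) (hq m hm) h0)
    exact map_H_le_kSum h3 ⟨_, hq m hm, rfl⟩

/-- The two terms of `Phi_boostZ` belong to different K-types, so a submodule contains each of them.
For m₂ = 0 the lower term is absent. -/
lemma IsGKSubmodule.upZ_mem (hp : 1 < p) {W : Submodule ℂ (X0 p → ℂ)} (hW : IsGKSubmodule p a k W)
    {m : ℕ × ℕ} {P : Poly p} (hP : P ∈ H p m) (hPW : Phi p a k P ∈ W) (j : Fin p) :
    ((m.1 : ℂ) - (a + k) / 2) • Phi p a k (upZ m j P) ∈ W ∧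
      (((p : ℂ) + m.1 + m.2 - 1)⁻¹ * (p + m.2 - 1 + (a + k) / 2)) •
        Phi p a k (pderiv (Sum.inr j) P) ∈ W := by
  obtain ⟨m₁, m₂⟩ := m
  have h1 := Phi_boostZ_mem hW.2.2 hPW j
  rw [Phi_boostZ hp hP] at h1
  rcases m₂ with _ | m₂
  · rw [pderiv_inr_of_zero hP, map_zero, smul_zero, sub_zero] at h1
    rw [pderiv_inr_of_zero hP, map_zero, smul_zero]
    exact ⟨h1, zero_mem _⟩
  · rw [← map_smul, ← map_smul, ← map_sub, sub_eq_add_neg] at h1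
    have hne : ((m₁ + 1, m₂ + 1) : ℕ × ℕ) ≠ (m₁, m₂) := by simp
    have h2 := hW.rotStable.component_mem hp {(m₁ + 1, m₂ + 1), (m₁, m₂)}
      (fun n => if n = (m₁ + 1, m₂ + 1) then (((m₁, m₂ + 1) : ℕ × ℕ).1 - (a + k) / 2 : ℂ) •
        upZ (m₁, m₂ + 1) j P else -((((p : ℂ) + ((m₁, m₂ + 1) : ℕ × ℕ).1 + ((m₁, m₂ + 1) : ℕ × ℕ).2 - 1)⁻¹ *
          (p + ((m₁, m₂ + 1) : ℕ × ℕ).2 - 1 + (a + k) / 2)) • pderiv (Sum.inr j) P)) (by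
        intro n hn
        rcases Finset.mem_insert.1 hn with rfl | hn
        · rw [if_pos rfl]
          exact Submodule.smul_mem _ _ (LightCone.upZ_mem hp hP j)
        · obtain rfl := Finset.mem_singleton.1 hn
          rw [if_neg hne.symm]
          exact neg_mem (Submodule.smul_mem _ _ (pderiv_inr_mem hP j))) (by
        rw [Finset.sum_pair hne, if_pos rfl, if_neg hne.symm]
        exact h1)
    have h3 := h2 _ (Finset.mem_insert_self _ _)
    have h4 := h2 (m₁, m₂) (by simp)
    rw [if_pos rfl, Submodule.mem_comap, map_smul] at h3
    rw [if_neg hne.symm, Submodule.neg_mem_iff, Submodule.mem_comap, map_smul] at h4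
    exact ⟨h3, h4⟩

lemma IsGKSubmodule.upB_mem (hp : 1 < p) {W : Submodule ℂ (X0 p → ℂ)} (hW : IsGKSubmodule p a k W)
    {m : ℕ × ℕ} {P : Poly p} (hP : P ∈ H p m) (hPW : Phi p a k P ∈ W) (j : Fin p) :
    ((m.2 : ℂ) - (a - k) / 2) • Phi p a k (upB m j P) ∈ W ∧
      (((p : ℂ) + m.1 + m.2 - 1)⁻¹ * (p + m.1 - 1 + (a - k) / 2)) •
        Phi p a k (pderiv (Sum.inl j) P) ∈ W := by
  obtain ⟨m₁, m₂⟩ := m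
  have h1 := Phi_boostB_mem hW.2.2 hPW j
  rw [Phi_boostB hp hP] at h1
  rcases m₁ with _ | m₁
  · rw [pderiv_inl_of_zero hP, map_zero, smul_zero, sub_zero] at h1
    rw [pderiv_inl_of_zero hP, map_zero, smul_zero]
    exact ⟨h1, zero_mem _⟩
  · rw [← map_smul, ← map_smul, ← map_sub, sub_eq_add_neg] at h1
    have hne : ((m₁ + 1, m₂ + 1) : ℕ × ℕ) ≠ (m₁, m₂) := by simp
    have h2 := hW.rotStable.component_mem hp {(m₁ + 1, m₂ + 1), (m₁, m₂)}
      (fun n => if n = (m₁ + 1, m₂ + 1) then (((m₁ + 1, m₂) : ℕ × ℕ).2 - (a - k) / 2 : ℂ) •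
        upB (m₁ + 1, m₂) j P else -((((p : ℂ) + ((m₁ + 1, m₂) : ℕ × ℕ).1 + ((m₁ + 1, m₂) : ℕ × ℕ).2 - 1)⁻¹ *
          (p + ((m₁ + 1, m₂) : ℕ × ℕ).1 - 1 + (a - k) / 2)) • pderiv (Sum.inl j) P)) (by
        intro n hn
        rcases Finset.mem_insert.1 hn with rfl | hn
        · rw [if_pos rfl]
          exact Submodule.smul_mem _ _ (LightCone.upB_mem hp hP j)
        · obtain rfl := Finset.mem_singleton.1 hn
          rw [if_neg hne.symm]
          exact neg_mem (Submodule.smul_mem _ _ (pderiv_inl_mem hP j))) (by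
        rw [Finset.sum_pair hne, if_pos rfl, if_neg hne.symm]
        exact h1)
    have h3 := h2 _ (Finset.mem_insert_self _ _)
    have h4 := h2 (m₁, m₂) (by simp)
    rw [if_pos rfl, Submodule.mem_comap, map_smul] at h3
    rw [if_neg hne.symm, Submodule.neg_mem_iff, Submodule.mem_comap, map_smul] at h4
    exact ⟨h3, h4⟩

/-- Highest weight vectors serve as test vectors: the four transition maps carry them to nonzero
multiples of one another, so a transition fails only when its scalar coefficient vanishes. -/
lemma pderiv_inl_hwv {o₁ o₂ : Fin p} (m₁ m₂ : ℕ) :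
    pderiv (Sum.inl o₁) (hwv o₁ o₂ (m₁ + 1, m₂)) = ((m₁ : ℂ) + 1) • hwv o₁ o₂ (m₁, m₂) := by
  rw [hwv_eq, hwv_eq, pderiv_mul, pderiv_pow, pderiv_pow, pderiv_X_self,
    pderiv_X_of_ne (by simp), smul_eq_C_mul]
  simp
  ring

lemma pderiv_inr_hwv {o₁ o₂ : Fin p} (m₁ m₂ : ℕ) :
    pderiv (Sum.inr o₂) (hwv o₁ o₂ (m₁, m₂ + 1)) = ((m₂ : ℂ) + 1) • hwv o₁ o₂ (m₁, m₂) := by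
  rw [hwv_eq, hwv_eq, pderiv_mul, pderiv_pow, pderiv_pow, pderiv_X_self,
    pderiv_X_of_ne (by simp), smul_eq_C_mul]
  simp
  ring

lemma upZ_hwv {o₁ o₂ : Fin p} (ho : o₁ ≠ o₂) (m₁ m₂ : ℕ) :
    upZ (m₁, m₂) o₁ (hwv o₁ o₂ (m₁, m₂)) = hwv o₁ o₂ (m₁ + 1, m₂) := by
  rw [upZ, hwv_eq, hwv_eq, pderiv_mul, pderiv_pow, pderiv_pow, pderiv_X_of_ne (by simp),
    pderiv_X_of_ne (by simpa using ho.symm)]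
  simp
  ring

lemma upB_hwv {o₁ o₂ : Fin p} (ho : o₁ ≠ o₂) (m₁ m₂ : ℕ) :
    upB (m₁, m₂) o₂ (hwv o₁ o₂ (m₁, m₂)) = hwv o₁ o₂ (m₁, m₂ + 1) := by
  rw [upB, hwv_eq, hwv_eq, pderiv_mul, pderiv_pow, pderiv_pow, pderiv_X_of_ne (by simpa using ho),
    pderiv_X_of_ne (by simp)]
  simp
  ring

/-- A nonzero coefficient puts the neighbouring highest weight vector into W, and irreducibility
then gives the full K-type. -/
lemma IsGKSubmodule.stepClosed (hp : 1 < p) {W : Submodule ℂ (X0 p → ℂ)}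
    (hW : IsGKSubmodule p a k W) :
    StepClosed p ((a + k) / 2) ((a - k) / 2) {m | (H p m).map (Phi p a k) ≤ W} := by
  have ho : (⟨0, by omega⟩ : Fin p) ≠ ⟨1, hp⟩ := by simp
  have hiff : ∀ m, Phi p a k (hwv (⟨0, by omega⟩ : Fin p) ⟨1, hp⟩ m) ∈ W →
      (H p m).map (Phi p a k) ≤ W := fun m h =>
    Submodule.map_le_iff_le_comap.2 (hW.rotStable.H_le hp (P := hwv (⟨0, by omega⟩ : Fin p) ⟨1, hp⟩ m)
      h (hwv_mem ho m) (hwv_ne_zero _ _ _))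
  have hcancel : ∀ (c : ℂ) (f : X0 p → ℂ), c ≠ 0 → c • f ∈ W → f ∈ W := fun c f hc h =>
    (Submodule.smul_mem_iff W hc).1 h
  rintro m m' (⟨m₁, m₂, h⟩ | ⟨m₁, m₂, h⟩ | ⟨m₁, m₂, h⟩ | ⟨m₁, m₂, h⟩) hm
  · have := (hW.upZ_mem hp (hwv_mem ho _) (hm ⟨_, hwv_mem ho _, rfl⟩) ⟨0, by omega⟩).1
    rw [upZ_hwv ho] at this
    exact hiff _ (hcancel _ _ (sub_ne_zero.2 h) this)
  · have := (hW.upZ_mem hp (hwv_mem ho _) (hm ⟨_, hwv_mem ho _, rfl⟩) ⟨1, hp⟩).2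
    rw [pderiv_inr_hwv, map_smul] at this
    refine hiff _ (hcancel _ _ (Nat.cast_add_one_ne_zero m₂) (hcancel _ _ (mul_ne_zero
      (inv_ne_zero (cast_ne_zero_of_lt hp _)) ?_) this))
    intro h0
    apply h
    push_cast at h0
    linear_combination h0
  · have := (hW.upB_mem hp (hwv_mem ho _) (hm ⟨_, hwv_mem ho _, rfl⟩) ⟨1, hp⟩).1
    rw [upB_hwv ho] at this
    exact hiff _ (hcancel _ _ (sub_ne_zero.2 h) this)
  · have := (hW.upB_mem hp (hwv_mem ho _) (hm ⟨_, hwv_mem ho _, rfl⟩) ⟨0, by omega⟩).2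
    rw [pderiv_inl_hwv, map_smul] at this
    refine hiff _ (hcancel _ _ (Nat.cast_add_one_ne_zero m₁) (hcancel _ _ (mul_ne_zero
      (inv_ne_zero (cast_ne_zero_of_lt hp _)) ?_) this))
    intro h0
    apply h
    push_cast at h0
    linear_combination h0

theorem isGKSubmodule_iff (hp : 1 < p) {W : Submodule ℂ (X0 p → ℂ)} : IsGKSubmodule p a k W ↔
    ∃ M, StepClosed p ((a + k) / 2) ((a - k) / 2) M ∧ W = kSum p a k M := by
  refine ⟨fun h => ⟨_, h.stepClosed hp, h.eq_kSum hp⟩, ?_⟩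
  rintro ⟨M, hM, rfl⟩
  exact isGKSubmodule_kSum hp hM

lemma isGKSubmodule_kSum_iff (hp : 1 < p) {M : Set (ℕ × ℕ)} : IsGKSubmodule p a k (kSum p a k M) ↔
    StepClosed p ((a + k) / 2) ((a - k) / 2) M := by
  refine ⟨fun h => ?_, isGKSubmodule_kSum hp⟩
  obtain ⟨M', hM', h'⟩ := (isGKSubmodule_iff hp).1 h
  rwa [kSum_injective hp h']

lemma isIrred_of_reach (hp : 1 < p)
    (h : ∀ m m', Relation.ReflTransGen (Step p ((a + k) / 2) ((a - k) / 2)) m m') :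
    IsIrred p a k := by
  refine ⟨?_, fun W hW => ?_⟩
  · rw [← kSum_univ hp, ← kSum_empty]
    exact fun h => Set.univ_nonempty.ne_empty (kSum_injective hp h)
  · obtain ⟨M, hM, rfl⟩ := (isGKSubmodule_iff hp).1 hW
    rcases M.eq_empty_or_nonempty with rfl | ⟨m, hm⟩
    · exact Or.inl kSum_empty
    · right
      rw [← kSum_univ hp, Set.eq_univ_of_forall fun m' => hM.reach (h m m') hm]

/-- The highest weight vectors of the K-types in M but not in M' stay independent in the quotient.
Conversely the sum of these K-types, each finite-dimensional, maps onto it. -/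
lemma finiteDimensional_quotient_iff (hp : 1 < p) {M M' : Set (ℕ × ℕ)}
    (hM' : IsGKSubmodule p a k (kSum p a k M')) :
    FiniteDimensional ℂ (kSum p a k M ⧸ (kSum p a k M').submoduleOf (kSum p a k M)) ↔
      (M \ M').Finite := by
  constructor
  · intro hfin
    have ho : (⟨0, by omega⟩ : Fin p) ≠ ⟨1, hp⟩ := by simp
    set hw := hwv (⟨0, by omega⟩ : Fin p) ⟨1, hp⟩ with hwd
    have hmem : ∀ m : ↥(M \ M'), Phi p a k (hw m) ∈ kSum p a k M := fun m =>
      map_H_le_kSum m.2.1 ⟨_, hwv_mem ho _, rfl⟩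
    have hli : LinearIndependent ℂ (fun m : ↥(M \ M') =>
        ((kSum p a k M').submoduleOf (kSum p a k M)).mkQ ⟨_, hmem m⟩) := by
      classical
      rw [linearIndependent_iff']
      intro s g hg i hi
      have h1 : (∑ j ∈ s, g j • (⟨_, hmem j⟩ : kSum p a k M)) ∈
          (kSum p a k M').submoduleOf (kSum p a k M) := by
        rw [← Submodule.ker_mkQ ((kSum p a k M').submoduleOf (kSum p a k M)), LinearMap.mem_ker,
          map_sum]
        simpa only [map_smul] using hg
      have h2 : ∑ n ∈ s.map (Function.Embedding.subtype _),
          (if h : n ∈ M \ M' then g ⟨n, h⟩ • hw n else 0) ∈ (kSum p a k M').comap (Phi p a k) := by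
        rw [Finset.sum_map, Submodule.mem_comap, map_sum]
        have h3 : ((∑ j ∈ s, g j • (⟨_, hmem j⟩ : kSum p a k M) : kSum p a k M) : X0 p → ℂ) ∈
          kSum p a k M' := h1
        rw [AddSubmonoidClass.coe_finsetSum] at h3
        convert h3 using 2 with j hj
        have : (Function.Embedding.subtype (fun m => m ∈ M \ M')) j ∈ M \ M' := j.2
        rw [dif_pos this, map_smul]
        rfl
      have h3 := hM'.rotStable.component_mem hp _ _ (by
        intro n hn
        obtain ⟨j, hj, rfl⟩ := Finset.mem_map.1 hn
        have : (Function.Embedding.subtype (fun m => m ∈ M \ M')) j ∈ M \ M' := j.2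
        rw [dif_pos this]
        exact Submodule.smul_mem _ _ (hwv_mem ho _)) h2 i.1 (Finset.mem_map_of_mem _ hi)
      rw [dif_pos i.2] at h3
      by_contra h0
      exact i.2.2 (mem_of_Phi_mem_kSum hp (Submodule.smul_mem _ _ (hwv_mem ho _))
        (smul_ne_zero h0 (hwv_ne_zero _ _ _)) h3)
    exact hli.finite
  · intro hfin
    have : Finite ↥(M \ M') := hfin
    have hFD : FiniteDimensional ℂ (⨆ m ∈ M \ M', H p m : Submodule ℂ (Poly p)) := by
      rw [iSup_subtype']
      exact Submodule.finiteDimensional_iSup _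
    have hle := kSum_mono (p := p) (a := a) (k := k) (Set.sdiff_subset (s := M) (t := M'))
    have hFD' : FiniteDimensional ℂ (kSum p a k (M \ M')) := by
      unfold kSum
      infer_instance
    refine Module.Finite.of_surjective
      (((kSum p a k M').submoduleOf (kSum p a k M)).mkQ ∘ₗ Submodule.inclusion hle) ?_
    intro q
    obtain ⟨⟨f, hf⟩, rfl⟩ := Submodule.mkQ_surjective _ q
    have hsup : kSum p a k M ≤ kSum p a k (M \ M') ⊔ kSum p a k M' := kSum_le_iff.2 fun m hm => by
      by_cases h : m ∈ M'
      · exact (map_H_le_kSum h).trans le_sup_right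
      · exact (map_H_le_kSum (⟨hm, h⟩ : m ∈ M \ M')).trans le_sup_left
    obtain ⟨x, hx, y, hy, rfl⟩ := Submodule.mem_sup.1 (hsup hf)
    refine ⟨⟨x, hx⟩, ?_⟩
    rw [LinearMap.comp_apply, ← sub_eq_zero, ← map_sub, ← LinearMap.mem_ker, Submodule.ker_mkQ]
    change x - (x + y) ∈ kSum p a k M'
    rw [sub_add_cancel_left]
    exact neg_mem hy

end Lattice

/-! ### Integral parameters -/

section Integral

variable {p : ℕ} {α β : ℤ}

lemma alpha_eq (α β : ℤ) : (((α + β : ℤ) : ℂ) + ((α - β : ℤ) : ℂ)) / 2 = α := by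
  push_cast
  ring

lemma beta_eq (α β : ℤ) : (((α + β : ℤ) : ℂ) - ((α - β : ℤ) : ℂ)) / 2 = β := by
  push_cast
  ring

/-- The `K`-type `m'` satisfies the barrier conditions that `m` satisfies. -/
def BarrierLE (p : ℕ) (α β : ℤ) (m m' : ℕ × ℕ) : Prop :=
  (m.1 ≤ α → m'.1 ≤ α) ∧ (1 - p - β ≤ m.1 → 1 - p - β ≤ m'.1) ∧
    (m.2 ≤ β → m'.2 ≤ β) ∧ (1 - p - α ≤ m.2 → 1 - p - α ≤ m'.2)

/-- A step changes one coordinate by one, so it can leave a half-plane only from the boundary line,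
where the coefficient is zero. -/
lemma Step.barrierLE {m m' : ℕ × ℕ} (h : Step p (α : ℂ) β m m') : BarrierLE p α β m m' := by
  rcases h with ⟨m₁, m₂, h⟩ | ⟨m₁, m₂, h⟩ | ⟨m₁, m₂, h⟩ | ⟨m₁, m₂, h⟩ <;> unfold BarrierLE
  · have : (m₁ : ℤ) ≠ α := by exact_mod_cast h
    dsimp only
    omega
  · have : (p : ℤ) + m₂ + α ≠ 0 := by exact_mod_cast h
    dsimp only
    omega
  · have : (m₂ : ℤ) ≠ β := by exact_mod_cast h
    dsimp only
    omega
  · have : (p : ℤ) + m₁ + β ≠ 0 := by exact_mod_cast h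
    dsimp only
    omega

lemma reach_up_fst {α β : ℂ} {m₁ n : ℕ} (m₂ : ℕ) (hn : m₁ ≤ n) (h : ∀ j, m₁ ≤ j → j < n → (j : ℂ) ≠ α) :
    Relation.ReflTransGen (Step p α β) (m₁, m₂) (n, m₂) := by
  induction n, hn using Nat.le_induction with
  | base => exact .refl
  | succ n hn ih =>
    exact (ih fun j h1 h2 => h j h1 (by omega)).tail (Step.up_fst _ _ (h n hn (by omega)))

lemma reach_up_snd {α β : ℂ} {m₂ n : ℕ} (m₁ : ℕ) (hn : m₂ ≤ n) (h : ∀ j, m₂ ≤ j → j < n → (j : ℂ) ≠ β) :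
    Relation.ReflTransGen (Step p α β) (m₁, m₂) (m₁, n) := by
  induction n, hn using Nat.le_induction with
  | base => exact .refl
  | succ n hn ih =>
    exact (ih fun j h1 h2 => h j h1 (by omega)).tail (Step.up_snd _ _ (h n hn (by omega)))

lemma reach_down_fst {α β : ℂ} {m₁ n : ℕ} (m₂ : ℕ) (hn : n ≤ m₁)
    (h : ∀ j, n ≤ j → j < m₁ → (p : ℂ) + j + β ≠ 0) :
    Relation.ReflTransGen (Step p α β) (m₁, m₂) (n, m₂) := by
  induction m₁, hn using Nat.le_induction with
  | base => exact .refl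
  | succ m₁ hn ih =>
    exact (ih fun j h1 h2 => h j h1 (by omega)).head (Step.down_fst _ _ (h m₁ hn (by omega)))

lemma reach_down_snd {α β : ℂ} {m₂ n : ℕ} (m₁ : ℕ) (hn : n ≤ m₂)
    (h : ∀ j, n ≤ j → j < m₂ → (p : ℂ) + j + α ≠ 0) :
    Relation.ReflTransGen (Step p α β) (m₁, m₂) (m₁, n) := by
  induction m₂, hn using Nat.le_induction with
  | base => exact .refl
  | succ m₂ hn ih =>
    exact (ih fun j h1 h2 => h j h1 (by omega)).head (Step.down_snd _ _ (h m₂ hn (by omega)))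

/-- The barriers are horizontal or vertical in the (m₁, m₂)-plane. So m₁ can be adjusted before m₂,
and along each segment only a barrier met in the forbidden direction could block the way. -/
theorem reach_iff {m m' : ℕ × ℕ} :
    Relation.ReflTransGen (Step p (α : ℂ) β) m m' ↔ BarrierLE p α β m m' := by
  constructor
  · intro h
    induction h with
    | refl => exact ⟨id, id, id, id⟩
    | tail _ hs ih =>
      have := hs.barrierLE
      exact ⟨this.1 ∘ ih.1, this.2.1 ∘ ih.2.1, this.2.2.1 ∘ ih.2.2.1, this.2.2.2 ∘ ih.2.2.2⟩
  · obtain ⟨m₁, m₂⟩ := m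
    obtain ⟨n₁, n₂⟩ := m'
    rintro ⟨h1, h2, h3, h4⟩
    dsimp only at h1 h2 h3 h4
    refine Relation.ReflTransGen.trans (b := (n₁, m₂)) ?_ ?_
    · rcases le_total m₁ n₁ with h | h
      · refine reach_up_fst _ h fun j hj hj' h0 => ?_
        have : (j : ℤ) = α := by exact_mod_cast h0
        omega
      · refine reach_down_fst _ h fun j hj hj' h0 => ?_
        have : (p : ℤ) + j + β = 0 := by exact_mod_cast h0
        omega
    · rcases le_total m₂ n₂ with h | h
      · refine reach_up_snd _ h fun j hj hj' h0 => ?_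
        have : (j : ℤ) = β := by exact_mod_cast h0
        omega
      · refine reach_down_snd _ h fun j hj hj' h0 => ?_
        have : (p : ℤ) + j + α = 0 := by exact_mod_cast h0
        omega

lemma isGKSubmodule_kSum_int_iff (hp : 1 < p) {M : Set (ℕ × ℕ)} :
    IsGKSubmodule p ((α + β : ℤ) : ℂ) (α - β) (kSum p ((α + β : ℤ) : ℂ) (α - β) M) ↔
      ∀ m m', BarrierLE p α β m m' → m ∈ M → m' ∈ M := by
  rw [isGKSubmodule_kSum_iff hp, alpha_eq, beta_eq]
  exact ⟨fun h m m' hm => h.reach (reach_iff.2 hm), fun h m m' hs => h m m' hs.barrierLE⟩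

/-- The sets closed under `BarrierLE` are the preimages of lower sets as soon as κ identifies this
preorder with the reverse of the order of P. The constituent at v then has the K-types in the fibre
of v. -/
theorem hasHasseDiagram_of_barrierLE (hp : 1 < p) {P : Type} [PartialOrder P] {κ : ℕ × ℕ → P}
    {F : Set P} (hκ : Function.Surjective κ) (hle : ∀ m m', BarrierLE p α β m m' ↔ κ m' ≤ κ m)
    (hF : ∀ v, (κ ⁻¹' {v}).Finite ↔ v ∈ F) : HasHasseDiagram p α β P κ F := by
  have hGK : ∀ L : LowerSet P, IsGKSubmodule p ((α + β : ℤ) : ℂ) (α - β)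
      (kSum p ((α + β : ℤ) : ℂ) (α - β) (κ ⁻¹' L)) := fun L =>
    (isGKSubmodule_kSum_int_iff hp).2 fun m m' h hm => L.lower ((hle m m').1 h) hm
  let f : LowerSet P ↪o GKSubmodule p ((α + β : ℤ) : ℂ) (α - β) :=
    OrderEmbedding.ofMapLEIff (fun L => ⟨_, hGK L⟩) fun L L' =>
      (kSum_le_kSum_iff hp).trans hκ.preimage_subset_preimage_iff
  have hf : Function.Surjective f := by
    rintro ⟨W, hW⟩
    obtain ⟨M, hM, rfl⟩ := (isGKSubmodule_iff hp).1 hW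
    have hM' := (isGKSubmodule_kSum_int_iff hp).1 hW
    refine ⟨⟨κ '' M, ?_⟩, Subtype.ext (congrArg (kSum p ((α + β : ℤ) : ℂ) (α - β)) ?_)⟩
    · rintro _ v' hv ⟨m, hm, rfl⟩
      obtain ⟨m', rfl⟩ := hκ v'
      exact ⟨m', hM' m m' ((hle m m').2 hv) hm, rfl⟩
    · refine Set.Subset.antisymm ?_ (Set.subset_preimage_image κ M)
      rintro m' ⟨m, hm, h⟩
      exact hM' m m' ((hle m m').2 h.ge) hm
  refine ⟨RelIso.ofSurjective f hf, fun L => kSum_eq _, fun v => ?_⟩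
  have hd : (κ ⁻¹' (LowerSet.Iic v : Set P)) \ (κ ⁻¹' (LowerSet.Iio v : Set P)) = κ ⁻¹' {v} := by
    ext m
    simp only [LowerSet.coe_Iic, LowerSet.coe_Iio, Set.mem_sdiff, Set.mem_preimage, Set.mem_Iic,
      Set.mem_Iio, Set.mem_singleton_iff]
    exact ⟨fun h => h.1.eq_of_not_lt h.2, fun h => ⟨h.le, h.not_lt⟩⟩
  rw [← hF, ← hd]
  exact finiteDimensional_quotient_iff hp (hGK (LowerSet.Iio v))

/-- That the span is nonzero follows from the existence of a K-type on the barrier; that it is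
proper means some K-type is strictly on the negative side. -/
lemma causesReducibility_iff (hp : 1 < p) (A : ℤ → ℤ → ℤ → ℤ → ℤ → ℤ) {v : ℕ × ℕ → ℤ}
    (hv : ∀ m : ℕ × ℕ, A (2 * p) 2 (α + β) (m.1 + m.2) (α - β - m.1 + m.2) = v m) :
    CausesReducibility p α β A ↔ (∃ m, v m = 0) ∧
      (∀ m m', BarrierLE p α β m m' → 0 ≤ v m → 0 ≤ v m') ∧ ∃ m, v m < 0 := by
  unfold CausesReducibility
  simp only [hv]
  have h1 : (⨆ m : ℕ × ℕ, ⨆ _ : 0 ≤ v m, KType p ((α + β : ℤ) : ℂ) (α - β) m) =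
      kSum p ((α + β : ℤ) : ℂ) (α - β) {m | 0 ≤ v m} := (kSum_eq _).symm
  rw [h1, isGKSubmodule_kSum_int_iff hp, ← kSum_univ hp, ← kSum_empty, (kSum_injective hp).ne_iff,
    (kSum_injective hp).ne_iff, Set.ne_univ_iff_exists_notMem, ← Set.nonempty_iff_ne_empty]
  simp only [Set.mem_ofPred_eq, not_le]
  constructor
  · rintro ⟨h1, h2, -, h3⟩
    exact ⟨h1, h2, h3⟩
  · rintro ⟨⟨m, hm⟩, h2, h3⟩
    exact ⟨⟨m, hm⟩, h2, ⟨m, hm.ge⟩, h3⟩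

/-- Restricted to K-types, each of the four functions is twice an integral affine function of a
single degree; here it depends on m₂ only. -/
lemma causesReducibility_App (hp : 1 < p) : CausesReducibility p α β App ↔ 0 ≤ β := by
  rw [causesReducibility_iff hp App (v := fun m => 2 * β - 2 * m.2)
    (fun m => by unfold App; ring)]
  constructor
  · rintro ⟨⟨m, hm⟩, -⟩
    omega
  · intro h
    refine ⟨⟨(0, β.toNat), by dsimp only; omega⟩, fun m m' hm h => ?_, ⟨(0, β.toNat + 1), by
      dsimp only; omega⟩⟩
    obtain ⟨h1, h2, h3, h4⟩ := hm
    omega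

lemma causesReducibility_Apm (hp : 1 < p) : CausesReducibility p α β Apm ↔ 0 ≤ α := by
  rw [causesReducibility_iff hp Apm (v := fun m => 2 * α - 2 * m.1)
    (fun m => by unfold Apm; ring)]
  constructor
  · rintro ⟨⟨m, hm⟩, -⟩
    omega
  · intro h
    refine ⟨⟨(α.toNat, 0), by dsimp only; omega⟩, fun m m' hm h => ?_, ⟨(α.toNat + 1, 0), by
      dsimp only; omega⟩⟩
    obtain ⟨h1, h2, h3, h4⟩ := hm
    omega

/-- For β = 1 - p the line still passes through the K-types with m₁ = 0, but nothing lies on its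
negative side. Properness therefore makes the bound -p, and the witness is (0, 0). -/
lemma causesReducibility_Amp (hp : 1 < p) : CausesReducibility p α β Amp ↔ β ≤ -p := by
  rw [causesReducibility_iff hp Amp (v := fun m => 2 * β + 2 * m.1 + 2 * p - 2)
    (fun m => by unfold Amp; ring)]
  constructor
  · rintro ⟨-, -, m, hm⟩
    omega
  · intro h
    refine ⟨⟨((1 - p - β).toNat, 0), by dsimp only; omega⟩, fun m m' hm h => ?_, ⟨(0, 0), by
      dsimp only; omega⟩⟩
    obtain ⟨h1, h2, h3, h4⟩ := hm
    omega

lemma causesReducibility_Amm (hp : 1 < p) : CausesReducibility p α β Amm ↔ α ≤ -p := by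
  rw [causesReducibility_iff hp Amm (v := fun m => 2 * α + 2 * m.2 + 2 * p - 2)
    (fun m => by unfold Amm; ring)]
  constructor
  · rintro ⟨-, -, m, hm⟩
    omega
  · intro h
    refine ⟨⟨(0, (1 - p - α).toNat), by dsimp only; omega⟩, fun m m' hm h => ?_, ⟨(0, 0), by
      dsimp only; omega⟩⟩
    obtain ⟨h1, h2, h3, h4⟩ := hm
    omega

/-! ### Hasse diagrams, case by case -/

lemma not_finite_of_forall_fst {P : Type} {κ : ℕ × ℕ → P} {v : P} (c N : ℕ)
    (h : ∀ n, κ (N + n, c) = v) : ¬ (κ ⁻¹' {v}).Finite :=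
  Set.infinite_of_injective_forall_mem (f := fun n => (N + n, c)) (fun m n h => by simpa using h) h

lemma not_finite_of_forall_snd {P : Type} {κ : ℕ × ℕ → P} {v : P} (c N : ℕ)
    (h : ∀ n, κ (c, N + n) = v) : ¬ (κ ⁻¹' {v}).Finite :=
  Set.infinite_of_injective_forall_mem (f := fun n => (c, N + n)) (fun m n h => by simpa using h) h

lemma hasHasseDiagram_of_not_finite (hp : 1 < p) {P : Type} [PartialOrder P] {κ : ℕ × ℕ → P}
    (hle : ∀ m m', BarrierLE p α β m m' ↔ κ m' ≤ κ m)
    (hF : ∀ v, ¬ (κ ⁻¹' {v}).Finite) : HasHasseDiagram p α β P κ ∅ :=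
  hasHasseDiagram_of_barrierLE hp (fun v => (Set.Infinite.nonempty (hF v)).imp fun _ h => h) hle
    fun v => iff_of_false (hF v) (Set.notMem_empty v)

lemma hasHasseDiagram_point (hp : 1 < p) (h : -p < α ∧ α < 0 ∧ -p < β ∧ β < 0) :
    HasHasseDiagram p α β Unit (fun _ => ()) ∅ := by
  refine hasHasseDiagram_of_not_finite hp (fun m m' => ?_) fun v =>
    not_finite_of_forall_fst 0 0 fun n => rfl
  simp only [BarrierLE, le_refl, iff_true]
  omega

lemma hasHasseDiagram_alpha_nonneg (hp : 1 < p) (h : 0 ≤ α ∧ -p < β ∧ β < 0) :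
    HasHasseDiagram p α β (Fin 2) (fun m => if m.1 ≤ α then 0 else 1) ∅ := by
  refine hasHasseDiagram_of_not_finite hp (fun m m' => ?_) fun v => ?_
  · unfold BarrierLE
    split_ifs <;> simp <;> omega
  · fin_cases v
    · exact not_finite_of_forall_snd 0 0 fun n => by simp; omega
    · exact not_finite_of_forall_snd (α.toNat + 1) 0 fun n => by simp

lemma hasHasseDiagram_beta_nonneg (hp : 1 < p) (h : -p < α ∧ α < 0 ∧ 0 ≤ β) :
    HasHasseDiagram p α β (Fin 2) (fun m => if m.2 ≤ β then 0 else 1) ∅ := by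
  refine hasHasseDiagram_of_not_finite hp (fun m m' => ?_) fun v => ?_
  · unfold BarrierLE
    split_ifs <;> simp <;> omega
  · fin_cases v
    · exact not_finite_of_forall_fst 0 0 fun n => by simp; omega
    · exact not_finite_of_forall_fst (β.toNat + 1) 0 fun n => by simp

lemma hasHasseDiagram_beta_le (hp : 1 < p) (h : -p < α ∧ α < 0 ∧ β ≤ -p) :
    HasHasseDiagram p α β (Fin 2) (fun m => if 1 - p - β ≤ m.1 then 0 else 1) ∅ := by
  refine hasHasseDiagram_of_not_finite hp (fun m m' => ?_) fun v => ?_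
  · unfold BarrierLE
    split_ifs <;> simp <;> omega
  · fin_cases v
    · exact not_finite_of_forall_snd (1 - p - β).toNat 0 fun n => by simp
    · exact not_finite_of_forall_snd 0 0 fun n => by simp; omega

lemma hasHasseDiagram_alpha_le (hp : 1 < p) (h : α ≤ -p ∧ -p < β ∧ β < 0) :
    HasHasseDiagram p α β (Fin 2) (fun m => if 1 - p - α ≤ m.2 then 0 else 1) ∅ := by
  refine hasHasseDiagram_of_not_finite hp (fun m m' => ?_) fun v => ?_
  · unfold BarrierLE
    split_ifs <;> simp <;> omega
  · fin_cases v
    · exact not_finite_of_forall_fst (1 - p - α).toNat 0 fun n => by simp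
    · exact not_finite_of_forall_fst 0 0 fun n => by simp; omega

/-- The barriers in m₁ and m₂ act independently, which gives the product order. Only the least of
the four regions is bounded in both directions; the others contain a ray of K-types. -/
lemma hasHasseDiagram_nonneg_nonneg (hp : 1 < p) (h : 0 ≤ α ∧ 0 ≤ β) :
    HasHasseDiagram p α β (Fin 2 × Fin 2)
      (fun m => (if m.1 ≤ α then 0 else 1, if m.2 ≤ β then 0 else 1)) {(0, 0)} := by
  refine hasHasseDiagram_of_barrierLE hp ?_ (fun m m' => ?_) ?_
  · rintro ⟨i, j⟩
    refine ⟨(if i = 0 then 0 else α.toNat + 1, if j = 0 then 0 else β.toNat + 1), ?_⟩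
    fin_cases i <;> fin_cases j <;> simp <;> omega
  · unfold BarrierLE
    rw [Prod.mk_le_mk]
    split_ifs <;> simp <;> omega
  · rintro ⟨i, j⟩
    fin_cases i <;> fin_cases j
    · refine iff_of_true (((Set.finite_Iic α.toNat).prod (Set.finite_Iic β.toNat)).subset ?_) (by simp)
      rintro ⟨m₁, m₂⟩ hm
      simp at hm
      simp
      omega
    · refine iff_of_false (not_finite_of_forall_snd 0 (β.toNat + 1) fun n => ?_) (by simp)
      simp; omega
    · refine iff_of_false (not_finite_of_forall_fst 0 (α.toNat + 1) fun n => ?_) (by simp)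
      simp; omega
    · refine iff_of_false (not_finite_of_forall_fst (β.toNat + 1) (α.toNat + 1) fun n => ?_) (by simp)
      simp; omega

lemma hasHasseDiagram_le_le (hp : 1 < p) (h : α ≤ -p ∧ β ≤ -p) :
    HasHasseDiagram p α β (Fin 2 × Fin 2)
      (fun m => (if 1 - p - β ≤ m.1 then 0 else 1, if 1 - p - α ≤ m.2 then 0 else 1)) {(1, 1)} := by
  refine hasHasseDiagram_of_barrierLE hp ?_ (fun m m' => ?_) ?_
  · rintro ⟨i, j⟩
    refine ⟨(if i = 0 then (1 - p - β).toNat else 0, if j = 0 then (1 - p - α).toNat else 0), ?_⟩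
    fin_cases i <;> fin_cases j <;> simp <;> omega
  · unfold BarrierLE
    rw [Prod.mk_le_mk]
    split_ifs <;> simp <;> omega
  · rintro ⟨i, j⟩
    fin_cases i <;> fin_cases j
    · refine iff_of_false (not_finite_of_forall_fst (1 - p - α).toNat (1 - p - β).toNat fun n => ?_)
        (by simp)
      simp; omega
    · refine iff_of_false (not_finite_of_forall_fst 0 (1 - p - β).toNat fun n => ?_) (by simp)
      simp; omega
    · refine iff_of_false (not_finite_of_forall_snd 0 (1 - p - α).toNat fun n => ?_) (by simp)
      simp; omega
    · refine iff_of_true (((Set.finite_Iic (1 - p - β).toNat).prod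
        (Set.finite_Iic (1 - p - α).toNat)).subset ?_) (by simp)
      rintro ⟨m₁, m₂⟩ hm
      simp at hm
      simp
      omega

/-- Both barriers constrain m₁, in opposite directions. The submodules m₁ ≤ α and m₁ ≥ 1 - p - β
overlap exactly when α + β > -p, and the overlap is the least constituent. -/
lemma hasHasseDiagram_bot_fst (hp : 1 < p) (h : 0 ≤ α ∧ β ≤ -p ∧ -p < α + β) :
    HasHasseDiagram p α β (WithBot Two)
      (fun m => if α < m.1 then (Sum.inl () : Two) else
        if m.1 < 1 - p - β then (Sum.inr () : Two) else ⊥) ∅ := by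
  refine hasHasseDiagram_of_not_finite hp (fun m m' => ?_) fun v => ?_
  · unfold BarrierLE
    split_ifs <;> simp <;> omega
  · rcases v with _ | ⟨⟨⟩ | ⟨⟩⟩
    · refine not_finite_of_forall_snd α.toNat 0 fun n => ?_
      rw [if_neg (by simp; omega), if_neg (by simp; omega)]
      rfl
    · refine not_finite_of_forall_snd (α.toNat + 1) 0 fun n => ?_
      rw [if_pos (by simp)]
      rfl
    · refine not_finite_of_forall_snd 0 0 fun n => ?_
      rw [if_neg (by simp; omega), if_pos (by simp; omega)]
      rfl

/-- Here the two submodules are disjoint and leave a gap, which is the greatest constituent. -/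
lemma hasHasseDiagram_top_fst (hp : 1 < p) (h : 0 ≤ α ∧ β ≤ -p ∧ α + β < -p) :
    HasHasseDiagram p α β (WithTop Two)
      (fun m => if m.1 ≤ α then (Sum.inl () : Two) else
        if 1 - p - β ≤ m.1 then (Sum.inr () : Two) else ⊤) ∅ := by
  refine hasHasseDiagram_of_not_finite hp (fun m m' => ?_) fun v => ?_
  · unfold BarrierLE
    split_ifs <;> simp <;> omega
  · rcases v with _ | ⟨⟨⟩ | ⟨⟩⟩
    · refine not_finite_of_forall_snd (α.toNat + 1) 0 fun n => ?_
      rw [if_neg (by simp), if_neg (by simp; omega)]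
      rfl
    · refine not_finite_of_forall_snd 0 0 fun n => ?_
      rw [if_pos (by simp; omega)]
      rfl
    · refine not_finite_of_forall_snd (1 - p - β).toNat 0 fun n => ?_
      rw [if_neg (by simp; omega), if_pos (by simp)]
      rfl

/-- Now 1 - p - β = α + 1, so the two submodules are complementary and the module is their direct
sum. -/
lemma hasHasseDiagram_two_fst (hp : 1 < p) (h : 0 ≤ α ∧ β ≤ -p ∧ α + β = -p) :
    HasHasseDiagram p α β Two (fun m => if m.1 ≤ α then Sum.inl () else Sum.inr ()) ∅ := by
  refine hasHasseDiagram_of_not_finite hp (fun m m' => ?_) fun v => ?_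
  · unfold BarrierLE
    split_ifs <;> simp <;> omega
  · rcases v with ⟨⟩ | ⟨⟩
    · refine not_finite_of_forall_snd 0 0 fun n => ?_
      rw [if_pos (by simp; omega)]
    · refine not_finite_of_forall_snd (α.toNat + 1) 0 fun n => ?_
      rw [if_neg (by simp)]

lemma hasHasseDiagram_bot_snd (hp : 1 < p) (h : α ≤ -p ∧ 0 ≤ β ∧ -p < α + β) :
    HasHasseDiagram p α β (WithBot Two)
      (fun m => if β < m.2 then (Sum.inl () : Two) else
        if m.2 < 1 - p - α then (Sum.inr () : Two) else ⊥) ∅ := by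
  refine hasHasseDiagram_of_not_finite hp (fun m m' => ?_) fun v => ?_
  · unfold BarrierLE
    split_ifs <;> simp <;> omega
  · rcases v with _ | ⟨⟨⟩ | ⟨⟩⟩
    · refine not_finite_of_forall_fst β.toNat 0 fun n => ?_
      rw [if_neg (by simp; omega), if_neg (by simp; omega)]
      rfl
    · refine not_finite_of_forall_fst (β.toNat + 1) 0 fun n => ?_
      rw [if_pos (by simp)]
      rfl
    · refine not_finite_of_forall_fst 0 0 fun n => ?_
      rw [if_neg (by simp; omega), if_pos (by simp; omega)]
      rfl

lemma hasHasseDiagram_top_snd (hp : 1 < p) (h : α ≤ -p ∧ 0 ≤ β ∧ α + β < -p) :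
    HasHasseDiagram p α β (WithTop Two)
      (fun m => if m.2 ≤ β then (Sum.inl () : Two) else
        if 1 - p - α ≤ m.2 then (Sum.inr () : Two) else ⊤) ∅ := by
  refine hasHasseDiagram_of_not_finite hp (fun m m' => ?_) fun v => ?_
  · unfold BarrierLE
    split_ifs <;> simp <;> omega
  · rcases v with _ | ⟨⟨⟩ | ⟨⟩⟩
    · refine not_finite_of_forall_fst (β.toNat + 1) 0 fun n => ?_
      rw [if_neg (by simp), if_neg (by simp; omega)]
      rfl
    · refine not_finite_of_forall_fst 0 0 fun n => ?_
      rw [if_pos (by simp; omega)]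
      rfl
    · refine not_finite_of_forall_fst (1 - p - α).toNat 0 fun n => ?_
      rw [if_neg (by simp; omega), if_pos (by simp)]
      rfl

lemma hasHasseDiagram_two_snd (hp : 1 < p) (h : α ≤ -p ∧ 0 ≤ β ∧ α + β = -p) :
    HasHasseDiagram p α β Two (fun m => if m.2 ≤ β then Sum.inl () else Sum.inr ()) ∅ := by
  refine hasHasseDiagram_of_not_finite hp (fun m m' => ?_) fun v => ?_
  · unfold BarrierLE
    split_ifs <;> simp <;> omega
  · rcases v with ⟨⟩ | ⟨⟩
    · refine not_finite_of_forall_fst 0 0 fun n => ?_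
      rw [if_pos (by simp; omega)]
    · refine not_finite_of_forall_fst (β.toNat + 1) 0 fun n => ?_
      rw [if_neg (by simp)]

end Integral

/-! ### Invariant forms -/

section Unitarity

variable {p : ℕ} {a : ℂ} {k : ℤ}

lemma fischer_eq_mul {m : ℕ × ℕ} {P : Poly p} (hP : P ∈ H p m) (c : ℕ × ℕ → ℝ) (Q : Poly p) :
    fischer p c P Q = c m * fischer p 1 P Q := by
  obtain ⟨h1, h2, -⟩ := mem_H.1 hP
  rw [fischer, fischer, diagForm_apply, diagForm_apply, Finset.mul_sum]
  refine Finset.sum_congr rfl fun s hs => ?_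
  have : bideg s = m := Prod.ext (h1 (mem_support_iff.1 hs)) (h2 (mem_support_iff.1 hs))
  rw [this]
  push_cast
  simp
  ring

lemma fischer_eq_mul' {m : ℕ × ℕ} {Q : Poly p} (hQ : Q ∈ H p m) (c : ℕ × ℕ → ℝ) (P : Poly p) :
    fischer p c P Q = c m * fischer p 1 P Q := by
  rw [fischer_symm, fischer_eq_mul hQ, fischer_symm 1, star_mul', star_star, RCLike.star_def,
    Complex.conj_ofReal]

lemma fischer_eq_zero {m n : ℕ × ℕ} (hmn : m ≠ n) {P Q : Poly p} (hP : P ∈ H p m) (hQ : Q ∈ H p n) :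
    fischer p 1 P Q = 0 := by
  -- Computing one form with weight 1 in bidegree m and 2 elsewhere, once from the side of P and
  -- once from that of Q, shows that the product equals its double.
  have h1 := fischer_eq_mul hP (fun n => if n = m then 1 else 2) Q
  rw [fischer_eq_mul' hQ, if_pos rfl, if_neg hmn.symm] at h1
  push_cast at h1
  linear_combination h1

/-- The correction term of `upZ` is a multiple of |z|², hence orthogonal to the harmonic Q. So
raising is adjoint to differentiation up to the weight. -/
lemma fischer_upZ {m n : ℕ × ℕ} {P Q : Poly p} (hP : P ∈ H p m) (hQ : Q ∈ H p n)
    (c : ℕ × ℕ → ℝ) (j : Fin p) :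
    fischer p c (upZ m j P) Q = c (m.1 + 1, m.2) * fischer p 1 P (pderiv (Sum.inl j) Q) := by
  rw [upZ, map_sub, LinearMap.map_smulₛₗ, LinearMap.sub_apply, LinearMap.smul_apply, fischer_r2_mul,
    (mem_H.1 hQ).2.2, map_zero, smul_zero, sub_zero, fischer_X_mul, fischer_eq_mul hP]
  rfl

lemma fischer_upB {m n : ℕ × ℕ} {P Q : Poly p} (hP : P ∈ H p m) (hQ : Q ∈ H p n)
    (c : ℕ × ℕ → ℝ) (j : Fin p) :
    fischer p c P (upB n j Q) = c (n.1, n.2 + 1) * fischer p 1 (pderiv (Sum.inr j) P) Q := by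
  have h0 : fischer p c P (r2 p * pderiv (Sum.inl j) Q) = 0 := by
    rw [fischer_symm, fischer_r2_mul, (mem_H.1 hP).2.2, map_zero, star_zero]
  rw [upB, map_sub, map_smul, h0, smul_zero, sub_zero, fischer_mul_X, fischer_eq_mul' hQ]
  rfl

/-- The compatibility of a rescaling of the Fischer form with the action of the Lie algebra. -/
structure IsInvariantWeight (p : ℕ) (α β : ℂ) (c : ℕ × ℕ → ℝ) : Prop where
  pos : ∀ m, 0 < c m
  fst : ∀ m₁ m₂ : ℕ, ((m₁ : ℂ) - star α) * c (m₁ + 1, m₂) * (p + m₁ + m₂) = (p + m₁ + β) * c (m₁, m₂)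
  snd : ∀ m₁ m₂ : ℕ, ((m₂ : ℂ) - β) * c (m₁, m₂ + 1) * (p + m₁ + m₂) = (p + m₂ + star α) * c (m₁, m₂)

lemma cast_add_ne_zero (hp : 1 < p) (m₁ m₂ : ℕ) : (p : ℂ) + m₁ + m₂ ≠ 0 := by
  exact_mod_cast (by omega : p + m₁ + m₂ ≠ 0)

/-- The four terms form two pairs, each with a common Fischer product. Such a product is nonzero
only if one of m, n is the neighbour of the other, and there the recursion for c makes the pair
cancel. -/
lemma fischer_boost_skew (hp : 1 < p) {α β : ℂ} {c : ℕ × ℕ → ℝ} (hc : IsInvariantWeight p α β c)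
    {m n : ℕ × ℕ} {P Q : Poly p} (hP : P ∈ H p m) (hQ : Q ∈ H p n) (j : Fin p) :
    fischer p c (((m.1 : ℂ) - α) • upZ m j P -
        (((p : ℂ) + m.1 + m.2 - 1)⁻¹ * (p + m.2 - 1 + α)) • pderiv (Sum.inr j) P) Q +
      fischer p c P (((n.2 : ℂ) - β) • upB n j Q -
        (((p : ℂ) + n.1 + n.2 - 1)⁻¹ * (p + n.1 - 1 + β)) • pderiv (Sum.inl j) Q) = 0 := by
  rw [map_sub, map_sub, LinearMap.map_smulₛₗ, LinearMap.map_smulₛₗ, map_smul, map_smul,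
    LinearMap.sub_apply, LinearMap.smul_apply, LinearMap.smul_apply, fischer_upZ hP hQ,
    fischer_upB hP hQ, fischer_eq_mul hP c (pderiv (Sum.inl j) Q),
    fischer_eq_mul' hQ c (pderiv (Sum.inr j) P)]
  simp only [smul_eq_mul, map_sub, map_mul, map_add, map_inv₀, Complex.conj_natCast, map_one]
  have h1 : ((((m.1 : ℂ) - star α) * c (m.1 + 1, m.2)) -
      ((p : ℂ) + n.1 + n.2 - 1)⁻¹ * (p + n.1 - 1 + β) * c m) *
        fischer p 1 P (pderiv (Sum.inl j) Q) = 0 := by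
    obtain ⟨n₁, n₂⟩ := n
    obtain ⟨m₁, m₂⟩ := m
    rcases n₁ with _ | n₁
    · rw [pderiv_inl_of_zero hQ, map_zero, mul_zero]
    · by_cases h : ((m₁, m₂) : ℕ × ℕ) = (n₁, n₂)
      · obtain ⟨rfl, rfl⟩ := Prod.mk.inj h
        have h0 := cast_add_ne_zero hp m₁ m₂
        have hf := hc.fst m₁ m₂
        have e : (p : ℂ) + ((m₁ + 1 : ℕ) : ℂ) + m₂ - 1 = p + m₁ + m₂ := by push_cast; ring
        dsimp only
        rw [e]
        refine mul_eq_zero_of_left ?_ _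
        field_simp
        push_cast
        linear_combination hf
      · rw [fischer_eq_zero h hP (pderiv_inl_mem hQ j), mul_zero]
  have h2 : (((n.2 : ℂ) - β) * c (n.1, n.2 + 1) -
      ((p : ℂ) + m.1 + m.2 - 1)⁻¹ * (p + m.2 - 1 + star α) * c n) *
        fischer p 1 (pderiv (Sum.inr j) P) Q = 0 := by
    obtain ⟨n₁, n₂⟩ := n
    obtain ⟨m₁, m₂⟩ := m
    rcases m₂ with _ | m₂
    · rw [pderiv_inr_of_zero hP, map_zero, LinearMap.zero_apply, mul_zero]
    · by_cases h : ((m₁, m₂) : ℕ × ℕ) = (n₁, n₂)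
      · obtain ⟨rfl, rfl⟩ := Prod.mk.inj h
        have h0 := cast_add_ne_zero hp m₁ m₂
        have hf := hc.snd m₁ m₂
        have e : (p : ℂ) + m₁ + ((m₂ + 1 : ℕ) : ℂ) - 1 = p + m₁ + m₂ := by push_cast; ring
        dsimp only
        rw [e]
        refine mul_eq_zero_of_left ?_ _
        field_simp
        push_cast
        linear_combination hf
      · rw [fischer_eq_zero h (pderiv_inr_mem hP j) hQ, mul_zero]
  simp only [RCLike.star_def] at h1 h2
  linear_combination h1 + h2

lemma harmonic_induction {E : Poly p → Poly p → ℂ} (hl : ∀ P P' Q, E (P + P') Q = E P Q + E P' Q)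
    (hr : ∀ P Q Q', E P (Q + Q') = E P Q + E P Q')
    (h : ∀ m n, ∀ P ∈ H p m, ∀ Q ∈ H p n, E P Q = 0) :
    ∀ P ∈ Harmonic p, ∀ Q ∈ Harmonic p, E P Q = 0 := by
  have h0l : ∀ Q, E 0 Q = 0 := fun Q => by simpa using hl 0 0 Q
  have h0r : ∀ P, E P 0 = 0 := fun P => by simpa using hr P 0 0
  intro P hP Q hQ
  refine Submodule.iSup_induction _ (motive := fun P => E P Q = 0) hP (fun m P hP => ?_) (h0l Q)
    fun P P' h1 h2 => by rw [hl, h1, h2, add_zero]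
  exact Submodule.iSup_induction _ (motive := fun Q => E P Q = 0) hQ (fun n Q hQ => h m n P hP Q hQ)
    (h0r P) fun Q Q' h1 h2 => by rw [hr, h1, h2, add_zero]

lemma rot_mem_harmonic (i j : Fin p) {P : Poly p} (hP : P ∈ Harmonic p) : rot i j P ∈ Harmonic p := by
  refine Submodule.iSup_induction _ (motive := fun P => rot i j P ∈ Harmonic p) hP
    (fun m P hP => H_le_harmonic m (rot_mem hP i j)) ?_ fun P P' h1 h2 => ?_
  · rw [map_zero]; exact zero_mem _
  · rw [map_add]; exact add_mem h1 h2

lemma subst_mem_harmonic {v : Matrix (Fin p) (Fin p) ℂ} (hv : v ∈ Matrix.unitaryGroup (Fin p) ℂ)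
    {P : Poly p} (hP : P ∈ Harmonic p) : subst v P ∈ Harmonic p := by
  refine Submodule.iSup_induction _ (motive := fun P => subst v P ∈ Harmonic p) hP
    (fun m P hP => H_le_harmonic m (subst_mem hv hP)) ?_ fun P P' h1 h2 => ?_
  · rw [map_zero]; exact zero_mem _
  · rw [map_add]; exact add_mem h1 h2

lemma uLie_relations {A : Matrix (Idx p) (Idx p) ℂ} (hA : A ∈ uLie p) :
    (∀ j, A (Sum.inl j) (Sum.inr ()) = star (A (Sum.inr ()) (Sum.inl j))) ∧
      star (A (Sum.inr ()) (Sum.inr ())) = -A (Sum.inr ()) (Sum.inr ()) ∧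
      ∀ i j, star (A (Sum.inl i) (Sum.inl j)) = -A (Sum.inl j) (Sum.inl i) := by
  rw [mem_uLie_iff] at hA
  refine ⟨fun j => ?_, ?_, fun i j => ?_⟩
  · have := hA (Sum.inl j) (Sum.inr ())
    simp only [gram, diagonal_apply_eq, Sum.elim_inr, Sum.elim_inl] at this
    linear_combination this
  · have := hA (Sum.inr ()) (Sum.inr ())
    simp only [gram, diagonal_apply_eq, Sum.elim_inr] at this
    linear_combination -this
  · have := hA (Sum.inl j) (Sum.inl i)
    simp only [gram, diagonal_apply_eq, Sum.elim_inl] at this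
    linear_combination this

/-- A form for which the boosts and rotations have the right adjoints is invariant under the
Lie algebra. -/
lemma lieOp_skew {E : Poly p →ₗ⋆[ℂ] Poly p →ₗ[ℂ] ℂ} {P Q : Poly p}
    (hb : ∀ j, E (boostZ ((a + k) / 2) j P) Q + E P (boostB ((a - k) / 2) j Q) = 0)
    (hb' : ∀ j, E (boostB ((a - k) / 2) j P) Q + E P (boostZ ((a + k) / 2) j Q) = 0)
    (hr : ∀ i j, E (rot i j P) Q = E P (rot j i Q))
    {A : Matrix (Idx p) (Idx p) ℂ} (hA : A ∈ uLie p) :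
    E (lieOp a k A P) Q + E P (lieOp a k A Q) = 0 := by
  obtain ⟨h1, h2, h3⟩ := uLie_relations hA
  have he : E (eulerZ p P - eulerB p P) Q = E P (eulerZ p Q - eulerB p Q) := by
    rw [← sum_rot_self, ← sum_rot_self, map_sum, map_sum, LinearMap.sum_apply]
    exact Finset.sum_congr rfl fun i _ => hr i i
  rw [map_sub, LinearMap.sub_apply, map_sub] at he
  simp only [lieOp_apply, map_add, map_sub, map_sum, LinearMap.map_smulₛₗ, LinearMap.add_apply,
    LinearMap.sub_apply, LinearMap.sum_apply, LinearMap.smul_apply, smul_eq_mul, RingHom.id_apply,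
    ← RCLike.star_def, h1, h2, h3, star_star]
  have e1 : ∑ j, star (A (Sum.inr ()) (Sum.inl j)) * E (boostZ ((a + k) / 2) j P) Q =
      -∑ j, star (A (Sum.inr ()) (Sum.inl j)) * E P (boostB ((a - k) / 2) j Q) := by
    rw [← Finset.sum_neg_distrib]
    refine Finset.sum_congr rfl fun j _ => ?_
    linear_combination star (A (Sum.inr ()) (Sum.inl j)) * hb j
  have e2 : ∑ j, A (Sum.inr ()) (Sum.inl j) * E (boostB ((a - k) / 2) j P) Q =
      -∑ j, A (Sum.inr ()) (Sum.inl j) * E P (boostZ ((a + k) / 2) j Q) := by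
    rw [← Finset.sum_neg_distrib]
    refine Finset.sum_congr rfl fun j _ => ?_
    linear_combination A (Sum.inr ()) (Sum.inl j) * hb' j
  have e3 : ∑ i, ∑ j, -A (Sum.inl j) (Sum.inl i) * E (rot j i P) Q =
      -∑ i, ∑ j, A (Sum.inl i) (Sum.inl j) * E P (rot j i Q) := by
    rw [Finset.sum_comm, ← Finset.sum_neg_distrib]
    refine Finset.sum_congr rfl fun i _ => ?_
    rw [← Finset.sum_neg_distrib]
    refine Finset.sum_congr rfl fun j _ => ?_
    rw [hr]
    ring
  have e4 : star (k : ℂ) = k := by simp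
  rw [e1, e2, e3, e4]
  linear_combination -A (Sum.inr ()) (Sum.inr ()) * he

theorem isUnitary_of_isInvariantWeight (hp : 1 < p) {c : ℕ × ℕ → ℝ}
    (hc : IsInvariantWeight p ((a + k) / 2) ((a - k) / 2) c) : IsUnitary p a k := by
  have hker : LinearMap.ker (Phi p a k ∘ₗ (Harmonic p).subtype) = ⊥ := by
    rw [LinearMap.ker_eq_bot']
    rintro ⟨P, hP⟩ h
    exact Subtype.ext (eq_zero_of_Phi_eq_zero hp hP h)
  -- A left inverse of `Phi` on harmonic polynomials, arbitrary elsewhere, carries the weighted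
  -- Fischer form to all functions.
  obtain ⟨g, hg⟩ := LinearMap.exists_leftInverse_of_injective _ hker
  set π : (X0 p → ℂ) →ₗ[ℂ] Poly p := (Harmonic p).subtype ∘ₗ g
  have hπ : ∀ P ∈ Harmonic p, π (Phi p a k P) = P := fun P hP =>
    congrArg Subtype.val (LinearMap.congr_fun hg ⟨P, hP⟩)
  let B : (X0 p → ℂ) →ₗ⋆[ℂ] (X0 p → ℂ) →ₗ[ℂ] ℂ :=
    LinearMap.mk₂'ₛₗ (starRingEnd ℂ) (RingHom.id ℂ) (fun f g => fischer p c (π f) (π g))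
      (fun f f' g => by simp) (fun c f g => by simp) (fun f g g' => by simp) (fun c f g => by simp)
  have hB : ∀ f h, B f h = fischer p c (π f) (π h) := fun _ _ => rfl
  have hBP : ∀ P ∈ Harmonic p, ∀ Q ∈ Harmonic p, B (Phi p a k P) (Phi p a k Q) = fischer p c P Q :=
    fun P hP Q hQ => by rw [hB, hπ P hP, hπ Q hQ]
  have hBs : ∀ f h, B h f = star (B f h) := fun f h => fischer_symm _ _ _
  refine ⟨B, fun f _ h _ => hBs f h, ?_, ?_, ?_⟩
  · intro f hf h0
    rw [HC_eq hp] at hf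
    obtain ⟨P, hP, rfl⟩ := hf
    rw [hBP P hP P hP]
    exact fischer_self_pos hc.pos fun h => h0 (by rw [h, map_zero])
  · intro g hg f hf h hh
    rw [HC_eq hp] at hf hh
    obtain ⟨P, hP, rfl⟩ := hf
    obtain ⟨Q, hQ, rfl⟩ := hh
    obtain ⟨t, v, ht, hv, hx⟩ := hg.entries
    rw [rho_Phi ht hx, rho_Phi ht hx, map_smul, LinearMap.map_smulₛₗ, LinearMap.smul_apply,
      hBP _ (subst_mem_harmonic hv hP) _ (subst_mem_harmonic hv hQ), fischer_subst hv, hBP P hP Q hQ,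
      smul_smul, Complex.mul_conj', norm_psi ht]
    simp
  · intro A f hf h hh
    rw [HC_eq hp] at hf hh
    obtain ⟨P, hP, rfl⟩ := hf
    obtain ⟨Q, hQ, rfl⟩ := hh
    rw [dRho_Phi, dRho_Phi]
    let E : Poly p →ₗ⋆[ℂ] Poly p →ₗ[ℂ] ℂ :=
      LinearMap.mk₂'ₛₗ (starRingEnd ℂ) (RingHom.id ℂ) (fun P Q => B (Phi p a k P) (Phi p a k Q))
        (fun f f' g => by simp) (fun c f g => by simp) (fun f g g' => by simp) (fun c f g => by simp)
    have hE : ∀ P Q, E P Q = B (Phi p a k P) (Phi p a k Q) := fun _ _ => rfl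
    have hEs : ∀ P Q, E Q P = star (E P Q) := fun P Q => hBs _ _
    have hb : ∀ j, ∀ P ∈ Harmonic p, ∀ Q ∈ Harmonic p,
        E (boostZ ((a + k) / 2) j P) Q + E P (boostB ((a - k) / 2) j Q) = 0 := by
      intro j
      refine harmonic_induction (fun P P' Q => ?_) (fun P Q Q' => ?_) fun m n P hP Q hQ => ?_
      · simp only [map_add, LinearMap.add_apply]; ring
      · simp only [map_add]; ring
      · have h := fischer_boost_skew hp hc hP hQ j
        rw [hE, hE, Phi_boostZ hp hP, Phi_boostB hp hQ]
        simp only [← map_smul, ← map_sub]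
        rwa [hBP _ _ _ (H_le_harmonic n hQ), hBP _ (H_le_harmonic m hP)]
        · exact sub_mem (Submodule.smul_mem _ _ (H_le_harmonic _ (upB_mem hp hQ j)))
            (Submodule.smul_mem _ _ (Phi_pderiv_inl_mem hQ j))
        · exact sub_mem (Submodule.smul_mem _ _ (H_le_harmonic _ (upZ_mem hp hP j)))
            (Submodule.smul_mem _ _ (Phi_pderiv_inr_mem hP j))
    refine lieOp_skew (E := E) (fun j => hb j P hP Q hQ) (fun j => ?_) (fun i j => ?_) A.2
    -- The second skewness relation is the conjugate of the first with P and Q exchanged.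
    · have := congrArg star (hb j Q hQ P hP)
      rw [star_add, ← hEs, ← hEs, star_zero, add_comm] at this
      exact this
    · rw [hE, hE, hBP _ (rot_mem_harmonic i j hP) _ hQ, hBP _ hP _ (rot_mem_harmonic j i hQ),
        fischer_rot]

end Unitarity

/-! ### The unitary axis and the complementary series -/

section Series

variable {p : ℕ} {a : ℂ} {k : ℤ}

/-- The weight on the unitary axis. -/
def axisWeight (p : ℕ) (m : ℕ × ℕ) : ℝ := ∏ j ∈ Finset.range (m.1 + m.2), ((p : ℝ) + j)⁻¹

lemma axisWeight_pos (hp : 1 < p) (m : ℕ × ℕ) : 0 < axisWeight p m :=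
  Finset.prod_pos fun j _ => by positivity

lemma axisWeight_succ_fst (hp : 1 < p) (m₁ m₂ : ℕ) :
    axisWeight p (m₁ + 1, m₂) * (p + m₁ + m₂) = axisWeight p (m₁, m₂) := by
  have h : (p : ℝ) + m₁ + m₂ ≠ 0 := by positivity
  rw [axisWeight, axisWeight, show m₁ + 1 + m₂ = m₁ + m₂ + 1 by ring, Finset.prod_range_succ]
  push_cast
  rw [← add_assoc]
  field_simp

lemma axisWeight_succ_snd (hp : 1 < p) (m₁ m₂ : ℕ) :
    axisWeight p (m₁, m₂ + 1) * (p + m₁ + m₂) = axisWeight p (m₁, m₂) := by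
  have h : (p : ℝ) + m₁ + m₂ ≠ 0 := by positivity
  rw [axisWeight, axisWeight, show m₁ + (m₂ + 1) = m₁ + m₂ + 1 by ring, Finset.prod_range_succ]
  push_cast
  rw [← add_assoc]
  field_simp

/-- On the axis the conjugate of α is -p - β. The parameters then enter both sides of each recursion
through the same factor, and only division by p + m₁ + m₂ remains. -/
theorem isUnitary_of_re_eq (hp : 1 < p) (ha : a.re = -p) : IsUnitary p a k := by
  have hstar : star a = -2 * p - a := by
    refine Complex.ext ?_ ?_
    · simp [ha]; ring
    · simp
  have h1 : star ((a + k) / 2) = -p - (a - k) / 2 := by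
    rw [star_div₀, star_add, hstar]
    simp
    ring
  refine isUnitary_of_isInvariantWeight hp ⟨axisWeight_pos hp, fun m₁ m₂ => ?_, fun m₁ m₂ => ?_⟩
  · have := congrArg (fun r : ℝ => (r : ℂ)) (axisWeight_succ_fst hp m₁ m₂)
    push_cast at this
    rw [h1]
    linear_combination ((p : ℂ) + m₁ + (a - k) / 2) * this
  · have := congrArg (fun r : ℝ => (r : ℂ)) (axisWeight_succ_snd hp m₁ m₂)
    push_cast at this
    rw [h1]
    linear_combination (m₂ - (a - k) / 2) * this

/-- Apart from `axisWeight`, which depends on m₁ + m₂, the two recursions concern separate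
coordinates, so a product solves both. All its factors are positive for parameters between -p and 0.
-/
theorem isUnitary_of_mem_Ioo (hp : 1 < p) {α β : ℝ} (hα : (a + k) / 2 = α) (hβ : (a - k) / 2 = β)
    (h1 : -p < α) (h2 : α < 0) (h3 : -p < β) (h4 : β < 0) : IsUnitary p a k := by
  let c : ℕ × ℕ → ℝ := fun m => axisWeight p m *
    ((∏ j ∈ Finset.range m.1, (p + j + β) / (j - α)) * ∏ j ∈ Finset.range m.2, (p + j + α) / (j - β))
  have hn : ∀ (j : ℕ) (x : ℝ), x < 0 → 0 < j - x := fun j x hx => by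
    have : (0 : ℝ) ≤ j := j.cast_nonneg
    linarith
  have hn' : ∀ (j : ℕ) (x : ℝ), -p < x → 0 < p + j + x := fun j x hx => by
    have : (0 : ℝ) ≤ j := j.cast_nonneg
    linarith
  refine isUnitary_of_isInvariantWeight hp (c := c) ⟨fun m => ?_, fun m₁ m₂ => ?_, fun m₁ m₂ => ?_⟩
  · exact mul_pos (axisWeight_pos hp m) (mul_pos
      (Finset.prod_pos fun j _ => div_pos (hn' j β h3) (hn j α h2))
      (Finset.prod_pos fun j _ => div_pos (hn' j α h1) (hn j β h4)))
  · have h0 := (hn m₁ α h2).ne'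
    have : (m₁ - α) * c (m₁ + 1, m₂) * (p + m₁ + m₂) = (p + m₁ + β) * c (m₁, m₂) := by
      simp only [c, ← axisWeight_succ_fst hp m₁ m₂, Finset.prod_range_succ]
      field_simp
    rw [hα, hβ, RCLike.star_def, Complex.conj_ofReal]
    exact_mod_cast this
  · have h0 := (hn m₂ β h4).ne'
    have : (m₂ - β) * c (m₁, m₂ + 1) * (p + m₁ + m₂) = (p + m₂ + α) * c (m₁, m₂) := by
      simp only [c, ← axisWeight_succ_snd hp m₁ m₂, Finset.prod_range_succ]
      field_simp
    rw [hα, hβ, RCLike.star_def, Complex.conj_ofReal]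
    exact_mod_cast this

theorem isIrred_of_mem_Ioo (hp : 1 < p) {α β : ℝ} (hα : (a + k) / 2 = α) (hβ : (a - k) / 2 = β)
    (h1 : -p < α) (h2 : α < 0) (h3 : -p < β) (h4 : β < 0) : IsIrred p a k := by
  have hn : ∀ (j : ℕ) (x : ℝ), x < 0 → (j : ℂ) ≠ x := fun j x hx h => by
    have h' : (j : ℝ) = x := by exact_mod_cast h
    have : (0 : ℝ) ≤ j := j.cast_nonneg
    linarith
  have hn' : ∀ (j : ℕ) (x : ℝ), -p < x → (p : ℂ) + j + x ≠ 0 := fun j x hx h => by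
    have h' : (p : ℝ) + j + x = 0 := by exact_mod_cast h
    have : (0 : ℝ) ≤ j := j.cast_nonneg
    linarith
  refine isIrred_of_reach hp ?_
  rw [hα, hβ]
  rintro ⟨m₁, m₂⟩ ⟨n₁, n₂⟩
  refine Relation.ReflTransGen.trans (b := (n₁, m₂)) ?_ ?_
  · rcases le_total m₁ n₁ with h | h
    · exact reach_up_fst _ h fun j _ _ => hn j α h2
    · exact reach_down_fst _ h fun j _ _ => hn' j β h3
  · rcases le_total m₂ n₂ with h | h
    · exact reach_up_snd _ h fun j _ _ => hn j β h4
    · exact reach_down_snd _ h fun j _ _ => hn' j α h1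

lemma X_inl_mem (i : Fin p) : (X (Sum.inl i) : Poly p) ∈ H p (1, 0) :=
  mem_H.2 ⟨isWeightedHomogeneous_X _ _ _, isWeightedHomogeneous_X _ _ _, by
    rw [lap_apply]
    exact Finset.sum_eq_zero fun j _ => by rw [pderiv_X_of_ne (by simp), map_zero]⟩

lemma X_inr_mem (i : Fin p) : (X (Sum.inr i) : Poly p) ∈ H p (0, 1) :=
  mem_H.2 ⟨isWeightedHomogeneous_X _ _ _, isWeightedHomogeneous_X _ _ _, by
    rw [lap_apply]
    exact Finset.sum_eq_zero fun j _ => by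
      rw [pderiv_comm', pderiv_X_of_ne (by simp), map_zero]⟩

lemma one_mem_H : (1 : Poly p) ∈ H p (0, 0) :=
  mem_H.2 ⟨isWeightedHomogeneous_one _ _, isWeightedHomogeneous_one _ _, by simp [lap_apply]⟩

lemma boostZ_one (α : ℂ) (j : Fin p) : boostZ α j 1 = -α • X (Sum.inl j) := by
  rw [boostZ_apply, eulerZ_of_mem (mem_H.1 one_mem_H).1]
  simp

lemma boostB_one (β : ℂ) (j : Fin p) : boostB β j 1 = -β • X (Sum.inr j) := by
  rw [boostB_apply, eulerB_of_mem (mem_H.1 one_mem_H).2.1]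
  simp

/-- The sum over j is -β|z|² - p before restriction, and |z|² acts as 1. Summing removes the
component outside the trivial polynomial. -/
lemma Phi_sum_boostB_X (β : ℂ) :
    Phi p a k (∑ j, boostB β j (X (Sum.inl j))) = -(p + β) • Phi p a k 1 := by
  have h : ∑ j : Fin p, boostB β j (X (Sum.inl j)) = (-β) • (r2 p * 1) - (p : ℂ) • 1 := by
    rw [mul_one, r2, Finset.smul_sum, show ((p : ℂ) • (1 : Poly p)) = ∑ _j : Fin p, 1 by
      simp [smul_eq_C_mul], ← Finset.sum_sub_distrib]
    refine Finset.sum_congr rfl fun j _ => ?_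
    rw [boostB_apply, eulerB_of_mem (mem_H.1 (X_inl_mem j)).2.1, pderiv_X_self]
    simp [mul_comm]
  rw [h, map_sub, map_smul, map_smul, Phi_r2_mul]
  module

lemma Phi_sum_boostZ_X (α : ℂ) :
    Phi p a k (∑ j, boostZ α j (X (Sum.inr j))) = -(p + α) • Phi p a k 1 := by
  have h : ∑ j : Fin p, boostZ α j (X (Sum.inr j)) = (-α) • (r2 p * 1) - (p : ℂ) • 1 := by
    rw [mul_one, r2, Finset.smul_sum, show ((p : ℂ) • (1 : Poly p)) = ∑ _j : Fin p, 1 by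
      simp [smul_eq_C_mul], ← Finset.sum_sub_distrib]
    refine Finset.sum_congr rfl fun j _ => ?_
    rw [boostZ_apply, eulerZ_of_mem (mem_H.1 (X_inr_mem j)).1, pderiv_X_self]
    simp
  rw [h, map_sub, map_smul, map_smul, Phi_r2_mul]
  module

/-- The boosts `boostZ` and `boostB` come from conjugate elements of the complexified Lie algebra,
so skewness on the real form makes each minus the adjoint of the other. -/
lemma boost_skew {B : (X0 p → ℂ) →ₗ⋆[ℂ] (X0 p → ℂ) →ₗ[ℂ] ℂ}
    (hB : ∀ A : uLie p, ∀ f ∈ HC p a k, ∀ h ∈ HC p a k, B (dRho A f) h + B f (dRho A h) = 0)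
    {P Q : Poly p} (hP : Phi p a k P ∈ HC p a k) (hQ : Phi p a k Q ∈ HC p a k) (j : Fin p) :
    B (Phi p a k (boostZ ((a + k) / 2) j P)) (Phi p a k Q) +
        B (Phi p a k P) (Phi p a k (boostB ((a - k) / 2) j Q)) = 0 ∧
      B (Phi p a k (boostB ((a - k) / 2) j P)) (Phi p a k Q) +
        B (Phi p a k P) (Phi p a k (boostZ ((a + k) / 2) j Q)) = 0 := by
  have h1 := hB ⟨_, single_add_single_mem_uLie j⟩ _ hP _ hQ
  have h2 := hB ⟨_, I_smul_single_sub_single_mem_uLie j⟩ _ hP _ hQ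
  rw [dRho_Phi, dRho_Phi] at h1 h2
  rw [boostZ_eq_lieOp, boostB_eq_lieOp, boostZ_eq_lieOp, boostB_eq_lieOp]
  simp only [map_add, map_sub, map_smul, LinearMap.map_smulₛₗ, LinearMap.add_apply,
    LinearMap.sub_apply, LinearMap.smul_apply, smul_eq_mul, map_div₀, map_one, Complex.conj_I,
    map_ofNat]
  constructor
  · linear_combination (1 / 2 : ℂ) * h1 - Complex.I / 2 * h2
  · linear_combination (1 / 2 : ℂ) * h1 + Complex.I / 2 * h2

lemma Phi_mem_HC (hp : 1 < p) (P : Poly p) : Phi p a k P ∈ HC p a k := by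
  rw [HC_eq hp]
  exact Phi_mem_map_harmonic hp P

lemma Phi_ne_zero (hp : 1 < p) {m : ℕ × ℕ} {P : Poly p} (hP : P ∈ H p m) (h0 : P ≠ 0) :
    Phi p a k P ≠ 0 := fun h => h0 (eq_zero_of_Phi_eq_zero hp (H_le_harmonic m hP) h)

/-- Necessary conditions for unitarity, from the `K`-types next to the trivial one. -/
lemma IsUnitary.exists_pos (hp : 1 < p) {α β : ℝ} (hα : (a + k) / 2 = α) (hβ : (a - k) / 2 = β)
    (h : IsUnitary p a k) : ∃ b s t : ℝ, 0 < b ∧ 0 < s ∧ 0 < t ∧ -α * s = (p + β) * b ∧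
      -β * t = (p + α) * b := by
  obtain ⟨B, -, hpos, -, hB⟩ := h
  have : Nonempty (Fin p) := ⟨⟨0, by omega⟩⟩
  have hS : ∀ P, Phi p a k P ∈ HC p a k := Phi_mem_HC hp
  refine ⟨(B (Phi p a k 1) (Phi p a k 1)).re,
    ∑ j, (B (Phi p a k (X (Sum.inl j))) (Phi p a k (X (Sum.inl j)))).re,
    ∑ j, (B (Phi p a k (X (Sum.inr j))) (Phi p a k (X (Sum.inr j)))).re,
    hpos _ (hS _) (Phi_ne_zero hp one_mem_H one_ne_zero),
    Finset.sum_pos (fun j _ => hpos _ (hS _) (Phi_ne_zero hp (X_inl_mem j) (X_ne_zero _)))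
      Finset.univ_nonempty,
    Finset.sum_pos (fun j _ => hpos _ (hS _) (Phi_ne_zero hp (X_inr_mem j) (X_ne_zero _)))
      Finset.univ_nonempty, ?_, ?_⟩
  -- Skewness between 1 and z_j, summed over j: one boost sends 1 to -α z_j, the other brings the
  -- z_j back to -(p + β) times 1.
  · have h1 : ∑ j : Fin p, (B (Phi p a k (boostZ ((a + k) / 2) j 1)) (Phi p a k (X (Sum.inl j))) +
        B (Phi p a k 1) (Phi p a k (boostB ((a - k) / 2) j (X (Sum.inl j))))) = 0 :=
      Finset.sum_eq_zero fun j _ => (boost_skew hB (hS 1) (hS _) j).1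
    rw [Finset.sum_add_distrib, ← map_sum, ← map_sum, Phi_sum_boostB_X, map_smul, hα, hβ] at h1
    simp only [boostZ_one, map_smul, LinearMap.map_smulₛₗ, LinearMap.smul_apply, smul_eq_mul,
      ← Finset.mul_sum, map_neg, Complex.conj_ofReal] at h1
    have h2 := congrArg Complex.re h1
    rw [← Complex.ofReal_neg, ← Complex.ofReal_natCast, ← Complex.ofReal_add, ← Complex.ofReal_neg,
      Complex.add_re, Complex.re_ofReal_mul, Complex.re_ofReal_mul, Complex.re_sum] at h2
    simp only [Complex.zero_re] at h2
    linarith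
  · have h1 : ∑ j : Fin p, (B (Phi p a k (boostB ((a - k) / 2) j 1)) (Phi p a k (X (Sum.inr j))) +
        B (Phi p a k 1) (Phi p a k (boostZ ((a + k) / 2) j (X (Sum.inr j))))) = 0 :=
      Finset.sum_eq_zero fun j _ => (boost_skew hB (hS 1) (hS _) j).2
    rw [Finset.sum_add_distrib, ← map_sum, ← map_sum, Phi_sum_boostZ_X, map_smul, hα, hβ] at h1
    simp only [boostB_one, map_smul, LinearMap.map_smulₛₗ, LinearMap.smul_apply, smul_eq_mul,
      ← Finset.mul_sum, map_neg, Complex.conj_ofReal] at h1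
    have h2 := congrArg Complex.re h1
    rw [← Complex.ofReal_neg, ← Complex.ofReal_natCast, ← Complex.ofReal_add, ← Complex.ofReal_neg,
      Complex.add_re, Complex.re_ofReal_mul, Complex.re_ofReal_mul, Complex.re_sum] at h2
    simp only [Complex.zero_re] at h2
    linarith

/-- The relations give -α and p + β the same sign, and -β and p + α as well. If α ≥ 0 then β ≤ -p,
so α - β ≥ p, which is excluded; the case β ≥ 0 is symmetric. -/
lemma IsUnitary.mem_Ioo (hp : 1 < p) {α β : ℝ} (hα : (a + k) / 2 = α) (hβ : (a - k) / 2 = β)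
    (hαβ : |α - β| < p) (h : IsUnitary p a k) : (-p < α ∧ α < 0) ∧ -p < β ∧ β < 0 := by
  obtain ⟨b, s, t, hb, hs, ht, h1, h2⟩ := h.exists_pos hp hα hβ
  rw [abs_lt] at hαβ
  have e1 : α < 0 := by
    by_contra! h0
    have : 0 < p + β := by linarith
    nlinarith [mul_pos this hb, mul_nonneg h0 hs.le]
  have e2 : β < 0 := by
    by_contra! h0
    have : 0 < p + α := by linarith
    nlinarith [mul_pos this hb, mul_nonneg h0 ht.le]
  have e3 : 0 < p + β := by
    by_contra! h0
    nlinarith [mul_nonneg (neg_nonneg.2 h0) hb.le, mul_pos (neg_pos.2 e1) hs]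
  have e4 : 0 < p + α := by
    by_contra! h0
    nlinarith [mul_nonneg (neg_nonneg.2 h0) hb.le, mul_pos (neg_pos.2 e2) ht]
  exact ⟨⟨by linarith, e1⟩, by linarith, e2⟩

/-- The diamond around the unitary axis in the (a, k)-plane is the open square -p < α, β < 0 in the
coordinates α, β. -/
lemma abs_add_lt_iff (a k : ℝ) (p : ℕ) : |a + p| < p - |k| ↔
    (-p < (a + k) / 2 ∧ (a + k) / 2 < 0) ∧ -p < (a - k) / 2 ∧ (a - k) / 2 < 0 := by
  rw [abs_lt]
  rcases abs_cases k with ⟨h, hk⟩ | ⟨h, hk⟩ <;> rw [h] <;> constructor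
  · rintro ⟨h1, h2⟩
    exact ⟨⟨by linarith, by linarith⟩, by linarith, by linarith⟩
  · rintro ⟨⟨h1, h2⟩, h3, h4⟩
    exact ⟨by linarith, by linarith⟩
  · rintro ⟨h1, h2⟩
    exact ⟨⟨by linarith, by linarith⟩, by linarith, by linarith⟩
  · rintro ⟨⟨h1, h2⟩, h3, h4⟩
    exact ⟨by linarith, by linarith⟩

theorem complementary_series (hp : 1 < p) (k : ℤ) (hk : |k| < p) (a : ℝ) :
    (IsUnitary p a k ↔ |a + p| < p - |k|) ∧ (|a + p| < p - |k| → IsIrred p a k) := by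
  have hα : ((a : ℂ) + k) / 2 = (((a + k) / 2 : ℝ) : ℂ) := by push_cast; rfl
  have hβ : ((a : ℂ) - k) / 2 = (((a - k) / 2 : ℝ) : ℂ) := by push_cast; rfl
  have hk' : |(a + k) / 2 - (a - k) / 2| < (p : ℝ) := by
    rw [show (a + k) / 2 - (a - k) / 2 = (k : ℝ) by ring]
    exact_mod_cast hk
  push_cast
  rw [abs_add_lt_iff]
  exact ⟨⟨fun h => h.mem_Ioo hp hα hβ hk', fun h =>
    isUnitary_of_mem_Ioo hp hα hβ h.1.1 h.1.2 h.2.1 h.2.2⟩, fun h =>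
    isIrred_of_mem_Ioo hp hα hβ h.1.1 h.1.2 h.2.1 h.2.2⟩

/-! ### The constant functions -/

lemma Phi_one : Phi p 0 0 1 = 1 := by
  ext x
  rw [Phi_apply]
  simp [psi]

lemma H_zero : H p (0, 0) = Submodule.span ℂ {1} := by
  refine le_antisymm (fun P hP => ?_) ((Submodule.span_singleton_le_iff_mem _ _).2 one_mem_H)
  obtain ⟨h1, h2, -⟩ := mem_H.1 hP
  have hP0 : P = C (coeff 0 P) := by
    ext s
    rw [coeff_C]
    split_ifs with hs
    · rw [hs]
    · by_contra h0
      apply hs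
      have e1 := h1 h0
      have e2 := h2 h0
      rw [Finsupp.weight_apply, Finsupp.sum_fintype _ _ (by simp), Fintype.sum_sum_type] at e1 e2
      ext i
      rcases i with i | i
      · simp at e1
        simp [e1 i]
      · simp at e2
        simp [e2 i]
  rw [hP0, Submodule.mem_span_singleton]
  exact ⟨coeff 0 P, by simp [smul_eq_C_mul]⟩

lemma span_one_eq_kSum : Submodule.span ℂ {(1 : X0 p → ℂ)} = kSum p 0 0 {(0, 0)} := by
  simp [kSum, H_zero, Submodule.map_span, Phi_one]

theorem isGKSubmodule_span_one (hp : 1 < p) :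
    IsGKSubmodule p 0 0 (Submodule.span ℂ {(1 : X0 p → ℂ)}) := by
  have h := isGKSubmodule_kSum_int_iff (α := 0) (β := 0) hp (M := {(0, 0)})
  simp only [add_zero, sub_zero, Int.cast_zero] at h
  rw [span_one_eq_kSum, h]
  rintro _ ⟨m₁, m₂⟩ ⟨h1, h2, h3, h4⟩ rfl
  simp at h1 h3
  simp [h1, h3]

/-- For α = β = 0 the lower bounds 1 - p on the degrees are vacuous and the upper bounds hold at (0,
0), so (0, 0) is reachable from every K-type. -/
theorem one_mem_of_isGKSubmodule (hp : 1 < p) {W : Submodule ℂ (X0 p → ℂ)}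
    (hW : IsGKSubmodule p 0 0 W) (h0 : W ≠ ⊥) : (1 : X0 p → ℂ) ∈ W := by
  obtain ⟨M, hM, rfl⟩ := (isGKSubmodule_iff hp).1 hW
  have h := isGKSubmodule_kSum_int_iff (α := 0) (β := 0) hp (M := M)
  simp only [add_zero, sub_zero, Int.cast_zero] at h
  rcases M.eq_empty_or_nonempty with rfl | ⟨m, hm⟩
  · exact absurd kSum_empty h0
  · have h1 : (0, 0) ∈ M := h.1 hW m (0, 0) ⟨by simp, by simp; omega, by simp, by simp; omega⟩ hm
    rw [← Phi_one]
    exact map_H_le_kSum h1 ⟨1, one_mem_H, rfl⟩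

theorem isIrred_and_isUnitary_of_int (hp : 1 < p) {α β : ℤ}
    (h : -p < α ∧ α < 0 ∧ -p < β ∧ β < 0) :
    IsIrred p ((α + β : ℤ) : ℂ) (α - β) ∧ IsUnitary p ((α + β : ℤ) : ℂ) (α - β) := by
  obtain ⟨h1, h2, h3, h4⟩ := h
  have hα : (((α + β : ℤ) : ℂ) + ((α - β : ℤ) : ℂ)) / 2 = ((α : ℝ) : ℂ) := by rw [alpha_eq]; simp
  have hβ : (((α + β : ℤ) : ℂ) - ((α - β : ℤ) : ℂ)) / 2 = ((β : ℝ) : ℂ) := by rw [beta_eq]; simp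
  have h1' : -(p : ℝ) < α := by exact_mod_cast h1
  have h2' : (α : ℝ) < 0 := by exact_mod_cast h2
  have h3' : -(p : ℝ) < β := by exact_mod_cast h3
  have h4' : (β : ℝ) < 0 := by exact_mod_cast h4
  exact ⟨isIrred_of_mem_Ioo hp hα hβ h1' h2' h3' h4', isUnitary_of_mem_Ioo hp hα hβ h1' h2' h3' h4'⟩

lemma spherical_iff (s : ℝ) (p : ℕ) : |2 * s + p| < (p : ℝ) - |(0 : ℤ)| ↔ -p < s ∧ s < 0 := by
  rw [abs_zero, Int.cast_zero, sub_zero, abs_lt]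
  constructor
  · rintro ⟨h1, h2⟩
    exact ⟨by linarith, by linarith⟩
  · rintro ⟨h1, h2⟩
    exact ⟨by linarith, by linarith⟩

end Series

end LightCone

end

theorem lemma4p4 (p : ℕ) (hp : 1 < p) :
    -- the four barriers
    (∀ α β : ℤ,
      (CausesReducibility p α β App ↔ 0 ≤ β) ∧
      (CausesReducibility p α β Apm ↔ 0 ≤ α) ∧
      (CausesReducibility p α β Amp ↔ β ≤ -p) ∧
      (CausesReducibility p α β Amm ↔ α ≤ -p)) ∧
    -- the Hasse diagrams
    (∀ α β : ℤ,
      (-p < α ∧ α < 0 ∧ -p < β ∧ β < 0 →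
        HasHasseDiagram p α β Unit (fun _ => ()) ∅ ∧
        IsIrred p ((α + β : ℤ) : ℂ) (α - β) ∧ IsUnitary p ((α + β : ℤ) : ℂ) (α - β)) ∧
      (0 ≤ α ∧ -p < β ∧ β < 0 →
        HasHasseDiagram p α β (Fin 2) (fun m => if m.1 ≤ α then 0 else 1) ∅) ∧
      (-p < α ∧ α < 0 ∧ 0 ≤ β →
        HasHasseDiagram p α β (Fin 2) (fun m => if m.2 ≤ β then 0 else 1) ∅) ∧
      (-p < α ∧ α < 0 ∧ β ≤ -p →
        HasHasseDiagram p α β (Fin 2) (fun m => if 1 - p - β ≤ m.1 then 0 else 1) ∅) ∧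
      (α ≤ -p ∧ -p < β ∧ β < 0 →
        HasHasseDiagram p α β (Fin 2) (fun m => if 1 - p - α ≤ m.2 then 0 else 1) ∅) ∧
      (0 ≤ α ∧ 0 ≤ β →
        HasHasseDiagram p α β (Fin 2 × Fin 2)
          (fun m => (if m.1 ≤ α then 0 else 1, if m.2 ≤ β then 0 else 1)) {(0, 0)}) ∧
      (α ≤ -p ∧ β ≤ -p →
        HasHasseDiagram p α β (Fin 2 × Fin 2)
          (fun m => (if 1 - p - β ≤ m.1 then 0 else 1, if 1 - p - α ≤ m.2 then 0 else 1))
          {(1, 1)}) ∧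
      (0 ≤ α ∧ β ≤ -p ∧ -p < α + β →
        HasHasseDiagram p α β (WithBot Two)
          (fun m => if α < m.1 then (Sum.inl () : Two) else
            if m.1 < 1 - p - β then (Sum.inr () : Two) else ⊥) ∅) ∧
      (0 ≤ α ∧ β ≤ -p ∧ α + β < -p →
        HasHasseDiagram p α β (WithTop Two)
          (fun m => if m.1 ≤ α then (Sum.inl () : Two) else
            if 1 - p - β ≤ m.1 then (Sum.inr () : Two) else ⊤) ∅) ∧
      (0 ≤ α ∧ β ≤ -p ∧ α + β = -p →
        HasHasseDiagram p α β Two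
          (fun m => if m.1 ≤ α then Sum.inl () else Sum.inr ()) ∅) ∧
      (α ≤ -p ∧ 0 ≤ β ∧ -p < α + β →
        HasHasseDiagram p α β (WithBot Two)
          (fun m => if β < m.2 then (Sum.inl () : Two) else
            if m.2 < 1 - p - α then (Sum.inr () : Two) else ⊥) ∅) ∧
      (α ≤ -p ∧ 0 ≤ β ∧ α + β < -p →
        HasHasseDiagram p α β (WithTop Two)
          (fun m => if m.2 ≤ β then (Sum.inl () : Two) else
            if 1 - p - α ≤ m.2 then (Sum.inr () : Two) else ⊤) ∅) ∧
      (α ≤ -p ∧ 0 ≤ β ∧ α + β = -p →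
        HasHasseDiagram p α β Two
          (fun m => if m.2 ≤ β then Sum.inl () else Sum.inr ()) ∅)) ∧
    -- the unitary axis
    (∀ (a : ℂ) (k : ℤ), a.re = -p → IsUnitary p a k) ∧
    -- the complementary series (`a = α + β` real, `k = α - β`)
    (∀ k : ℤ, |k| < p → ∀ a : ℝ,
      (IsUnitary p a k ↔ |a + p| < p - |k|) ∧ (|a + p| < p - |k| → IsIrred p a k)) ∧
    -- the spherical case `α = β`
    (∀ s : ℝ, (IsUnitary p ((2 * s : ℝ) : ℂ) 0 ↔ -p < s ∧ s < 0) ∧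
      (-p < s ∧ s < 0 → IsIrred p ((2 * s : ℝ) : ℂ) 0)) ∧
    (IsGKSubmodule p 0 0 (Submodule.span ℂ {(1 : X0 p → ℂ)}) ∧
      (∀ g : U p, rho g (1 : X0 p → ℂ) = 1) ∧
      ∀ W : Submodule ℂ (X0 p → ℂ), IsGKSubmodule p 0 0 W → W ≠ ⊥ → (1 : X0 p → ℂ) ∈ W) := by
  refine ⟨fun α β => ⟨causesReducibility_App hp, causesReducibility_Apm hp,
    causesReducibility_Amp hp, causesReducibility_Amm hp⟩, fun α β => ⟨fun h =>
      ⟨hasHasseDiagram_point hp h, isIrred_and_isUnitary_of_int hp h⟩,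
      hasHasseDiagram_alpha_nonneg hp, hasHasseDiagram_beta_nonneg hp, hasHasseDiagram_beta_le hp,
      hasHasseDiagram_alpha_le hp, hasHasseDiagram_nonneg_nonneg hp, hasHasseDiagram_le_le hp,
      hasHasseDiagram_bot_fst hp, hasHasseDiagram_top_fst hp, hasHasseDiagram_two_fst hp,
      hasHasseDiagram_bot_snd hp, hasHasseDiagram_top_snd hp, hasHasseDiagram_two_snd hp⟩,
    fun a k ha => isUnitary_of_re_eq hp ha, complementary_series hp, fun s => ?_,
    isGKSubmodule_span_one hp, fun g => rfl, fun W hW h0 => one_mem_of_isGKSubmodule hp hW h0⟩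
  have h := complementary_series hp 0 (by simp; omega) (2 * s)
  rwa [spherical_iff] at h
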